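/- Let $d,m$ be integers with $1\le m\le d-2$ and let $g:\mathbb R^d\to\mathbb R$ be homogeneous of order $\alpha>0$ (that is, $g(cu)=c^\alpha g(u)$ for all $c>0$, $u\in\mathbb R^d$), of class $C^2$ on $\mathbb R^d\setminus\{0\}$, with $\hat g:=\max_{\mathbb S_{d-1}}g>0$, where $\mathbb S_{d-1}$ is the unit sphere. Let $\mathcal M=\{v\in\mathbb S_{d-1}:g(v)=\hat g\}$. Assume that $\mathcal M$ is an $m$-dimensional $C^2$ embedded manifold without boundary and that, for every $v\in\mathcal M$, the matrix $\frac{g''_{d-1}(v)}{\alpha\hat g}-I_{d-1}$ has rank $d-1-m$, where $g''_{d-1}(v)$ is the Hessian matrix at $v$, in an orthonormal frame, of the restriction of $g$ to the hyperplane tangent to $\mathbb S_{d-1}$ at $v$. For an angle vector $\varphi\in\Pi_{d-1}=[0,\pi)^{d-2}\times[0,2\pi)$ let $\Phi(\varphi)=(\cos\varphi_1,\ \sin\varphi_1\cos\varphi_2,\ \dots,\ \sin\varphi_1\cdots\sin\varphi_{d-2}\cos\varphi_{d-1},\ \sin\varphi_1\cdots\sin\varphi_{d-1})\in\mathbb S_{d-1}$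 and $J(\varphi)=\prod_{j=1}^{d-2}\sin^{d-1-j}\varphi_j$. Let $\Pi^{\rm reg}=\{\varphi\in\Pi_{d-1}:J(\varphi)\ne0\}$, and let $\Sigma=\{v\in\mathbb S_{d-1}:v_{d-1}=v_d=0\}$ be the locus where the coordinates degenerate. Let $\chi>0$ be a random variable independent of the random unit vector $\zeta=\Phi(\nu)$, where the random vector $\nu\in\Pi_{d-1}$ has a density $p_\nu$ with respect to Lebesgue measure which, on $\Pi^{\rm reg}$, is positive, bounded and continuous (for the topology induced by $\Phi$ from the sphere). Assume moreover that $\mathcal M\cap\Sigma$ has zero $m$-dimensional volume and that at each $v\in\mathcal M\cap\Sigma$ the limit of $p_\nu(\varphi)/|J(\varphi)|$, as $\Phi(\varphi)\to v$ with $\varphi\in\Pi^{\rm reg}$, exists and is a positive real number (both conditions are void if $\mathcal M\cap\Sigma=\emptyset$). For a random variable $X$, $w$ a real function and $x_+\in(-\infty,\infty]$, write $X\in GMDA(w,x_+)$ if $x_+$ is the upper endpoint of the distribution of $X$, $w$ is positive near $x_+$ and, for every $t\in\mathbb R$, $\mathbb P\{X>x+t/w(x)\}\sim e^{-t}\,\mathbb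 P\{X>x\}$ as $x\uparrow x_+$. Suppose that $\chi^\alpha\in GMDA(w,x_+)$. Then, as $x\uparrow\hat g x_+$, $$\mathbb P\{g(\chi\zeta)>x\}\sim\frac{h_0}{\bigl(x\,w(x/\hat g)\bigr)^{(d-1-m)/2}}\;\mathbb P\{\chi^\alpha>x/\hat g\},$$ where $$h_0=(2\pi\hat g^2)^{\frac{d-1-m}2}\int_{\mathcal M_\varphi}\frac{p_\nu(\varphi)}{\sqrt{|\det g''_{d-1-m}(\varphi)|}}\,dV_\varphi\in(0,\infty).$$ Here $\mathcal M_\varphi=\{\varphi\in\Pi^{\rm reg}:\Phi(\varphi)\in\mathcal M\}$, $dV_\varphi$ is the $m$-dimensional Euclidean volume element of $\mathcal M_\varphi\subset\mathbb R^{d-1}$, and $\det g''_{d-1-m}(\varphi)$ is the product of the non-zero eigenvalues, with multiplicity, of the Hessian matrix of $g\circ\Phi$ at $\varphi$. In particular $g(\chi\zeta)\in GMDA(\tilde w,\hat g x_+)$ with the correspondingly rescaled function $\tilde w(x)=w(x/\hat g)/\hat g$. -/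

import Mathlib

open MeasureTheory ProbabilityTheory Filter Topology Asymptotics

noncomputable section

namespace PolarChaos

/-- `ℝ^n` with the Euclidean norm. -/
abbrev E (n : ℕ) : Type := EuclideanSpace ℝ (Fin n)

/-! ### Gumbel max-domain of attraction -/

/-- The filter on `ℝ` of `x ↑ a`, for `a ∈ [-∞, ∞]`; for `a = ∞` this is `x → ∞`. -/
def upTo (a : EReal) : Filter ℝ := comap (fun x : ℝ => (x : EReal)) (𝓝[<] a)

/-- The upper endpoint of the distribution of the random variable `X`. -/
def upperEndpoint {Ω : Type*} [MeasurableSpace Ω] (μ : Measure Ω) (X : Ω → ℝ) : EReal :=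
  sSup ((fun x : ℝ => (x : EReal)) '' {x : ℝ | 0 < μ.real {ω | x < X ω}})

/-- `X ∈ GMDA(w, xp)`: `xp` is the upper endpoint of `X`, `w` is positive near `xp`, and
`P(X > x + t / w x) ~ e^{-t} P(X > x)` as `x ↑ xp`, for every real `t`. -/
def IsGMDA {Ω : Type*} [MeasurableSpace Ω] (μ : Measure Ω) (X : Ω → ℝ) (w : ℝ → ℝ)
    (xp : EReal) : Prop :=
  upperEndpoint μ X = xp ∧ (∀ᶠ x in upTo xp, 0 < w x) ∧
    ∀ t : ℝ, (fun x : ℝ => μ.real {ω | x + t / w x < X ω}) ~[upTo xp]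
      fun x : ℝ => Real.exp (-t) * μ.real {ω | x < X ω}

/-! ### Hessians and the set of maximum points on the sphere -/

/-- The matrix of second partial derivatives of `f` at `x`. -/
def hessian {n : ℕ} (f : E n → ℝ) (x : E n) : Matrix (Fin n) (Fin n) ℝ :=
  Matrix.of fun i j =>
    fderiv ℝ (fun y => fderiv ℝ f y (EuclideanSpace.single j 1)) x (EuclideanSpace.single i 1)

/-- The product of the nonzero eigenvalues, with multiplicity. -/
def pseudoDet {n : ℕ} (A : Matrix (Fin n) (Fin n) ℝ) : ℝ :=
  (A.charpoly.roots.filter (fun r => r ≠ 0)).prod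

/-- The maximum of `g` over the unit sphere. -/
def maxVal {d : ℕ} (g : E d → ℝ) : ℝ := sSup (g '' Metric.sphere 0 1)

/-- The set of points of the unit sphere where `g` is maximal. -/
def maxSet {d : ℕ} (g : E d → ℝ) : Set (E d) := {v ∈ Metric.sphere 0 1 | g v = maxVal g}

/-- The Hessian matrix at `v` of `g` restricted to the affine hyperplane `v + span(u)`, in the
coordinates given by the vectors `u`. -/
def tangentHessian {d : ℕ} (g : E d → ℝ) (v : E d) (u : Fin (d - 1) → E d) :
    Matrix (Fin (d - 1)) (Fin (d - 1)) ℝ :=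
  hessian (fun t : E (d - 1) => g (v + ∑ i, t i • u i)) 0

/-- `M` is an `m`-dimensional embedded `C²` submanifold of `ℝ^d` without boundary
(existence of slice charts). -/
def IsC2Submanifold {d : ℕ} (m : ℕ) (M : Set (E d)) : Prop :=
  ∀ v ∈ M, ∃ e : OpenPartialHomeomorph (E d) (E d), v ∈ e.source ∧
    ContDiffOn ℝ 2 e e.source ∧ ContDiffOn ℝ 2 e.symm e.target ∧
    e '' (e.source ∩ M) = {z ∈ e.target | ∀ i : Fin d, m ≤ i.val → z i = 0}

/-! ### Hyperspherical coordinates (indices start at `0`) -/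

/-- The point of the unit sphere with angular coordinates `φ`. -/
def sphPoint {d : ℕ} (φ : E (d - 1)) : E d :=
  WithLp.toLp 2 fun i : Fin d =>
    (∏ j : Fin (d - 1), if j.val < i.val then Real.sin (φ j) else 1) *
      (if h : i.val < d - 1 then Real.cos (φ ⟨i.val, h⟩) else 1)

/-- The domain `[0,π)^{d-2} × [0,2π)` of the angular coordinates. -/
def angleBox (d : ℕ) : Set (E (d - 1)) :=
  {φ | ∀ j : Fin (d - 1), 0 ≤ φ j ∧
    φ j < if j.val + 1 = d - 1 then 2 * Real.pi else Real.pi}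

/-- The Jacobian determinant `sin^{d-2} φ_0 ⋯ sin φ_{d-3}` of the hyperspherical coordinates at
radius `1`. -/
def sphJac {d : ℕ} (φ : E (d - 1)) : ℝ :=
  ∏ j : Fin (d - 1), Real.sin (φ j) ^ (d - 2 - j.val)

/-- The angular coordinates at which the coordinate system is non-degenerate. -/
def regAngles (d : ℕ) : Set (E (d - 1)) := {φ ∈ angleBox d | sphJac φ ≠ 0}

/-- The points of the sphere at which the coordinate system degenerates: the last two Cartesian
coordinates vanish. -/
def sphSing (d : ℕ) : Set (E d) :=
  {v ∈ Metric.sphere 0 1 | ∀ i : Fin d, d ≤ i.val + 2 → v i = 0}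

/-- Continuity of a function of the angles at the non-degenerate angles, for the topology induced
from the unit sphere. -/
def AngularContinuous {d : ℕ} (p : E (d - 1) → ℝ) : Prop :=
  @ContinuousOn (E (d - 1)) ℝ (TopologicalSpace.induced sphPoint inferInstance) inferInstance
    p (regAngles d)

/-- The maximum set in angular coordinates (at non-degenerate angles). -/
def angularMaxSet {d : ℕ} (g : E d → ℝ) : Set (E (d - 1)) :=
  {φ ∈ regAngles d | sphPoint φ ∈ maxSet g}

/-- The integrand `p(φ) / √|det g''_{d-1-m}(φ)|` of the leading constant, where the determinant is
the product of the nonzero eigenvalues of the Hessian of `g` in the angular coordinates. -/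
def leadingIntegrand {d : ℕ} (g : E d → ℝ) (p : E (d - 1) → ℝ) (φ : E (d - 1)) : ℝ :=
  p φ / √|pseudoDet (hessian (fun ψ : E (d - 1) => g (sphPoint ψ)) φ)|

/-- The leading constant `h₀`; the integral is with respect to the `m`-dimensional Euclidean
volume in the space of angles. -/
def leadingConst {d : ℕ} (m : ℕ) (g : E d → ℝ) (p : E (d - 1) → ℝ) : ℝ :=
  (2 * Real.pi * maxVal g ^ 2) ^ (((d : ℝ) - 1 - m) / 2) *
    ∫ φ in angularMaxSet g, leadingIntegrand g p φ ∂(Measure.euclideanHausdorffMeasure m)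

end PolarChaos

end

/-! ### Tails in the Gumbel domain of attraction. -/

noncomputable section

namespace PolarChaos

/-! Let `T` be the tail of `χ ^ α`, `Q` the law of the direction, and `k = d - 1 - m`. By
homogeneity `g (χ ζ) = χ ^ α * g ζ`, so conditioning on the direction (`ofReal_tail_eq_lintegral`)
gives P(g (χ ζ) > maxVal g * y) = T y * ∫ f_y (A_y * (maxVal g / g x - 1)) dQ(x), where `A_y = y * w
y`, `f_y s = T (y + s / w y) / T y`, and the integrand is 0 where `g ≤ 0`. The Gumbel condition
yields `A_y → ∞` and `f_y s → exp (-s)`, together with bounds `C / (1 + s) ^ N` for every `N`,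
uniform in `y` near the endpoint (`IsGumbelTail.isExpKernel`). This is therefore a Laplace integral
with large parameter `A_y`, whose phase vanishes on the sphere exactly on the maximum set.

The rank condition says that this set of minima of the phase is non-degenerate in the sense of Morse
and Bott. It is stated in tangent hyperplanes; to carry it to an arbitrary chart of the sphere one
uses `defect`, the function `maxVal g * ‖x‖ ^ α - g x`. It is nonnegative on the punctured space, so
points of the maximum set are genuine critical points and its second derivative transforms as a
bilinear form (`IsSphereChart.rank_hessian`). In a chart the zero set of the phase is then a graph
of small slope over the kernel of the Hessian, and the phase is squeezed between multiples close to
1 of half the Hessian form of the normal displacement (`exists_isMinGraph`). Dilating the normal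
directions by `A_y ^ (-1/2)` and passing to the limit by dominated convergence leaves a Gaussian
integral, hence the pseudo-determinant (`tendsto_laplace_graph`, `exists_nhds_laplace`).

To globalize, the rescaled integrands are regarded as measures on the sphere and compared with a
limit measure carried by the maximum set. At maximum points with regular angles the angular chart
gives two-sided comparison (`isLocallyClose_of_mem`); off the maximum set both sides are negligible
(`isLocallyClose_of_notMem`). Where the angles degenerate an upper bound suffices: in the
orthographic chart the law of the direction is dominated by Lebesgue measure, and the degenerate
maximum points are null for the resulting majorant (`exists_majorant_of_mem_sphSing`).
`tendsto_measure_univ_of_local` glues these estimates. It also proves that the limit mass is finite,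
which is the integrability of the leading integrand. Finally `A_y` is asymptotically unchanged by
shifts `y + t / w y`, so the tail of `g (χ ζ)` inherits the Gumbel property from `T`. -/

/-- A family of functions `f y` converging to `exp (-s)` with uniform polynomial decay, together
with a scale `A y` tending to infinity. -/
structure IsExpKernel {ι : Type*} (l : Filter ι) (A : ι → ℝ) (f : ι → ℝ → ℝ) : Prop where
  scale : Tendsto A l atTop
  nonneg : ∀ y s, 0 ≤ f y s
  meas : ∀ y, Measurable (f y)
  anti : ∀ᶠ y in l, Antitone (f y)
  lim : ∀ s, 0 ≤ s → Tendsto (fun y => f y s) l (𝓝 (Real.exp (-s)))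
  bound : ∀ N : ℕ, ∃ C : ℝ, 0 < C ∧ ∀ᶠ y in l, ∀ s, 0 ≤ s → f y s ≤ C / (1 + s) ^ N

lemma eventually_upTo_iff {a : EReal} (ha : ⊥ < a) {P : ℝ → Prop} :
    (∀ᶠ x in upTo a, P x) ↔ ∃ b : ℝ, (b : EReal) < a ∧ ∀ x : ℝ, b < x → (x : EReal) < a → P x := by
  unfold upTo
  rw [eventually_comap]
  constructor
  · intro h
    have h2 := (mem_nhdsLT_iff_exists_Ioo_subset' ha).1 h
    obtain ⟨l, hl, hsub⟩ := h2
    obtain ⟨b, hb1, hb2⟩ := EReal.lt_iff_exists_real_btwn.1 (show l < a from hl)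
    refine ⟨b, hb2, fun x hx hxa => ?_⟩
    exact hsub (show (x : EReal) ∈ Set.Ioo l a from
      ⟨hb1.trans (by exact_mod_cast hx), hxa⟩) x rfl
  · rintro ⟨b, hb, h⟩
    refine (mem_nhdsLT_iff_exists_Ioo_subset' ha).2 ⟨b, hb, ?_⟩
    rintro z hz x rfl
    exact h x (by exact_mod_cast hz.1) hz.2

lemma upTo_neBot {a : EReal} (ha : ⊥ < a) : (upTo a).NeBot := by
  rw [neBot_iff]
  intro h
  have : ∀ᶠ x in upTo a, False := by rw [h]; exact eventually_bot
  obtain ⟨b, hb, h⟩ := (eventually_upTo_iff ha).1 this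
  obtain ⟨c, hc1, hc2⟩ := EReal.lt_iff_exists_real_btwn.1 hb
  exact h c (by exact_mod_cast hc1) hc2

instance upTo_isCountablyGenerated (a : EReal) : (upTo a).IsCountablyGenerated := by
  unfold upTo; infer_instance

lemma eventually_upTo_lt {a : EReal} (ha : ⊥ < a) : ∀ᶠ x : ℝ in upTo a, (x : EReal) < a := by
  rw [eventually_upTo_iff ha]
  obtain ⟨c, hc1, hc2⟩ := EReal.lt_iff_exists_real_btwn.1 ha
  exact ⟨c, hc2, fun x _ h => h⟩

lemma eventually_upTo_gt {a : EReal} (ha : ⊥ < a) {b : ℝ} (hb : (b : EReal) < a) :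
    ∀ᶠ x in upTo a, b < x := by
  rw [eventually_upTo_iff ha]
  exact ⟨b, hb, fun x h _ => h⟩

/-- A tail function in the Gumbel domain of attraction. -/
structure IsGumbelTail (T w : ℝ → ℝ) (a : EReal) : Prop where
  pos_end : 0 < a
  anti : Antitone T
  nonneg : ∀ x, 0 ≤ T x
  one : ∀ x, x < 0 → T x = 1
  pos : ∀ x : ℝ, (x : EReal) < a → 0 < T x
  le_of_pos : ∀ x : ℝ, 0 < T x → (x : EReal) ≤ a
  wpos : ∀ᶠ x in upTo a, 0 < w x
  ratio : ∀ t : ℝ, Tendsto (fun x => T (x + t / w x) / T x) (upTo a) (𝓝 (Real.exp (-t)))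

namespace IsGumbelTail

variable {T w : ℝ → ℝ} {a : EReal}

lemma bot_lt (h : IsGumbelTail T w a) : ⊥ < a := lt_trans (by simp) h.pos_end

/-- A shift by `(t + 1) / w x` still leaves a positive tail, so the shifted point is at most `a`.
The spare unit makes the inequality for `t` strict. -/
lemma eventually_shift_lt (h : IsGumbelTail T w a) (t : ℝ) :
    ∀ᶠ x in upTo a, ((x + t / w x : ℝ) : EReal) < a := by
  have h1 := (h.ratio (t + 1)).eventually (lt_mem_nhds (Real.exp_pos _))
  filter_upwards [h1, h.wpos, eventually_upTo_lt h.bot_lt] with x hx hw hxa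
  have hp := h.pos x hxa
  have h3 : 0 < T (x + (t + 1) / w x) := by
    by_contra hc
    have : T (x + (t + 1) / w x) = 0 := le_antisymm (not_lt.1 hc) (h.nonneg _)
    simp [this] at hx
  refine lt_of_lt_of_le ?_ (h.le_of_pos _ h3)
  have : t / w x < (t + 1) / w x := by gcongr; linarith
  exact_mod_cast (by linarith : x + t / w x < x + (t + 1) / w x)

/-- Monotonicity gives a limit `c ≥ 0`. Passing to the limit in `c ≤ T (x + 1 / w x)` yields `c ≤
exp (-1) * c`, so `c = 0`: a finite endpoint carries no atom. -/
lemma tendsto_zero (h : IsGumbelTail T w a) : Tendsto T (upTo a) (𝓝 0) := by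
  set c := sInf (T '' {x : ℝ | (x : EReal) < a}) with hc
  have hbdd : BddBelow (T '' {x : ℝ | (x : EReal) < a}) :=
    ⟨0, by rintro _ ⟨x, _, rfl⟩; exact h.nonneg x⟩
  have hne : (T '' {x : ℝ | (x : EReal) < a}).Nonempty :=
    ⟨T 0, 0, by simpa using h.pos_end, rfl⟩
  have hlim : Tendsto T (upTo a) (𝓝 c) := by
    rw [tendsto_order]
    constructor
    · intro b hb
      filter_upwards [eventually_upTo_lt h.bot_lt] with x hx
      exact hb.trans_le (csInf_le hbdd ⟨x, hx, rfl⟩)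
    · intro b hb
      obtain ⟨_, ⟨x, hx, rfl⟩, hxb⟩ := exists_lt_of_csInf_lt hne hb
      filter_upwards [eventually_upTo_gt h.bot_lt hx] with y hy
      exact (h.anti hy.le).trans_lt hxb
  have hc0 : 0 ≤ c := le_csInf hne (by rintro _ ⟨x, _, rfl⟩; exact h.nonneg x)
  have h2 : ∀ᶠ x in upTo a, c ≤ (T (x + 1 / w x) / T x) * T x := by
    filter_upwards [h.eventually_shift_lt 1, eventually_upTo_lt h.bot_lt] with x hx hxa
    rw [div_mul_cancel₀ _ (h.pos x hxa).ne']
    exact csInf_le hbdd ⟨_, hx, rfl⟩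
  have := upTo_neBot h.bot_lt
  have h3 := ge_of_tendsto ((h.ratio 1).mul hlim) h2
  have h4 : Real.exp (-1) < 1 := by rw [Real.exp_lt_one_iff]; norm_num
  have : c = 0 := by nlinarith
  rwa [this] at hlim

/-- If `y * w y < C`, then `y - C / w y` is negative and the tail there is 1. But that tail is
asymptotic to `exp C * T y`, which tends to 0. -/
lemma eventually_scale_ge (h : IsGumbelTail T w a) (C : ℝ) : ∀ᶠ y in upTo a, C ≤ y * w y := by
  have h1 := ((h.ratio (-C)).mul h.tendsto_zero)
  rw [mul_zero] at h1
  have h0 : ((0 : ℝ) : EReal) < a := by simpa using h.pos_end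
  filter_upwards [h1.eventually (gt_mem_nhds one_pos), h.wpos, eventually_upTo_lt h.bot_lt]
    with x hx hw hxa
  rw [div_mul_cancel₀ _ (h.pos x hxa).ne'] at hx
  by_contra hc
  rw [h.one] at hx
  · exact lt_irrefl _ hx
  · rw [neg_div, ← sub_eq_add_neg, sub_neg, lt_div_iff₀ hw]
    linarith

lemma tendsto_scale (h : IsGumbelTail T w a) : Tendsto (fun y => y * w y) (upTo a) atTop :=
  tendsto_atTop.2 h.eventually_scale_ge

lemma tendsto_shift (h : IsGumbelTail T w a) (t : ℝ) :
    Tendsto (fun y => y + t / w y) (upTo a) (upTo a) := by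
  intro s hs
  obtain ⟨b, hb, hs⟩ := (eventually_upTo_iff h.bot_lt).1 (show ∀ᶠ x in upTo a, x ∈ s from hs)
  have h1 := ((h.ratio t).mul h.tendsto_zero)
  rw [mul_zero] at h1
  rw [mem_map]
  filter_upwards [h1.eventually (gt_mem_nhds (h.pos b hb)), h.eventually_shift_lt t,
    eventually_upTo_lt h.bot_lt] with x hx hx2 hxa
  refine hs _ ?_ hx2
  rw [div_mul_cancel₀ _ (h.pos x hxa).ne'] at hx
  by_contra hc
  exact absurd (h.anti (not_lt.1 hc)) (not_le.2 hx)

/-- The auxiliary function `1 / w` is self-neglecting. Shifting first by `t / w y` and then by one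
unit at the new point multiplies the tail by `exp (-(t + 1))` in the limit. The same point is a
shift of `y` by `t` plus the weight ratio, in units of `1 / w y`; comparison with the shifts by `t +
b` and monotonicity of `T` place the ratio above every `b < 1` and below every `b > 1`. -/
lemma tendsto_weight_ratio (h : IsGumbelTail T w a) (t : ℝ) :
    Tendsto (fun y => w y / w (y + t / w y)) (upTo a) (𝓝 1) := by
  have hshift := h.tendsto_shift t
  have hA : Tendsto (fun y => T (y + t / w y + 1 / w (y + t / w y)) / T y) (upTo a)
      (𝓝 (Real.exp (-(t + 1)))) := by
    have := ((h.ratio 1).comp hshift).mul (h.ratio t)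
    rw [← Real.exp_add] at this
    refine (this.congr' ?_).trans (by rw [show -1 + -t = -(t+1) by ring])
    filter_upwards [hshift.eventually (eventually_upTo_lt h.bot_lt)] with y hy
    have := (h.pos _ hy).ne'
    simp only [Function.comp]
    field_simp
  have key : ∀ y, 0 < w y → 0 < w (y + t / w y) →
      y + t / w y + 1 / w (y + t / w y) = y + (t + w y / w (y + t / w y)) / w y := by
    intro y h1 h2
    field_simp
    ring
  rw [tendsto_order]
  constructor
  · intro b hb
    have hB := h.ratio (t + b)
    have : Real.exp (-(t+1)) < Real.exp (-(t+b)) := Real.exp_lt_exp.2 (by linarith)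
    filter_upwards [hA.eventually_lt hB this, h.wpos, hshift.eventually h.wpos,
      eventually_upTo_lt h.bot_lt] with y hy hw hw2 hya
    by_contra hc
    rw [not_lt] at hc
    rw [div_lt_div_iff_of_pos_right (h.pos y hya), key y hw hw2] at hy
    refine absurd hy (not_lt.2 (h.anti ?_))
    gcongr
  · intro b hb
    have hB := h.ratio (t + b)
    have : Real.exp (-(t+b)) < Real.exp (-(t+1)) := Real.exp_lt_exp.2 (by linarith)
    filter_upwards [hB.eventually_lt hA this, h.wpos, hshift.eventually h.wpos,
      eventually_upTo_lt h.bot_lt] with y hy hw hw2 hya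
    by_contra hc
    rw [not_lt] at hc
    rw [div_lt_div_iff_of_pos_right (h.pos y hya), key y hw hw2] at hy
    refine absurd hy (not_lt.2 (h.anti ?_))
    gcongr

lemma tendsto_scale_ratio (h : IsGumbelTail T w a) (t : ℝ) :
    Tendsto (fun y => (y * w y) / ((y + t / w y) * w (y + t / w y))) (upTo a) (𝓝 1) := by
  have h1 : Tendsto (fun y => 1 + t / (y * w y)) (upTo a) (𝓝 (1 + 0)) :=
    tendsto_const_nhds.add (tendsto_const_nhds.div_atTop h.tendsto_scale)
  have h2 := (h.tendsto_weight_ratio t).div h1 (by simp)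
  rw [add_zero, div_one] at h2
  have h0 : ((0 : ℝ) : EReal) < a := by simpa using h.pos_end
  refine h2.congr' ?_
  filter_upwards [h.wpos, eventually_upTo_gt h.bot_lt h0] with y hw hy
  simp only [Pi.div_apply]
  have e : 1 + t / (y * w y) = (y + t / w y) / y := by field_simp
  rw [e, div_div_eq_mul_div, div_mul_eq_mul_div, div_div, mul_comm (w y),
    mul_comm (w (y + t / w y))]

/-- Each step of length `1 / w` at least halves the tail, since `exp (-1) < 1 / 2`, while the step
length grows by a factor at most `1 + ε`. Geometric decay against slow geometric growth of the
distance gives decay of any prescribed polynomial order. -/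
lemma tail_bound (h : IsGumbelTail T w a) (N : ℕ) : ∃ C : ℝ, 0 < C ∧ ∀ᶠ y in upTo a, ∀ s, 0 ≤ s →
    T (y + s / w y) / T y ≤ C / (1 + s) ^ N := by
  -- With this `ε`, the distance after `j` steps raised to the power `N` grows no faster than `2 ^
  -- j`.
  obtain ⟨ε, hε, hεN⟩ : ∃ ε : ℝ, 0 < ε ∧ (1 + ε) ^ N ≤ 2 := by
    have : Tendsto (fun ε : ℝ => (1 + ε) ^ N) (𝓝[>] 0) (𝓝 ((1 + 0) ^ N)) :=
      (Continuous.tendsto (by fun_prop) 0).mono_left nhdsWithin_le_nhds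
    have h2 := this.eventually (gt_mem_nhds (show ((1 + 0 : ℝ)) ^ N < 2 by norm_num))
    obtain ⟨ε, h3, h4⟩ := (h2.and self_mem_nhdsWithin).exists
    exact ⟨ε, h4, h3.le⟩
  have hhalf : Real.exp (-1) < 1 / 2 := by
    rw [Real.exp_neg, inv_eq_one_div]
    have := Real.exp_one_gt_d9
    exact one_div_lt_one_div_of_lt (by norm_num) (by linarith)
  have ev : ∀ᶠ y in upTo a, (T (y + 1 / w y) ≤ 1 / 2 * T y) ∧
      (1 / w (y + 1 / w y) ≤ (1 + ε) / w y) ∧ 0 < w y ∧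
        ((y + 1 / w y : ℝ) : EReal) < a := by
    filter_upwards [(h.ratio 1).eventually (gt_mem_nhds hhalf),
      (h.tendsto_weight_ratio 1).eventually (gt_mem_nhds (show (1:ℝ) < 1 + ε by linarith)),
      h.wpos, h.eventually_shift_lt 1, eventually_upTo_lt h.bot_lt,
      (h.tendsto_shift 1).eventually h.wpos] with y h1 h2 h3 h4 h5 h6
    refine ⟨?_, ?_, h3, h4⟩
    · rw [div_lt_iff₀ (h.pos y h5)] at h1
      exact h1.le
    · rw [div_le_div_iff₀ h6 h3]
      rw [div_lt_iff₀ h6] at h2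
      linarith
  obtain ⟨y0, hy0, ev⟩ := (eventually_upTo_iff h.bot_lt).1 ev
  -- `b j` bounds the distance covered by `j` steps in units of `1 / w y`: after one unit step, the
  -- remaining ones are measured in a unit larger by at most `1 + ε`. In closed form `ε * b j + 1 =
  -- (1 + ε) ^ j`.
  let b : ℕ → ℝ := fun j => Nat.rec 0 (fun _ x => 1 + (1 + ε) * x) j
  have b0 : b 0 = 0 := rfl
  have bs : ∀ j, b (j+1) = 1 + (1 + ε) * b j := fun j => rfl
  have bnn : ∀ j, 0 ≤ b j := by
    intro j
    induction j with
    | zero => simp [b0]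
    | succ j ih => rw [bs]; positivity
  have bge : ∀ j : ℕ, (j : ℝ) ≤ b j := by
    intro j
    induction j with
    | zero => simp [b0]
    | succ j ih => rw [bs]; push_cast; nlinarith [bnn j]
  have ble : ∀ j : ℕ, ε * b j + 1 = (1 + ε) ^ j := by
    intro j
    induction j with
    | zero => simp [b0]
    | succ j ih => rw [bs, pow_succ, ← ih]; ring
  have claim : ∀ j : ℕ, ∀ y : ℝ, y0 < y → (y : EReal) < a →
      T (y + b j / w y) ≤ (1 / 2) ^ j * T y := by
    intro j
    induction j with
    | zero => intro y _ _; simp [b0]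
    | succ j ih =>
      intro y hy hya
      obtain ⟨h1, h2, h3, h4⟩ := ev y hy hya
      have hy' : y0 < y + 1 / w y := hy.trans (by simpa using h3)
      calc T (y + b (j+1) / w y) ≤ T (y + 1 / w y + b j / w (y + 1 / w y)) := by
            apply h.anti
            have h5 := mul_le_mul_of_nonneg_right h2 (bnn j)
            rw [bs, add_div, add_assoc, div_eq_mul_one_div (b j), mul_comm (b j),
              mul_div_right_comm]
            linarith
        _ ≤ (1/2)^j * T (y + 1 / w y) := ih _ hy' h4
        _ ≤ (1/2)^j * (1 / 2 * T y) := by gcongr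
        _ = _ := by ring
  refine ⟨2 * (1 + 1 / ε) ^ N, by positivity, ?_⟩
  rw [eventually_upTo_iff h.bot_lt]
  refine ⟨y0, hy0, fun y hy hya s hs => ?_⟩
  obtain ⟨-, -, hw, -⟩ := ev y hy hya
  have hex : ∃ j : ℕ, s < b (j + 1) := by
    obtain ⟨j, hj⟩ := exists_nat_gt s
    exact ⟨j, hj.trans_le ((bge j).trans (by rw [bs]; nlinarith [bnn j]))⟩
  classical
  -- Here `b j ≤ s < b (j + 1)`: the left inequality gives the tail bound `2 ^ (-j)`, the right one
  -- turns `j` into a power of `1 + s`.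
  set j := Nat.find hex
  have hj1 : s < b (j + 1) := Nat.find_spec hex
  have hj2 : b j ≤ s := by
    rcases Nat.eq_zero_or_pos j with h0 | h0
    · rw [h0, b0]; exact hs
    · have := Nat.find_min hex (show j - 1 < j by omega)
      rw [Nat.sub_add_cancel h0] at this
      exact not_lt.1 this
  have h1 : T (y + s / w y) / T y ≤ (1 / 2) ^ j := by
    rw [div_le_iff₀ (h.pos y hya)]
    refine (h.anti ?_).trans (claim j y hy hya)
    gcongr
  refine h1.trans ?_
  rw [le_div_iff₀ (by positivity)]
  have h2 : 1 + s ≤ (1 + 1 / ε) * (1 + ε) ^ (j + 1) := by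
    have : 1 + 1 / ε * (1 + ε) ^ (j+1) = b (j+1) + 1 + 1 / ε := by
      rw [← ble]; field_simp; ring
    have h3 : 1 ≤ (1 + ε) ^ (j+1) := one_le_pow₀ (by linarith)
    nlinarith [show 0 < 1 / ε by positivity]
  calc (1 / 2 : ℝ) ^ j * (1 + s) ^ N ≤ (1/2) ^ j * ((1 + 1 / ε) * (1 + ε) ^ (j + 1)) ^ N := by gcongr
    _ = (1/2)^j * (1 + 1 / ε)^N * ((1 + ε) ^ N) ^ (j+1) := by
        rw [mul_pow, ← pow_mul, ← pow_mul, mul_comm (j+1) N]; ring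
    _ ≤ (1/2)^j * (1 + 1 / ε)^N * 2 ^ (j+1) := by gcongr
    _ = 2 * (1 + 1 / ε) ^ N * ((1/2)^j * 2^j) := by ring
    _ = _ := by rw [← mul_pow]; norm_num

/-- The normalized tails form an exponential kernel. -/
lemma isExpKernel (h : IsGumbelTail T w a) :
    IsExpKernel (upTo a) (fun y => y * w y) (fun y s => T (y + s / w y) / T y) where
  scale := h.tendsto_scale
  nonneg y s := div_nonneg (h.nonneg _) (h.nonneg _)
  meas y := (h.anti.measurable.comp (by fun_prop)).div_const _
  anti := by
    filter_upwards [h.wpos] with y hw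
    intro s t hst
    have : T (y + t / w y) ≤ T (y + s / w y) := h.anti (by gcongr)
    exact div_le_div_of_nonneg_right this (h.nonneg _)
  lim s _ := h.ratio s
  bound := h.tail_bound

end IsGumbelTail

/-- The tail of a random variable in the Gumbel domain of attraction. -/
lemma IsGMDA.isGumbelTail {Ω : Type*} [MeasurableSpace Ω] {μ : Measure Ω} [IsProbabilityMeasure μ]
    {X : Ω → ℝ} {w : ℝ → ℝ} {a : EReal} (h : IsGMDA μ X w a) (hX : ∀ᵐ ω ∂μ, 0 < X ω) :
    IsGumbelTail (fun x => μ.real {ω | x < X ω}) w a := by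
  have hanti : Antitone (fun x => μ.real {ω | x < X ω}) := fun x y hxy =>
    measureReal_mono fun ω (hω : y < X ω) => hxy.trans_lt hω
  have hle : ∀ x : ℝ, 0 < μ.real {ω | x < X ω} → (x : EReal) ≤ a := by
    intro x hx
    rw [← h.1]
    exact le_sSup ⟨x, hx, rfl⟩
  have hpos : ∀ x : ℝ, (x : EReal) < a → 0 < μ.real {ω | x < X ω} := by
    intro x hx
    rw [← h.1] at hx
    obtain ⟨_, ⟨y, hy, rfl⟩, hxy⟩ := lt_sSup_iff.1 hx
    exact lt_of_lt_of_le hy (hanti (EReal.coe_le_coe_iff.1 hxy.le))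
  -- Almost sure positivity gives positive probability to some event `X > 1 / (n + 1)`, so the
  -- endpoint is strictly positive.
  have ha : 0 < a := by
    have h1 : ∃ n : ℕ, 0 < μ {ω | (1 / ((n : ℝ) + 1)) < X ω} := by
      by_contra hc
      push Not at hc
      have h2 : μ (⋃ n : ℕ, {ω | (1 / ((n : ℝ) + 1)) < X ω}) = 0 :=
        measure_iUnion_null fun n => le_antisymm (hc n) bot_le
      have h3 : ∀ᵐ ω ∂μ, ω ∈ ⋃ n : ℕ, {ω | (1 / ((n : ℝ) + 1)) < X ω} := by
        filter_upwards [hX] with ω hω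
        obtain ⟨n, hn⟩ := exists_nat_one_div_lt hω
        exact Set.mem_iUnion.2 ⟨n, hn⟩
      have h4 : ∀ᵐ ω ∂μ, False := by
        filter_upwards [h3, measure_eq_zero_iff_ae_notMem.1 h2] with ω h5 h6 using h6 h5
      simp at h4
      exact IsProbabilityMeasure.ne_zero μ h4
    obtain ⟨n, hn⟩ := h1
    refine lt_of_lt_of_le ?_ (hle (1 / ((n : ℝ) + 1))
      (ENNReal.toReal_pos hn.ne' (measure_ne_top _ _)))
    exact_mod_cast (by positivity : (0 : ℝ) < 1 / ((n : ℝ) + 1))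
  have hbot : ⊥ < a := lt_trans (by simp) ha
  refine ⟨ha, hanti, fun x => measureReal_nonneg, fun x hx => ?_, hpos, hle, h.2.1, fun t => ?_⟩
  · have : μ {ω | x < X ω} = 1 := by
      rw [← measure_univ (μ := μ)]
      apply measure_congr
      filter_upwards [hX] with ω hω
      exact propext ⟨fun _ => trivial, fun _ => hx.trans hω⟩
    simp [Measure.real, this]
  · have h1 := h.2.2 t
    have hne : ∀ᶠ x in upTo a, Real.exp (-t) * μ.real {ω | x < X ω} ≠ 0 := by
      filter_upwards [eventually_upTo_lt hbot] with x hx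
      exact (mul_pos (Real.exp_pos _) (hpos x hx)).ne'
    have h2 := ((isEquivalent_iff_tendsto_one hne).1 h1).mul_const (Real.exp (-t))
    rw [one_mul] at h2
    refine h2.congr' ?_
    filter_upwards [eventually_upTo_lt hbot] with x hx
    have := (hpos x hx).ne'
    simp only [Pi.div_apply]
    field_simp

end PolarChaos
end

/-! ### Pseudo-determinants and Gaussian integrals transverse to the kernel. -/

noncomputable section

namespace PolarChaos

section PseudoDet

variable {n k : ℕ} {A : Matrix (Fin n) (Fin n) ℝ}

lemma pseudoDet_eq_prod (hA : A.IsHermitian) :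
    pseudoDet A = ∏ i with hA.eigenvalues i ≠ 0, hA.eigenvalues i := by
  unfold pseudoDet
  rw [hA.roots_charpoly_eq_eigenvalues, Multiset.filter_map]
  rfl

lemma card_eigenvalues_ne_zero (hA : A.IsHermitian) (hk : A.rank = k) :
    (Finset.univ.filter fun i => hA.eigenvalues i ≠ 0).card = k := by
  rw [← hk, hA.rank_eq_card_non_zero_eigs, Fintype.card_subtype]

/-- The characteristic polynomial is `X ^ (n - k)` times the product of `X - λ` over the nonzero
eigenvalues, so its lowest nonzero coefficient is the pseudo-determinant up to sign. Unlike the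
pseudo-determinant, the coefficient is continuous in the matrix; the two agree as long as the rank
stays `k`. -/
lemma abs_pseudoDet_eq_abs_coeff (hA : A.IsHermitian) (hk : A.rank = k) :
    |pseudoDet A| = |A.charpoly.coeff (n - k)| := by
  have hcard := card_eigenvalues_ne_zero hA hk
  have hcard0 : (Finset.univ.filter fun i => ¬ hA.eigenvalues i ≠ 0).card = n - k := by
    have := Finset.card_filter_add_card_filter_not (s := (Finset.univ : Finset (Fin n)))
      (fun i => hA.eigenvalues i ≠ 0)
    simp only [Finset.card_univ, Fintype.card_fin] at this
    omega
  have h1 : A.charpoly = (∏ i with hA.eigenvalues i ≠ 0,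
      (Polynomial.X - Polynomial.C (hA.eigenvalues i))) * Polynomial.X ^ (n - k) := by
    rw [hA.charpoly_eq, ← Finset.prod_filter_mul_prod_filter_not Finset.univ
      (fun i => hA.eigenvalues i ≠ 0)]
    congr 1
    rw [← hcard0, ← Finset.prod_const]
    refine Finset.prod_congr rfl fun i hi => ?_
    have : hA.eigenvalues i = 0 := by simpa using hi
    simp [this]
  rw [h1, pseudoDet_eq_prod hA, Polynomial.coeff_mul_X_pow', if_pos le_rfl, Nat.sub_self,
    Polynomial.coeff_zero_eq_eval_zero, Polynomial.eval_prod, Finset.abs_prod, Finset.abs_prod]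
  simp

lemma pseudoDet_pos_abs (hA : A.IsHermitian) : 0 < |pseudoDet A| := by
  rw [abs_pos, pseudoDet_eq_prod hA, Finset.prod_ne_zero_iff]
  intro i hi
  simpa using hi

lemma rank_neg (A : Matrix (Fin n) (Fin n) ℝ) : (-A).rank = A.rank := by
  have h := Matrix.rank_mul_eq_left_of_isUnit_det (-1 : Matrix (Fin n) (Fin n) ℝ) A
    (by rw [Matrix.det_neg]; simp)
  simpa using h

/-- The characteristic polynomial of `-A` is `(-1) ^ n` times that of `A` evaluated at `-X`, so only
signs of coefficients change. -/
lemma abs_coeff_charpoly_neg (A : Matrix (Fin n) (Fin n) ℝ) (j : ℕ) :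
    |(-A).charpoly.coeff j| = |A.charpoly.coeff j| := by
  have h : (-A).charpoly = (-1) ^ n * A.charpoly.comp (-Polynomial.X) := by
    unfold Matrix.charpoly
    rw [← Polynomial.coe_compRingHom_apply, RingHom.map_det]
    have : Matrix.charmatrix (-A) = -((Polynomial.compRingHom (-Polynomial.X)).mapMatrix
        (Matrix.charmatrix A)) := by
      ext1 i j
      by_cases hij : i = j
      · subst hij; simp
        ring
      · simp [Matrix.charmatrix_apply_ne _ _ _ hij]
    rw [this, Matrix.det_neg]
    simp
  rw [h, show ((-1 : Polynomial ℝ) ^ n) = Polynomial.C ((-1) ^ n) by simp,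
    Polynomial.coeff_C_mul, show (-Polynomial.X : Polynomial ℝ) = Polynomial.C (-1) * Polynomial.X
      by simp, Polynomial.comp_C_mul_X_coeff]
  simp [abs_mul]

lemma abs_pseudoDet_neg (hA : A.IsHermitian) : |pseudoDet (-A)| = |pseudoDet A| := by
  rw [abs_pseudoDet_eq_abs_coeff hA rfl, abs_pseudoDet_eq_abs_coeff hA.neg rfl,
    abs_coeff_charpoly_neg, rank_neg]

lemma continuous_charpoly_coeff (j : ℕ) :
    Continuous fun A : Matrix (Fin n) (Fin n) ℝ => A.charpoly.coeff j := by
  have h : ∀ A : Matrix (Fin n) (Fin n) ℝ, A.charpoly.coeff j =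
      MvPolynomial.eval (fun p : Fin n × Fin n => A p.1 p.2)
        ((Matrix.charpoly.univ ℝ (Fin n)).coeff j) := by
    intro A
    have := Matrix.charpoly.univ_coeff_eval₂Hom (n := Fin n) (RingHom.id ℝ)
      (fun p => A p.1 p.2) j
    exact this.symm
  simp_rw [h]
  exact (MvPolynomial.continuous_eval _).comp (by fun_prop)

end PseudoDet

section Gaussian

variable {n k : ℕ} {A : Matrix (Fin n) (Fin n) ℝ}

/-- The quadratic form of a matrix. -/
def quadForm (A : Matrix (Fin n) (Fin n) ℝ) (x : E n) : ℝ :=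
  inner ℝ x (Matrix.toEuclideanLin A x)

lemma toEuclideanLin_eigenvectorBasis (hA : A.IsHermitian) (i : Fin n) :
    Matrix.toEuclideanLin A (hA.eigenvectorBasis i) =
      hA.eigenvalues i • hA.eigenvectorBasis i := by
  ext j
  have := congrFun (hA.mulVec_eigenvectorBasis i) j
  simpa [Matrix.toEuclideanLin] using this

lemma isSymmetric_toEuclideanLin (hA : A.IsHermitian) :
    (Matrix.toEuclideanLin A).IsSymmetric :=
  Matrix.isSymmetric_toEuclideanLin_iff.2 hA

lemma repr_toEuclideanLin (hA : A.IsHermitian) (x : E n) (i : Fin n) :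
    hA.eigenvectorBasis.repr (Matrix.toEuclideanLin A x) i =
      hA.eigenvalues i * hA.eigenvectorBasis.repr x i := by
  rw [OrthonormalBasis.repr_apply_apply, OrthonormalBasis.repr_apply_apply,
    ← isSymmetric_toEuclideanLin hA, toEuclideanLin_eigenvectorBasis, inner_smul_left]
  simp

lemma inner_eq_sum_repr (b : OrthonormalBasis (Fin n) ℝ (E n)) (x y : E n) :
    inner ℝ x y = ∑ i, b.repr x i * b.repr y i := by
  rw [← b.sum_inner_mul_inner]
  refine Finset.sum_congr rfl fun i _ => ?_
  rw [OrthonormalBasis.repr_apply_apply, OrthonormalBasis.repr_apply_apply,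
    real_inner_comm]

lemma quadForm_eq_sum (hA : A.IsHermitian) (x : E n) :
    quadForm A x = ∑ i, hA.eigenvalues i * (hA.eigenvectorBasis.repr x i) ^ 2 := by
  rw [quadForm, inner_eq_sum_repr hA.eigenvectorBasis]
  refine Finset.sum_congr rfl fun i _ => ?_
  rw [repr_toEuclideanLin]
  ring

/-- The kernel of a matrix acting on Euclidean space. -/
abbrev matKer (A : Matrix (Fin n) (Fin n) ℝ) : Submodule ℝ (E n) :=
  LinearMap.ker (Matrix.toEuclideanLin A)

lemma repr_eq_zero_of_mem_ker (hA : A.IsHermitian) {x : E n} (hx : x ∈ matKer A) {i : Fin n}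
    (hi : hA.eigenvalues i ≠ 0) : hA.eigenvectorBasis.repr x i = 0 := by
  have := repr_toEuclideanLin hA x i
  rw [LinearMap.mem_ker.1 hx] at this
  simpa [hi] using this.symm

lemma repr_eq_zero_of_mem_orthogonal (hA : A.IsHermitian) {x : E n} (hx : x ∈ (matKer A)ᗮ)
    {i : Fin n} (hi : hA.eigenvalues i = 0) : hA.eigenvectorBasis.repr x i = 0 := by
  rw [OrthonormalBasis.repr_apply_apply]
  refine (Submodule.mem_orthogonal _ _).1 hx _ ?_
  rw [LinearMap.mem_ker, toEuclideanLin_eigenvectorBasis, hi, zero_smul]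

lemma finrank_matKer (A : Matrix (Fin n) (Fin n) ℝ) :
    Module.finrank ℝ (matKer A) = n - A.rank := by
  have h := LinearMap.finrank_range_add_finrank_ker (Matrix.toEuclideanLin A)
  have h2 : A.rank = Module.finrank ℝ (LinearMap.range (Matrix.toEuclideanLin A)) :=
    Matrix.rank_eq_finrank_range_toLin A (PiLp.basisFun 2 ℝ (Fin n)) (PiLp.basisFun 2 ℝ (Fin n))
  rw [← h2, finrank_euclideanSpace, Fintype.card_fin] at h
  exact Nat.eq_sub_of_add_eq' h

/-- Recomposition from orthogonal components preserves volume. -/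
lemma measurePreserving_orthogonal_sum (K : Submodule ℝ (E n)) :
    MeasurePreserving (fun p : K × Kᗮ => (p.1 + p.2 : E n)) := by
  have h1 := WithLp.volume_preserving_toLp K Kᗮ
  have h2 := K.orthogonalDecomposition.symm.measurePreserving
  refine (h2.comp h1).congr ?_ (Eventually.of_forall fun p => ?_)
  · exact (by fun_prop : Continuous fun p : K × Kᗮ => (p.1 + p.2 : E n)).measurable
  · simp [Submodule.orthogonalDecomposition_symm_apply]

/-- Adding the identity on the kernel replaces the zero eigenvalues by 1. The resulting form is
diagonal in the eigenbasis, with a full-dimensional Gaussian integral. -/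
lemma quadForm_add_sq (hA : A.IsHermitian) (t : matKer A) (z : (matKer A)ᗮ) :
    ‖t‖ ^ 2 + quadForm A z = ∑ i, (if hA.eigenvalues i = 0 then 1 else hA.eigenvalues i) *
      (hA.eigenvectorBasis.repr (t + z : E n) i) ^ 2 := by
  rw [quadForm_eq_sum hA, Submodule.coe_norm, ← real_inner_self_eq_norm_sq,
    inner_eq_sum_repr hA.eigenvectorBasis, ← Finset.sum_add_distrib]
  refine Finset.sum_congr rfl fun i _ => ?_
  rw [map_add, PiLp.add_apply]
  split_ifs with h
  · rw [h, repr_eq_zero_of_mem_orthogonal hA z.2 h]; ring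
  · rw [repr_eq_zero_of_mem_ker hA t.2 h]; ring

lemma integral_gaussian_diag (b : OrthonormalBasis (Fin n) ℝ (E n)) (c : Fin n → ℝ) {a : ℝ} :
    ∫ x : E n, Real.exp (-(a / 2 * ∑ i, c i * (b.repr x i) ^ 2)) =
      ∏ i, √(2 * Real.pi / (a * c i)) := by
  have h1 := b.measurePreserving_repr.integral_comp
    b.repr.toHomeomorph.measurableEmbedding
    (fun y : E n => Real.exp (-(a / 2 * ∑ i, c i * (y i) ^ 2)))
  have h2 := (PiLp.volume_preserving_ofLp (Fin n)).integral_comp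
    (MeasurableEquiv.toLp 2 (Fin n → ℝ)).symm.measurableEmbedding
    (fun y : Fin n → ℝ => Real.exp (-(a / 2 * ∑ i, c i * (y i) ^ 2)))
  rw [h1]
  refine h2.trans ?_
  have h3 : ∀ y : Fin n → ℝ, Real.exp (-(a / 2 * ∑ i, c i * (y i) ^ 2)) =
      ∏ i, Real.exp (-(a * c i / 2) * (y i) ^ 2) := by
    intro y
    rw [← Real.exp_sum, Finset.mul_sum, ← Finset.sum_neg_distrib]
    congr 1
    exact Finset.sum_congr rfl fun i _ => by ring
  simp_rw [h3]
  rw [integral_fintype_prod_volume_eq_prod (fun i (x : ℝ) => Real.exp (-(a * c i / 2) * x ^ 2))]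
  refine Finset.prod_congr rfl fun i _ => ?_
  rw [integral_gaussian]
  congr 1
  rw [div_div_eq_mul_div, mul_comm]

/-- The integral over the complement of the kernel is obtained by division: the Gaussian with the
identity added on the kernel has a known integral over the whole space, and it factors as this
integral times the standard Gaussian integral over the kernel. -/
lemma lintegral_gaussian_orthogonal (hA : A.IsHermitian) (hnn : ∀ x, 0 ≤ quadForm A x)
    (hk : A.rank = k) {a : ℝ} (ha : 0 < a) :
    ∫⁻ z : (matKer A)ᗮ, ENNReal.ofReal (Real.exp (-(a / 2 * quadForm A z))) =
      ENNReal.ofReal ((2 * Real.pi / a) ^ ((k : ℝ) / 2) / √|pseudoDet A|) := by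
  have hkn : k ≤ n := by
    rw [← hk]; simpa using A.rank_le_width
  have hnnev : ∀ i, 0 ≤ hA.eigenvalues i := by
    intro i
    have := hnn (hA.eigenvectorBasis i)
    rw [quadForm, toEuclideanLin_eigenvectorBasis, inner_smul_right] at this
    simpa using this
  have hfull := integral_gaussian_diag (n := n) hA.eigenvectorBasis
    (fun i => if hA.eigenvalues i = 0 then 1 else hA.eigenvalues i) (a := a)
  have hmp := measurePreserving_orthogonal_sum (matKer A)
  have hprod := (integral_map (μ := volume) hmp.measurable.aemeasurable
    (f := fun x : E n => Real.exp (-(a / 2 * ∑ i, (if hA.eigenvalues i = 0 then 1 else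
      hA.eigenvalues i) * (hA.eigenvectorBasis.repr x i) ^ 2)))
    (Continuous.aestronglyMeasurable (by fun_prop))).symm
  rw [hmp.map_eq] at hprod
  simp_rw [← quadForm_add_sq hA, mul_add, neg_add, Real.exp_add] at hprod
  rw [hfull] at hprod
  have h4 := integral_prod_mul (μ := (volume : Measure (matKer A)))
    (ν := (volume : Measure (matKer A)ᗮ)) (fun t => Real.exp (-(a / 2 * ‖t‖ ^ 2)))
    (fun z => Real.exp (-(a / 2 * quadForm A z)))
  rw [← Measure.volume_eq_prod, hprod] at h4
  have h5 : ∫ t : matKer A, Real.exp (-(a / 2 * ‖t‖ ^ 2)) =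
      (2 * Real.pi / a) ^ (((n - k : ℕ) : ℝ) / 2) := by
    have := GaussianFourier.integral_rexp_neg_mul_sq_norm (V := matKer A) (half_pos ha)
    rw [finrank_matKer, hk] at this
    simp_rw [← neg_mul]
    rw [this]
    congr 1
    field_simp
  have hP : 0 < 2 * Real.pi / a := by positivity
  have h6 : ∏ i, √(2 * Real.pi / (a * (if hA.eigenvalues i = 0 then 1 else hA.eigenvalues i))) =
      (2 * Real.pi / a) ^ ((n : ℝ) / 2) / √|pseudoDet A| := by
    have e1 : ∀ i, √(2 * Real.pi / (a * (if hA.eigenvalues i = 0 then 1 else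
        hA.eigenvalues i))) = √(2 * Real.pi / a) *
          (√(if hA.eigenvalues i = 0 then 1 else hA.eigenvalues i))⁻¹ := by
      intro i
      rw [← div_div, Real.sqrt_div hP.le, div_eq_mul_inv]
    rw [Finset.prod_congr rfl fun i _ => e1 i, Finset.prod_mul_distrib, Finset.prod_const,
      Finset.prod_inv_distrib, Finset.card_univ, Fintype.card_fin,
      div_eq_mul_inv ((2 * Real.pi / a) ^ ((n : ℝ) / 2))]
    congr 1
    · rw [← Real.rpow_natCast, Real.sqrt_eq_rpow, ← Real.rpow_mul hP.le]
      congr 1; ring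
    · congr 1
      rw [← Real.sqrt_prod _ fun i _ => by split_ifs; exacts [zero_le_one, hnnev i]]
      congr 1
      rw [pseudoDet_eq_prod hA, abs_of_nonneg (Finset.prod_nonneg fun i _ => hnnev i),
        Finset.prod_filter]
      exact Finset.prod_congr rfl fun i _ => by split_ifs <;> simp_all
  have hD : 0 < √|pseudoDet A| := Real.sqrt_pos.2 (pseudoDet_pos_abs hA)
  have h7 : ∫ z : (matKer A)ᗮ, Real.exp (-(a / 2 * quadForm A z)) =
      (2 * Real.pi / a) ^ ((k : ℝ) / 2) / √|pseudoDet A| := by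
    rw [h5, h6] at h4
    have h8 : (2 * Real.pi / a) ^ ((n : ℝ) / 2) = (2 * Real.pi / a) ^ (((n - k : ℕ) : ℝ) / 2) *
        (2 * Real.pi / a) ^ ((k : ℝ) / 2) := by
      rw [← Real.rpow_add hP]
      congr 1
      rw [Nat.cast_sub hkn]; ring
    rw [h8, mul_div_assoc] at h4
    exact (mul_left_cancel₀ (Real.rpow_pos_of_pos hP _).ne' h4).symm
  rw [← h7, ofReal_integral_eq_lintegral_ofReal]
  -- Integrability comes for free: a non-integrable function has Bochner integral 0, whereas `h7`
  -- gives a positive value.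
  · by_contra hc
    rw [integral_undef hc] at h7
    exact absurd h7 (by positivity)
  · exact Eventually.of_forall fun z => (Real.exp_pos _).le

end Gaussian

end PolarChaos
end

/-! ### Second-order structure of a function near a manifold of minima. -/

noncomputable section

namespace PolarChaos

section Hessian

variable {n : ℕ} {S : E n → ℝ} {x₀ : E n}

lemma hasStrictFDerivAt_fderiv (hS : ContDiffAt ℝ 2 S x₀) :
    HasStrictFDerivAt (fderiv ℝ S) (fderiv ℝ (fderiv ℝ S) x₀) x₀ :=
  (hS.fderiv_right (m := 1) (by norm_num)).hasStrictFDerivAt (by norm_num)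

lemma hessian_apply (hS : ContDiffAt ℝ 2 S x₀) (i j : Fin n) :
    hessian S x₀ i j =
      fderiv ℝ (fderiv ℝ S) x₀ (EuclideanSpace.single i 1) (EuclideanSpace.single j 1) := by
  have h := (hasStrictFDerivAt_fderiv hS).hasFDerivAt.clm_apply
    (hasFDerivAt_const (EuclideanSpace.single j (1 : ℝ)) x₀)
  simp only [hessian, Matrix.of_apply]
  rw [h.fderiv]
  simp

lemma snd_fderiv_symm (hS : ContDiffAt ℝ 2 S x₀) (x y : E n) :
    fderiv ℝ (fderiv ℝ S) x₀ x y = fderiv ℝ (fderiv ℝ S) x₀ y x :=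
  hS.isSymmSndFDerivAt (by simp) x y

lemma hessian_isHermitian (hS : ContDiffAt ℝ 2 S x₀) : (hessian S x₀).IsHermitian := by
  ext i j
  simp only [Matrix.conjTranspose_apply, star_trivial]
  rw [hessian_apply hS, hessian_apply hS, snd_fderiv_symm hS]

lemma snd_fderiv_eq_inner (hS : ContDiffAt ℝ 2 S x₀) (x y : E n) :
    fderiv ℝ (fderiv ℝ S) x₀ x y = inner ℝ x (Matrix.toEuclideanLin (hessian S x₀) y) := by
  have e : ∀ v : E n, v = ∑ i, v i • EuclideanSpace.single i (1 : ℝ) := by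
    intro v
    ext j
    simp [Finset.sum_apply, Pi.single_apply]
  conv_lhs => rw [e x, e y]
  simp only [map_sum, map_smul, sum_apply, smul_apply,
    smul_eq_mul, ← hessian_apply hS]
  simp only [PiLp.inner_apply, Matrix.toEuclideanLin, Matrix.toLpLin_apply, Matrix.mulVec,
    dotProduct, RCLike.inner_apply, conj_trivial, Finset.sum_mul, Finset.mul_sum]
  rw [Finset.sum_comm]
  refine Finset.sum_congr rfl fun i _ => Finset.sum_congr rfl fun j _ => ?_
  ring

lemma quadForm_hessian (hS : ContDiffAt ℝ 2 S x₀) (z : E n) :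
    quadForm (hessian S x₀) z = fderiv ℝ (fderiv ℝ S) x₀ z z :=
  (snd_fderiv_eq_inner hS z z).symm

/-- Second-order expansion around critical zeros near a point of class `C²`. -/
lemma exists_ball_taylor (hS : ContDiffAt ℝ 2 S x₀) {η : ℝ} (hη : 0 < η) {W : Set (E n)}
    (hW : W ∈ 𝓝 x₀) :
    ∃ r > 0, Metric.ball x₀ r ⊆ W ∧ ContDiffOn ℝ 2 S (Metric.ball x₀ r) ∧
      (∀ x ∈ Metric.ball x₀ r, ∀ y ∈ Metric.ball x₀ r,
        ‖fderiv ℝ S x - fderiv ℝ S y - fderiv ℝ (fderiv ℝ S) x₀ (x - y)‖ ≤ η * ‖x - y‖) ∧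
      ∀ x ∈ Metric.ball x₀ r, S x = 0 → fderiv ℝ S x = 0 → ∀ z, x + z ∈ Metric.ball x₀ r →
        |S (x + z) - 1 / 2 * quadForm (hessian S x₀) z| ≤ η * ‖z‖ ^ 2 := by
  -- Strict differentiability of the gradient controls pairs of points near `x₀`. This makes the
  -- expansion uniform over all critical zeros in the ball, with the Hessian frozen at `x₀`.
  have h1 : ∀ᶠ p : E n × E n in 𝓝 x₀ ×ˢ 𝓝 x₀,
      ‖fderiv ℝ S p.1 - fderiv ℝ S p.2 - fderiv ℝ (fderiv ℝ S) x₀ (p.1 - p.2)‖ ≤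
        η * ‖p.1 - p.2‖ := by
    have := (hasStrictFDerivAt_fderiv hS).isLittleO.bound hη
    rwa [nhds_prod_eq] at this
  obtain ⟨U, hU, hU2⟩ := eventually_prod_self_iff (r := fun x y =>
    ‖fderiv ℝ S x - fderiv ℝ S y - fderiv ℝ (fderiv ℝ S) x₀ (x - y)‖ ≤ η * ‖x - y‖) |>.1 h1
  obtain ⟨V, hV, hV2⟩ := hS.eventually (by simp) |>.exists_mem
  obtain ⟨r, hr, hsub⟩ := Metric.mem_nhds_iff.1 (inter_mem (inter_mem hU hW) hV)
  have hC : ContDiffOn ℝ 2 S (Metric.ball x₀ r) := fun x hx => (hV2 x (hsub hx).2).contDiffWithinAt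
  refine ⟨r, hr, fun x hx => (hsub hx).1.2, hC, fun x hx y hy =>
    hU2 _ (hsub hx).1.1 _ (hsub hy).1.1, ?_⟩
  intro x hx hx0 hdx z hz
  have hd : ∀ y ∈ Metric.ball x₀ r, HasFDerivAt S (fderiv ℝ S y) y := fun y hy =>
    ((hC.contDiffAt (Metric.isOpen_ball.mem_nhds hy)).differentiableAt (by norm_num)).hasFDerivAt
  have hseg : ∀ y ∈ segment ℝ (0 : E n) z, x + y ∈ Metric.ball x₀ r := by
    intro y hy
    have : x + y ∈ segment ℝ (x + 0) (x + z) := by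
      rw [← segment_translate_image]
      exact ⟨y, hy, rfl⟩
    rw [add_zero] at this
    exact (convex_ball x₀ r).segment_subset hx hz this
  set B := fderiv ℝ (fderiv ℝ S) x₀ with hB
  have hG : ∀ y ∈ segment ℝ (0 : E n) z, HasFDerivWithinAt
      (fun y => S (x + y) - 1 / 2 * B y y) (fderiv ℝ S (x + y) - B y) (segment ℝ 0 z) y := by
    intro y hy
    have e1 : HasFDerivAt (fun y => S (x + y)) (fderiv ℝ S (x + y)) y :=
      (hasFDerivAt_comp_add_left x).2 (hd _ (hseg y hy))
    have e2 : HasFDerivAt (fun y => B y y) (2 • B y) y := by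
      have := B.hasFDerivAt (x := y) |>.clm_apply (hasFDerivAt_id y)
      refine this.congr_fderiv ?_
      ext v
      simp [two_smul]
      rw [hB, snd_fderiv_symm hS]
    have e3 := e1.sub (e2.const_mul (1 / 2))
    refine (e3.congr_fderiv ?_).hasFDerivWithinAt
    ext v
    simp
  -- The mean value inequality is applied to `S (x + y)` minus half the frozen quadratic form, whose
  -- gradient is small along the segment because `x` is critical.
  have hbound : ∀ y ∈ segment ℝ (0 : E n) z, ‖fderiv ℝ S (x + y) - B y‖ ≤ η * ‖z‖ := by
    intro y hy
    have h2 := hU2 _ (hsub (hseg y hy)).1.1 _ (hsub hx).1.1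
    simp only [hdx, sub_zero, add_sub_cancel_left] at h2
    refine h2.trans (mul_le_mul_of_nonneg_left ?_ hη.le)
    obtain ⟨t, ht, rfl⟩ := (segment_eq_image_lineMap ℝ (0 : E n) z ▸ hy)
    simp only [AffineMap.lineMap_apply, vsub_eq_sub, sub_zero, vadd_eq_add, add_zero, norm_smul,
      Real.norm_eq_abs, abs_of_nonneg ht.1]
    exact mul_le_of_le_one_left (norm_nonneg _) ht.2
  have h3 := Convex.norm_image_sub_le_of_norm_hasFDerivWithin_le hG hbound (convex_segment 0 z)
    (left_mem_segment ℝ 0 z) (right_mem_segment ℝ 0 z)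
  simp only [add_zero, hx0, map_zero, mul_zero, sub_zero,
    Real.norm_eq_abs] at h3
  rw [quadForm_hessian hS]
  calc _ ≤ η * ‖z‖ * ‖z‖ := h3
    _ = _ := by ring

/-- Along a short step `s • z` the expansion gives `0 ≤ s ^ 2 * (quadForm z + 2 * η' * ‖z‖ ^ 2)`;
divide by `s ^ 2` and let `η'` shrink. -/
lemma quadForm_hessian_nonneg (hS : ContDiffAt ℝ 2 S x₀) (h0 : S x₀ = 0)
    (hnn : ∀ᶠ x in 𝓝 x₀, 0 ≤ S x) (z : E n) : 0 ≤ quadForm (hessian S x₀) z := by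
  have hd0 : fderiv ℝ S x₀ = 0 := by
    apply IsLocalMin.fderiv_eq_zero
    filter_upwards [hnn] with x hx
    rwa [h0]
  refine le_of_forall_pos_le_add fun η hη => ?_
  obtain ⟨η', hη', hle⟩ : ∃ η' > 0, 2 * η' * ‖z‖ ^ 2 ≤ η := by
    refine ⟨η / (2 * (‖z‖ ^ 2 + 1)), by positivity, ?_⟩
    rw [show 2 * (η / (2 * (‖z‖ ^ 2 + 1))) * ‖z‖ ^ 2 = η * (‖z‖ ^ 2 / (‖z‖ ^ 2 + 1)) by
      field_simp]
    refine mul_le_of_le_one_right hη.le ?_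
    rw [div_le_one (by positivity)]
    linarith
  obtain ⟨r, hr, hsub, -, -, hT⟩ := exists_ball_taylor hS hη' hnn
  have hx : Tendsto (fun s : ℝ => x₀ + s • z) (𝓝[>] 0) (𝓝 (x₀ + (0 : ℝ) • z)) :=
    (Continuous.tendsto (by fun_prop) 0).mono_left nhdsWithin_le_nhds
  rw [zero_smul, add_zero] at hx
  obtain ⟨s, hs, hs0⟩ :=
    ((hx.eventually (Metric.ball_mem_nhds x₀ hr)).and self_mem_nhdsWithin).exists
  have hs0 : 0 < s := hs0
  have h1 := hT x₀ (Metric.mem_ball_self hr) h0 hd0 (s • z) hs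
  have h2 : quadForm (hessian S x₀) (s • z) = s ^ 2 * quadForm (hessian S x₀) z := by
    rw [quadForm_hessian hS, quadForm_hessian hS]
    simp; ring
  have h3 := hsub hs
  simp only [Set.mem_ofPred_eq] at h3
  rw [h2, norm_smul, mul_pow, Real.norm_eq_abs, sq_abs] at h1
  have h4 := (abs_le.1 h1).2
  have h5 : 0 ≤ s ^ 2 * (quadForm (hessian S x₀) z + 2 * η' * ‖z‖ ^ 2) := by nlinarith
  have := nonneg_of_mul_nonneg_right h5 (by positivity)
  linarith

/-- On the complement of the kernel only the nonzero eigenvalues contribute, and these are positive.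
Taking `c` small and positive, rather than the least of them, also covers the zero matrix. -/
lemma exists_coercive {A : Matrix (Fin n) (Fin n) ℝ} (hA : A.IsHermitian)
    (hnn : ∀ x, 0 ≤ quadForm A x) :
    ∃ c > 0, ∀ z ∈ (matKer A)ᗮ, c * ‖z‖ ^ 2 ≤ quadForm A z := by
  have hnnev : ∀ i, 0 ≤ hA.eigenvalues i := by
    intro i
    have := hnn (hA.eigenvectorBasis i)
    rw [quadForm, toEuclideanLin_eigenvectorBasis, inner_smul_right] at this
    simpa using this
  have h1 : ∀ᶠ c : ℝ in 𝓝[>] 0, ∀ i, hA.eigenvalues i ≠ 0 → c ≤ hA.eigenvalues i := by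
    rw [eventually_all]
    intro i
    by_cases hi : hA.eigenvalues i = 0
    · simp [hi]
    · have : 0 < hA.eigenvalues i := lt_of_le_of_ne (hnnev i) (Ne.symm hi)
      filter_upwards [nhdsWithin_le_nhds (gt_mem_nhds this)] with c hc _ using le_of_lt hc
  obtain ⟨c, hc, hc0⟩ := (h1.and self_mem_nhdsWithin).exists
  refine ⟨c, hc0, fun z hz => ?_⟩
  rw [quadForm_eq_sum hA, ← real_inner_self_eq_norm_sq, inner_eq_sum_repr hA.eigenvectorBasis,
    Finset.mul_sum]
  refine Finset.sum_le_sum fun i _ => ?_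
  by_cases hi : hA.eigenvalues i = 0
  · simp [repr_eq_zero_of_mem_orthogonal hA hz hi]
  · have := hc i hi
    rw [← pow_two]
    gcongr

/-- Near `x₀`, the zero set of `S` is the graph over `ker A` of the map `γ`, with slope at most
`ε`, and `S` is within a factor `1 ± ε` of half the quadratic form of `A` in the normal direction. -/
structure IsMinGraph (S : E n → ℝ) (A : Matrix (Fin n) (Fin n) ℝ) (W : Set (E n)) (ε : ℝ)
    (t₀ : matKer A) (r ρ : ℝ) (γ : matKer A → (matKer A)ᗮ) : Prop where
  r_pos : 0 < r
  rho_pos : 0 < ρ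
  lip : ∀ t ∈ Metric.ball t₀ r, ∀ t' ∈ Metric.ball t₀ r, ‖γ t - γ t'‖ ≤ ε * ‖t - t'‖
  mem : ∀ t ∈ Metric.ball t₀ r, ∀ z : (matKer A)ᗮ, ‖z‖ < ρ → (t + γ t + z : E n) ∈ W
  lower : ∀ t ∈ Metric.ball t₀ r, ∀ z : (matKer A)ᗮ, ‖z‖ < ρ →
    (1 - ε) / 2 * quadForm A z ≤ S (t + γ t + z)
  upper : ∀ t ∈ Metric.ball t₀ r, ∀ z : (matKer A)ᗮ, ‖z‖ < ρ →
    S (t + γ t + z) ≤ (1 + ε) / 2 * quadForm A z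

/-- Zeros of `S` are critical. If two zeros differ by `t + z`, with `t` in the kernel of the Hessian
and `z` orthogonal to it, strict differentiability of the gradient and coercivity bound `z` by `ε *
‖t‖`; so the zero set lies in a graph of slope `ε`. The immersion has tangent space inside the
kernel, hence equal to it since both have dimension `m`. Its projection therefore covers a ball of
the kernel and the graph has no holes. Taylor expansion at each point of the graph gives the
quadratic bounds. -/
theorem exists_isMinGraph {m k : ℕ} (hmk : m + k = n) (hS : ContDiffAt ℝ 2 S x₀) (h0 : S x₀ = 0)
    (hnn : ∀ᶠ x in 𝓝 x₀, 0 ≤ S x) (hrank : (hessian S x₀).rank = k)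
    {i : E m → E n} {i' : E m →L[ℝ] E n} (hi : HasStrictFDerivAt i i' 0)
    (hi' : Function.Injective i') (hi0 : i 0 = x₀) (hiZ : ∀ᶠ s in 𝓝 0, S (i s) = 0)
    {ε : ℝ} (hε : 0 < ε) {W : Set (E n)} (hW : W ∈ 𝓝 x₀) :
    ∃ r ρ γ, IsMinGraph S (hessian S x₀) W ε
        ((matKer (hessian S x₀)).orthogonalProjectionOnto x₀) r ρ γ ∧
      γ ((matKer (hessian S x₀)).orthogonalProjectionOnto x₀) =
        (matKer (hessian S x₀))ᗮ.orthogonalProjectionOnto x₀ := by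
  set A := hessian S x₀ with hAdef
  set T := matKer A with hT
  have hA : A.IsHermitian := hessian_isHermitian hS
  have hqnn : ∀ x, 0 ≤ quadForm A x := quadForm_hessian_nonneg hS h0 hnn
  obtain ⟨c, hc, hcoer⟩ := exists_coercive hA hqnn
  -- This size turns `c * ‖z‖ ≤ η * (‖t‖ + ‖z‖)` into slope `ε`, and ensures `η ≤ ε / 2 * c`, so
  -- that coercivity absorbs the Taylor error.
  set η := ε * c / (2 * (1 + ε)) with hη
  have hηpos : 0 < η := by positivity
  have hη2 : 2 * (η * (1 + ε)) = ε * c := by rw [hη]; field_simp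
  obtain ⟨r₀, hr₀, hsub, hC, hgrad, htay⟩ := exists_ball_taylor hS hηpos (inter_mem hW hnn)
  have hcrit : ∀ x ∈ Metric.ball x₀ r₀, S x = 0 → fderiv ℝ S x = 0 := by
    intro x hx hx0
    apply IsLocalMin.fderiv_eq_zero
    filter_upwards [Metric.isOpen_ball.mem_nhds hx] with y hy
    rw [hx0]
    exact (hsub hy).2
  have hdec : ∀ x : E n, (T.orthogonalProjectionOnto x : E n) + Tᗮ.orthogonalProjectionOnto x = x :=
    fun x => T.starProjection_add_starProjection_orthogonal x
  -- the slope of the zero set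
  have hslope : ∀ x ∈ Metric.ball x₀ r₀, ∀ y ∈ Metric.ball x₀ r₀, S x = 0 → S y = 0 →
      ‖Tᗮ.orthogonalProjectionOnto x - Tᗮ.orthogonalProjectionOnto y‖ ≤
        ε * ‖T.orthogonalProjectionOnto x - T.orthogonalProjectionOnto y‖ := by
    intro x hx y hy hx0 hy0
    have h1 := hgrad x hx y hy
    rw [hcrit x hx hx0, hcrit y hy hy0, sub_zero, zero_sub, norm_neg] at h1
    rw [← map_sub, ← map_sub]
    set v := x - y
    set z := Tᗮ.orthogonalProjectionOnto v with hz
    set t := T.orthogonalProjectionOnto v with ht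
    have hv : (t : E n) + z = v := hdec v
    -- The mixed term vanishes because `t` lies in the kernel and the second derivative is
    -- symmetric.
    have h2 : quadForm A z = fderiv ℝ (fderiv ℝ S) x₀ v z := by
      have h3 : fderiv ℝ (fderiv ℝ S) x₀ t z = 0 := by
        rw [snd_fderiv_symm hS, snd_fderiv_eq_inner hS]
        rw [LinearMap.mem_ker.1 t.2, inner_zero_right]
      rw [← hv, map_add, add_apply, h3, zero_add, quadForm_hessian hS]
    have h4 : c * ‖z‖ ^ 2 ≤ η * ‖v‖ * ‖z‖ := by
      calc c * ‖z‖ ^ 2 ≤ quadForm A z := hcoer z z.2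
        _ ≤ ‖fderiv ℝ (fderiv ℝ S) x₀ v z‖ := by rw [h2]; exact le_abs_self _
        _ ≤ ‖fderiv ℝ (fderiv ℝ S) x₀ v‖ * ‖(z : E n)‖ := ContinuousLinearMap.le_opNorm _ _
        _ ≤ _ := by
          rw [Submodule.coe_norm]
          gcongr
    have h5 : ‖v‖ ≤ ‖t‖ + ‖z‖ := by
      rw [← hv]; exact norm_add_le _ _
    rcases eq_or_ne ‖z‖ 0 with h6 | h6
    · rw [h6]; positivity
    have h7 : 0 < ‖z‖ := lt_of_le_of_ne (norm_nonneg _) (Ne.symm h6)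
    have h8 : c * ‖z‖ ≤ η * (‖t‖ + ‖z‖) := by
      have : c * ‖z‖ ≤ η * ‖v‖ := by
        refine le_of_mul_le_mul_right ?_ h7
        linarith [h4, show c * ‖z‖ * ‖z‖ = c * ‖z‖ ^ 2 by ring]
      exact this.trans (by gcongr)
    have h9 : η * (1 + ε) * ‖z‖ ≤ η * (1 + ε) * (ε * ‖t‖) := by
      have : 2 * (η * (1 + ε)) * ‖z‖ ≤ ε * (η * (‖t‖ + ‖z‖)) := by
        rw [hη2, mul_assoc]; gcongr
      nlinarith [norm_nonneg t, norm_nonneg z, mul_nonneg hηpos.le (norm_nonneg z),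
        mul_nonneg hηpos.le (norm_nonneg t), mul_nonneg hε.le (mul_nonneg hηpos.le (norm_nonneg z)),
        mul_nonneg (mul_nonneg hε.le hε.le) (mul_nonneg hηpos.le (norm_nonneg t))]
    exact le_of_mul_le_mul_left h9 (by positivity)
  -- the tangential projection of the immersion is a submersion
  have hrange : ∀ s, i' s ∈ T := by
    intro s
    -- The gradient of `S` vanishes along the immersion. Differentiating this identity at 0 shows
    -- that the Hessian annihilates the tangent vectors.
    have h1 : HasFDerivAt (fun s => fderiv ℝ S (i s)) ((fderiv ℝ (fderiv ℝ S) x₀).comp i') 0 := by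
      have := (hasStrictFDerivAt_fderiv hS).hasFDerivAt
      rw [← hi0] at this
      have h2 := this.comp (0 : E m) hi.hasFDerivAt
      rwa [hi0] at h2
    have h2 : (fun s => fderiv ℝ S (i s)) =ᶠ[𝓝 0] fun _ => 0 := by
      have hcont : Tendsto i (𝓝 0) (𝓝 x₀) := by
        rw [← hi0]; exact hi.hasFDerivAt.continuousAt
      filter_upwards [hiZ, hcont.eventually (Metric.ball_mem_nhds x₀ hr₀)] with s hs hs2
      exact hcrit _ hs2 hs
    have h3 := h1.unique ((hasFDerivAt_const (0 : E n →L[ℝ] ℝ) (0 : E m)).congr_of_eventuallyEq h2)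
    rw [LinearMap.mem_ker]
    refine ext_inner_left ℝ fun y => ?_
    rw [← snd_fderiv_eq_inner hS, snd_fderiv_symm hS, inner_zero_right]
    have := congrArg (fun L : E m →L[ℝ] E n →L[ℝ] ℝ => L s y) h3
    simpa using this
  have hPi : HasStrictFDerivAt (fun s => T.orthogonalProjectionOnto (i s))
      (T.orthogonalProjectionOnto.comp i') 0 :=
    T.orthogonalProjectionOnto.hasStrictFDerivAt.comp 0 hi
  have hsurj : (T.orthogonalProjectionOnto.comp i' : E m →L[ℝ] T).range = ⊤ := by
    have hfr : Module.finrank ℝ (E m) = Module.finrank ℝ T := by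
      rw [finrank_euclideanSpace, Fintype.card_fin, hT, finrank_matKer, hrank]; omega
    have hinj : Function.Injective (T.orthogonalProjectionOnto.comp i' : E m →ₗ[ℝ] T) := by
      rw [injective_iff_map_eq_zero]
      intro s hs
      have h1 : T.orthogonalProjectionOnto (i' s) = 0 := hs
      have h2 : (T.orthogonalProjectionOnto (i' s) : E n) = i' s :=
        Submodule.starProjection_eq_self_iff.2 (hrange s)
      rw [h1] at h2
      exact (injective_iff_map_eq_zero i').1 hi' s (by simpa using h2.symm)
    exact LinearMap.range_eq_top.2
      ((LinearMap.injective_iff_surjective_of_finrank_eq_finrank hfr).1 hinj)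
  -- A strictly differentiable map with surjective derivative is open at the point, so the projected
  -- zeros fill a neighbourhood.
  have hmap := hPi.map_nhds_eq_of_surj hsurj
  rw [hi0] at hmap
  have himg : T.orthogonalProjectionOnto '' (Metric.ball x₀ (r₀ / 2) ∩ {x | S x = 0}) ∈
      𝓝 (T.orthogonalProjectionOnto x₀) := by
    rw [← hmap, mem_map]
    have hcont : Tendsto i (𝓝 0) (𝓝 x₀) := by
      rw [← hi0]; exact hi.hasFDerivAt.continuousAt
    filter_upwards [hiZ, hcont.eventually (Metric.ball_mem_nhds x₀ (half_pos hr₀))] with s hs hs2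
    exact ⟨i s, ⟨hs2, hs⟩, rfl⟩
  obtain ⟨r, hr, hrsub⟩ := Metric.mem_nhds_iff.1 himg
  have hex : ∀ t : T, ∃ x : E n, t ∈ Metric.ball (T.orthogonalProjectionOnto x₀) r →
      x ∈ Metric.ball x₀ (r₀ / 2) ∩ {x | S x = 0} ∧ T.orthogonalProjectionOnto x = t := by
    intro t
    by_cases ht : t ∈ Metric.ball (T.orthogonalProjectionOnto x₀) r
    · obtain ⟨x, hx, hxt⟩ := hrsub ht
      exact ⟨x, fun _ => ⟨hx, hxt⟩⟩
    · exact ⟨0, fun h => absurd h ht⟩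
  choose x hxx using hex
  have hx := fun t ht => (hxx t ht).1
  have hxP := fun t ht => (hxx t ht).2
  have hhalf : Metric.ball x₀ (r₀ / 2) ⊆ Metric.ball x₀ r₀ := Metric.ball_subset_ball (by linarith)
  have hsum : ∀ t ∈ Metric.ball (T.orthogonalProjectionOnto x₀) r,
      (t + Tᗮ.orthogonalProjectionOnto (x t) : E n) = x t := by
    intro t ht
    conv_rhs => rw [← hdec (x t), hxP _ ht]
  have hball : ∀ t ∈ Metric.ball (T.orthogonalProjectionOnto x₀) r, ∀ z : Tᗮ, ‖z‖ < r₀ / 2 →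
      x t + z ∈ Metric.ball x₀ r₀ := by
    intro t ht z hz
    have h1 := (hx _ ht).1
    rw [mem_ball_iff_norm] at h1 ⊢
    calc ‖x t + z - x₀‖ = ‖(x t - x₀) + z‖ := by congr 1; abel
      _ ≤ ‖x t - x₀‖ + ‖(z : E n)‖ := norm_add_le _ _
      _ < r₀ / 2 + r₀ / 2 := add_lt_add h1 hz
      _ = r₀ := by ring
  have hmain : ∀ t ∈ Metric.ball (T.orthogonalProjectionOnto x₀) r, ∀ z : Tᗮ, ‖z‖ < r₀ / 2 →
      |S (x t + z) - 1 / 2 * quadForm A z| ≤ ε / 2 * quadForm A z := by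
    intro t ht z hz
    have h1 := hx _ ht
    refine (htay _ (hhalf h1.1) h1.2 (hcrit _ (hhalf h1.1) h1.2) z (hball t ht z hz)).trans ?_
    have h2 := hcoer z z.2
    have h3 : η ≤ ε / 2 * c := by nlinarith [mul_pos hηpos hε]
    rw [← Submodule.coe_norm] at h2 ⊢
    calc η * ‖z‖ ^ 2 ≤ ε / 2 * c * ‖z‖ ^ 2 := by gcongr
      _ = ε / 2 * (c * ‖z‖ ^ 2) := by ring
      _ ≤ _ := by gcongr
  refine ⟨r, r₀ / 2, fun t => Tᗮ.orthogonalProjectionOnto (x t),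
    ⟨hr, half_pos hr₀, ?_, ?_, ?_, ?_⟩, ?_⟩
  · intro t ht t' ht'
    have := hslope _ (hhalf (hx _ ht).1) _ (hhalf (hx _ ht').1) (hx _ ht).2 (hx _ ht').2
    rwa [hxP _ ht, hxP _ ht'] at this
  · intro t ht z hz
    rw [hsum t ht]
    exact (hsub (hball t ht z hz)).1
  · intro t ht z hz
    rw [hsum t ht]
    linarith [(abs_le.1 (hmain t ht z hz)).1]
  · intro t ht z hz
    rw [hsum t ht]
    linarith [(abs_le.1 (hmain t ht z hz)).2]
  -- The chosen zero over the projection of `x₀` has the same kernel component as `x₀`; the slope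
  -- estimate then makes the normal components equal.
  · have ht := Metric.mem_ball_self hr (x := T.orthogonalProjectionOnto x₀)
    have := hslope _ (hhalf (hx _ ht).1) _ (Metric.mem_ball_self hr₀) (hx _ ht).2 h0
    rw [hxP _ ht, sub_self, norm_zero, mul_zero] at this
    exact sub_eq_zero.1 (norm_le_zero_iff.1 this)

end Hessian

end PolarChaos
end

/-! ### The Laplace integral for the exact quadratic form of the displacement from a graph. -/

noncomputable section

namespace PolarChaos

open scoped ENNReal NNReal

lemma lintegral_comp_smul {F : Type*} [NormedAddCommGroup F] [InnerProductSpace ℝ F]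
    [FiniteDimensional ℝ F] [MeasurableSpace F] [BorelSpace F] {g : F → ℝ≥0∞} (hg : Measurable g)
    {r : ℝ} (hr : 0 < r) :
    ∫⁻ x, g (r • x) = ENNReal.ofReal ((r ^ Module.finrank ℝ F)⁻¹) * ∫⁻ x, g x := by
  have h := Measure.map_addHaar_smul (volume : Measure F) hr.ne'
  rw [← lintegral_map hg (by fun_prop : Measurable fun x : F => r • x), h, lintegral_smul_measure,
    abs_of_pos (by positivity), smul_eq_mul]

section Laplace

variable {n k : ℕ} {A : Matrix (Fin n) (Fin n) ℝ}

lemma continuous_quadForm (A : Matrix (Fin n) (Fin n) ℝ) : Continuous (quadForm A) := by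
  unfold quadForm
  have : Continuous (Matrix.toEuclideanLin A) := LinearMap.continuous_of_finiteDimensional _
  fun_prop

lemma quadForm_smul (A : Matrix (Fin n) (Fin n) ℝ) (c : ℝ) (x : E n) :
    quadForm A (c • x) = c ^ 2 * quadForm A x := by
  simp only [quadForm, map_smul, inner_smul_left, inner_smul_right, conj_trivial]
  ring

lemma finrank_matKer_orthogonal (hk : A.rank = k) : Module.finrank ℝ (matKer A)ᗮ = k := by
  have h := (matKer A).finrank_add_finrank_orthogonal
  have hkn : A.rank ≤ n := by simpa using A.rank_le_width
  rw [finrank_matKer, finrank_euclideanSpace, Fintype.card_fin, hk] at h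
  omega

/-- Integration in coordinates straightening a graph over the kernel. -/
lemma lintegral_eq_lintegral_graph (A : Matrix (Fin n) (Fin n) ℝ) (γ : matKer A → (matKer A)ᗮ)
    {F : E n → ℝ≥0∞} (hF : Measurable F) :
    ∫⁻ x, F x = ∫⁻ t : matKer A, ∫⁻ z : (matKer A)ᗮ, F (t + γ t + z) := by
  have hmp := measurePreserving_orthogonal_sum (matKer A)
  have h1 := hmp.lintegral_comp hF
  rw [← h1, Measure.volume_eq_prod,
    lintegral_prod (fun p : matKer A × (matKer A)ᗮ => F (p.1 + p.2))
      (hF.comp hmp.measurable).aemeasurable]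
  refine lintegral_congr fun t => ?_
  rw [← lintegral_add_left_eq_self _ (γ t)]
  simp only [Submodule.coe_add, add_assoc]

lemma orthogonalProjection_graph (A : Matrix (Fin n) (Fin n) ℝ) (t : matKer A)
    (z : (matKer A)ᗮ) : (matKer A).orthogonalProjectionOnto (t + z : E n) = t := by
  rw [map_add, Submodule.orthogonalProjectionOnto_mem_subspace_eq_self,
    Submodule.orthogonalProjectionOnto_apply_of_mem_orthogonal z.2, add_zero]

lemma orthogonalProjection_orthogonal_graph (A : Matrix (Fin n) (Fin n) ℝ) (t : matKer A)
    (z : (matKer A)ᗮ) : (matKer A)ᗮ.orthogonalProjectionOnto (t + z : E n) = z := by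
  rw [map_add, Submodule.orthogonalProjectionOnto_mem_subspace_eq_self,
    Submodule.orthogonalProjectionOnto_apply_of_mem_orthogonal
      ((matKer A).le_orthogonal_orthogonal t.2), zero_add]

/-- Coercivity reduces the integrand to a multiple of `(1 + ‖z‖ ^ 2) ^ (-(n + 1))`, integrable
because `2 * (n + 1)` exceeds the dimension. It is the dominating function in the Laplace limit. -/
lemma lintegral_polynomial_decay_lt_top (hA : A.IsHermitian) (hnn : ∀ x, 0 ≤ quadForm A x)
    {b : ℝ} (hb : 0 < b) (C : ℝ) :
    ∫⁻ z : (matKer A)ᗮ, ENNReal.ofReal (C / (1 + b * quadForm A z) ^ (n + 1)) < ∞ := by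
  obtain ⟨c, hc, hcoer⟩ := exists_coercive hA hnn
  set κ := min 1 (b * c) with hκ
  have hκ0 : 0 < κ := lt_min one_pos (by positivity)
  have hint : Integrable (fun z : (matKer A)ᗮ => |C| / κ ^ (n + 1) *
      ((1 : ℝ) + ‖z‖ ^ 2) ^ (-(2 * (n + 1) : ℝ) / 2)) := by
    refine (integrable_rpow_neg_one_add_norm_sq ?_).const_mul _
    have h1 : Module.finrank ℝ (matKer A)ᗮ ≤ n := by
      simpa using (matKer A)ᗮ.finrank_le
    have : (Module.finrank ℝ (matKer A)ᗮ : ℝ) ≤ n := by exact_mod_cast h1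
    linarith [n.cast_nonneg (α := ℝ)]
  refine lt_of_le_of_lt (lintegral_mono fun z => ENNReal.ofReal_le_ofReal ?_)
    (lt_of_le_of_lt (lintegral_mono fun z => Real.ofReal_le_enorm _) hint.2)
  have h2 : κ * (1 + ‖z‖ ^ 2) ≤ 1 + b * quadForm A z := by
    have h3 := hcoer z z.2
    rw [← Submodule.coe_norm] at h3
    have h4 : κ ≤ 1 := min_le_left _ _
    have h5 : κ ≤ b * c := min_le_right _ _
    nlinarith [mul_le_mul_of_nonneg_left h3 hb.le, mul_le_mul_of_nonneg_right h5 (sq_nonneg ‖z‖)]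
  have h6 : ((1 : ℝ) + ‖z‖ ^ 2) ^ (-(2 * (n + 1) : ℝ) / 2) = ((1 + ‖z‖ ^ 2) ^ (n + 1))⁻¹ := by
    rw [← Real.rpow_natCast (1 + ‖z‖ ^ 2), ← Real.rpow_neg (by positivity)]
    congr 1
    push_cast; ring
  have h7 : 0 < 1 + b * quadForm A z := by
    have := hnn z; positivity
  rw [h6, ← div_eq_mul_inv, div_div, ← mul_pow]
  calc C / (1 + b * quadForm A z) ^ (n + 1) ≤ |C| / (1 + b * quadForm A z) ^ (n + 1) := by
        gcongr; exact le_abs_self C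
    _ ≤ _ := by gcongr

/-- Laplace asymptotics for an integrand depending on the quadratic form of the displacement from
a graph. -/
lemma tendsto_laplace_graph (hA : A.IsHermitian) (hnn : ∀ x, 0 ≤ quadForm A x)
    (hk : A.rank = k) {a : ℝ} (ha : 0 < a) {γ : matKer A → (matKer A)ᗮ} (hγ : Measurable γ)
    {t₀ : matKer A} {r : ℝ} {q : E n → ℝ≥0∞} (hq : Measurable q) {Cq : ℝ≥0∞} (hCq : Cq ≠ ∞)
    (hqC : ∀ x, q x ≤ Cq)
    (hq0 : ∀ x, (matKer A).orthogonalProjectionOnto x ∉ Metric.ball t₀ r → q x = 0)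
    (hqcont : ∀ t ∈ Metric.ball t₀ r, ContinuousAt q (t + γ t : E n))
    {ι : Type*} {l : Filter ι} [l.IsCountablyGenerated] {sc : ι → ℝ} {f : ι → ℝ → ℝ}
    (hf : IsExpKernel l sc f) :
    Tendsto (fun y => ENNReal.ofReal (sc y ^ ((k : ℝ) / 2)) * ∫⁻ x, q x * ENNReal.ofReal
        (f y (sc y * (a / 2 * quadForm A ((matKer A)ᗮ.orthogonalProjectionOnto x -
          γ ((matKer A).orthogonalProjectionOnto x) : (matKer A)ᗮ))))) l
      (𝓝 ((∫⁻ t : matKer A, q (t + γ t)) *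
        ENNReal.ofReal ((2 * Real.pi / a) ^ ((k : ℝ) / 2) / √|pseudoDet A|))) := by
  have hqf := continuous_quadForm A
  have hpos : ∀ᶠ y in l, 0 < sc y := hf.scale.eventually_gt_atTop 0
  -- rescaling
  have key : ∀ᶠ y in l, ENNReal.ofReal (sc y ^ ((k : ℝ) / 2)) * ∫⁻ x, q x * ENNReal.ofReal
        (f y (sc y * (a / 2 * quadForm A ((matKer A)ᗮ.orthogonalProjectionOnto x -
          γ ((matKer A).orthogonalProjectionOnto x) : (matKer A)ᗮ)))) =
      ∫⁻ p : matKer A × (matKer A)ᗮ, q (p.1 + γ p.1 + ((√(sc y))⁻¹ • p.2 : (matKer A)ᗮ)) *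
        ENNReal.ofReal (f y (a / 2 * quadForm A p.2)) := by
    filter_upwards [hpos] with y hy
    have hm : Measurable fun x => q x * ENNReal.ofReal
        (f y (sc y * (a / 2 * quadForm A ((matKer A)ᗮ.orthogonalProjectionOnto x -
          γ ((matKer A).orthogonalProjectionOnto x) : (matKer A)ᗮ)))) := by
      refine hq.mul (ENNReal.measurable_ofReal.comp ((hf.meas y).comp ?_))
      refine (Measurable.const_mul (hqf.measurable.comp ?_) _).const_mul _
      exact (continuous_subtype_val.measurable).comp
        ((ContinuousLinearMap.measurable _).sub (hγ.comp (ContinuousLinearMap.measurable _)))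
    rw [lintegral_eq_lintegral_graph A γ hm, ← lintegral_const_mul' _ _ ENNReal.ofReal_ne_top,
      Measure.volume_eq_prod, lintegral_prod]
    · refine lintegral_congr fun t => ?_
      have hm2 : Measurable fun z : (matKer A)ᗮ => q (t + γ t + z) * ENNReal.ofReal
          (f y (sc y * (a / 2 * quadForm A z))) := by
        refine (hq.comp (by fun_prop)).mul (ENNReal.measurable_ofReal.comp ((hf.meas y).comp ?_))
        exact ((hqf.comp continuous_subtype_val).measurable.const_mul _).const_mul _
      -- The Jacobian of the normal dilation by `(√(sc y))⁻¹` cancels the prefactor `sc y ^ (k / 2)`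
      -- exactly.
      have h1 := lintegral_comp_smul hm2 (r := (√(sc y))⁻¹) (by positivity)
      rw [finrank_matKer_orthogonal hk] at h1
      have h2 : (((√(sc y))⁻¹) ^ k)⁻¹ = sc y ^ ((k : ℝ) / 2) := by
        rw [inv_pow, inv_inv, Real.sqrt_eq_rpow, ← Real.rpow_natCast, ← Real.rpow_mul hy.le]
        congr 1; ring
      rw [h2] at h1
      have h3 : ∀ z : (matKer A)ᗮ, (matKer A)ᗮ.orthogonalProjectionOnto (t + γ t + z : E n) -
          γ ((matKer A).orthogonalProjectionOnto (t + γ t + z : E n)) = z := by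
        intro z
        have := orthogonalProjection_graph A t (γ t + z)
        have h' := orthogonalProjection_orthogonal_graph A t (γ t + z)
        rw [Submodule.coe_add, ← add_assoc] at this h'
        rw [this, h', add_sub_cancel_left]
      simp_rw [h3]
      rw [← h1]
      refine lintegral_congr fun z => ?_
      rw [Submodule.coe_smul, quadForm_smul, inv_pow, Real.sq_sqrt hy.le]
      congr 3
      rw [mul_left_comm, ← mul_assoc (sc y), mul_inv_cancel₀ hy.ne', one_mul]
    · refine Measurable.aemeasurable ?_
      refine (hq.comp ?_).mul (ENNReal.measurable_ofReal.comp ((hf.meas y).comp ?_))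
      · have := hγ.comp (measurable_fst : Measurable (Prod.fst : matKer A × (matKer A)ᗮ → _))
        have h2 : Measurable fun p : matKer A × (matKer A)ᗮ => ((γ p.1 : (matKer A)ᗮ) : E n) :=
          measurable_subtype_coe.comp this
        have h3 : Measurable fun p : matKer A × (matKer A)ᗮ =>
            (((√(sc y))⁻¹ • p.2 : (matKer A)ᗮ) : E n) := by fun_prop
        exact ((measurable_subtype_coe.comp measurable_fst).add h2).add h3
      · exact (hqf.measurable.comp (measurable_subtype_coe.comp measurable_snd)).const_mul _
  refine Tendsto.congr' (key.mono fun y hy => hy.symm) ?_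
  have hlim : (∫⁻ t : matKer A, q (t + γ t)) *
        ENNReal.ofReal ((2 * Real.pi / a) ^ ((k : ℝ) / 2) / √|pseudoDet A|) =
      ∫⁻ p : matKer A × (matKer A)ᗮ, q (p.1 + γ p.1) *
        ENNReal.ofReal (Real.exp (-(a / 2 * quadForm A p.2))) := by
    rw [← lintegral_gaussian_orthogonal hA hnn hk ha, Measure.volume_eq_prod]
    refine (lintegral_prod_mul (f := fun t : matKer A => q (t + γ t))
      (g := fun z : (matKer A)ᗮ => ENNReal.ofReal (Real.exp (-(a / 2 * quadForm A z)))) ?_ ?_).symm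
    · exact (hq.comp (measurable_subtype_coe.add (measurable_subtype_coe.comp hγ))).aemeasurable
    · refine (ENNReal.measurable_ofReal.comp (Real.measurable_exp.comp ?_)).aemeasurable
      exact ((hqf.comp continuous_subtype_val).measurable.const_mul _).neg
  rw [hlim]
  obtain ⟨C, hC, hbd⟩ := hf.bound (n + 1)
  have hproj : ∀ (t : matKer A) (z : (matKer A)ᗮ), t ∉ Metric.ball t₀ r →
      q (t + γ t + z : E n) = 0 := by
    intro t z ht
    apply hq0
    have := orthogonalProjection_graph A t (γ t + z)
    rw [Submodule.coe_add, ← add_assoc] at this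
    rwa [this]
  -- The majorant is a product: a bounded function supported on a ball of the kernel, times the
  -- decay bound of the kernel family of order `n + 1` in the normal variable.
  refine tendsto_lintegral_filter_of_dominated_convergence
    (fun p => (Metric.ball t₀ r).indicator (fun _ => Cq) p.1 *
      ENNReal.ofReal (C / (1 + a / 2 * quadForm A p.2) ^ (n + 1))) ?_ ?_ ?_ ?_
  · filter_upwards with y
    refine (hq.comp ?_).mul (ENNReal.measurable_ofReal.comp ((hf.meas y).comp ?_))
    · have := hγ.comp (measurable_fst : Measurable (Prod.fst : matKer A × (matKer A)ᗮ → _))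
      have h2 : Measurable fun p : matKer A × (matKer A)ᗮ => ((γ p.1 : (matKer A)ᗮ) : E n) :=
        measurable_subtype_coe.comp this
      have h3 : Measurable fun p : matKer A × (matKer A)ᗮ =>
          (((√(sc y))⁻¹ • p.2 : (matKer A)ᗮ) : E n) := by fun_prop
      exact ((measurable_subtype_coe.comp measurable_fst).add h2).add h3
    · exact (hqf.measurable.comp (measurable_subtype_coe.comp measurable_snd)).const_mul _
  · filter_upwards [hbd] with y hy
    refine Eventually.of_forall fun p => ?_
    by_cases hp : p.1 ∈ Metric.ball t₀ r
    · rw [Set.indicator_of_mem hp]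
      exact mul_le_mul' (hqC _) (ENNReal.ofReal_le_ofReal
        (hy _ (mul_nonneg (by positivity) (hnn _))))
    · rw [hproj _ _ hp, zero_mul]
      exact zero_le
  · rw [Measure.volume_eq_prod, lintegral_prod_mul
      (f := (Metric.ball t₀ r).indicator fun _ => Cq)
      (g := fun z : (matKer A)ᗮ => ENNReal.ofReal (C / (1 + a / 2 * quadForm A z) ^ (n + 1)))]
    · refine ENNReal.mul_ne_top ?_
        (lintegral_polynomial_decay_lt_top hA hnn (half_pos ha) C).ne
      rw [lintegral_indicator Metric.isOpen_ball.measurableSet, setLIntegral_const]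
      exact ENNReal.mul_ne_top hCq measure_ball_lt_top.ne
    · exact (measurable_const.indicator Metric.isOpen_ball.measurableSet).aemeasurable
    · refine (ENNReal.measurable_ofReal.comp (Measurable.const_div (Measurable.pow_const
        (Measurable.const_add ?_ _) _) _)).aemeasurable
      exact (hqf.comp continuous_subtype_val).measurable.const_mul _
  · refine Eventually.of_forall fun p => ?_
    by_cases hp : p.1 ∈ Metric.ball t₀ r
    · refine ENNReal.Tendsto.mul ?_ (Or.inr ENNReal.ofReal_ne_top) ?_
        (Or.inr (ne_top_of_le_ne_top hCq (hqC _)))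
      -- The normal displacement shrinks to 0, so only continuity of `q` at points of the graph is
      -- needed.
      · refine (hqcont _ hp).tendsto.comp ?_
        have h1 : Tendsto (fun y => (√(sc y))⁻¹) l (𝓝 0) :=
          tendsto_inv_atTop_zero.comp (Real.tendsto_sqrt_atTop.comp hf.scale)
        have h2 : Tendsto (fun y => (p.1 + γ p.1 + (√(sc y))⁻¹ • (p.2 : E n) : E n)) l
            (𝓝 (p.1 + γ p.1 + (0 : ℝ) • (p.2 : E n))) :=
          tendsto_const_nhds.add (h1.smul_const _)
        simpa using h2
      · exact (ENNReal.continuous_ofReal.tendsto _).comp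
          (hf.lim _ (mul_nonneg (by positivity) (hnn _)))
    · have h0 : q (p.1 + γ p.1 : E n) = 0 := by simpa using hproj p.1 0 hp
      rw [h0, zero_mul]
      refine tendsto_const_nhds.congr fun y => ?_
      rw [hproj _ _ hp, zero_mul]

end Laplace

end PolarChaos
end

/-! ### Hausdorff measure of Lipschitz graphs, and local Laplace asymptotics. -/

noncomputable section

namespace PolarChaos

open scoped ENNReal NNReal

lemma euclideanHausdorffMeasure_image_le {X Y : Type*} [EMetricSpace X] [MeasurableSpace X]
    [BorelSpace X] [EMetricSpace Y] [MeasurableSpace Y] [BorelSpace Y] {K : ℝ≥0} {f : X → Y}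
    {s : Set X} (h : LipschitzOnWith K f s) (m : ℕ) :
    (μHE[m] : Measure Y) (f '' s) ≤ (K : ℝ≥0∞) ^ m * (μHE[m] : Measure X) s := by
  have h1 := h.hausdorffMeasure_image_le (d := m) (Nat.cast_nonneg m)
  rw [ENNReal.rpow_natCast] at h1
  simp only [Measure.euclideanHausdorffMeasure_def, Measure.smul_apply, ENNReal.smul_def,
    smul_eq_mul]
  calc _ ≤ _ * ((K : ℝ≥0∞) ^ m * μH[m] s) := by gcongr
    _ = _ := by ring

section Graph

variable {n m k : ℕ} {A : Matrix (Fin n) (Fin n) ℝ}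

lemma euclideanHausdorffMeasure_matKer (hmk : m + k = n) (hk : A.rank = k) :
    (μHE[m] : Measure (matKer A)) = volume := by
  have h : Module.finrank ℝ (matKer A) = m := by rw [finrank_matKer, hk]; omega
  rw [← h]
  exact InnerProductSpace.euclideanHausdorffMeasure_eq_volume

variable {γ : matKer A → (matKer A)ᗮ} {t₀ : matKer A} {r ε : ℝ}

/-- The orthogonal projection inverts the graph map and is 1-Lipschitz, so it does not increase
`m`-dimensional volume. -/
lemma map_graph_le (hmk : m + k = n) (hk : A.rank = k) (hγ : Measurable γ) :
    (volume.restrict (Metric.ball t₀ r)).map (fun t => (t + γ t : E n)) ≤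
      (μHE[m] : Measure (E n)).restrict ((fun t => (t + γ t : E n)) '' Metric.ball t₀ r) := by
  have hm : Measurable fun t : matKer A => (t + γ t : E n) :=
    measurable_subtype_coe.add (measurable_subtype_coe.comp hγ)
  refine Measure.le_iff.2 fun s hs => ?_
  rw [Measure.map_apply hm hs, Measure.restrict_apply (hm hs), Measure.restrict_apply hs,
    ← euclideanHausdorffMeasure_matKer hmk hk]
  have hlip : LipschitzOnWith 1 (matKer A).orthogonalProjectionOnto
      (s ∩ (fun t => (t + γ t : E n)) '' Metric.ball t₀ r) :=
    (matKer A).lipschitzWith_orthogonalProjectionOnto.lipschitzOnWith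
  have h1 := euclideanHausdorffMeasure_image_le hlip m
  rw [ENNReal.coe_one, one_pow, one_mul] at h1
  refine (measure_mono ?_).trans h1
  rintro t ⟨ht1, ht2⟩
  exact ⟨_, ⟨ht1, t, ht2, rfl⟩, orthogonalProjection_graph A t (γ t)⟩

/-- The graph map is `(1 + ε)`-Lipschitz. Together with `map_graph_le` this compares surface measure
with Lebesgue measure on the kernel up to `(1 + ε) ^ m`; since the slope can be made arbitrarily
small, no area formula is needed. -/
lemma le_map_graph (hmk : m + k = n) (hk : A.rank = k) (hγ : Measurable γ) (hε : 0 ≤ ε)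
    (hlip : ∀ t ∈ Metric.ball t₀ r, ∀ t' ∈ Metric.ball t₀ r, ‖γ t - γ t'‖ ≤ ε * ‖t - t'‖) :
    (μHE[m] : Measure (E n)).restrict ((fun t => (t + γ t : E n)) '' Metric.ball t₀ r) ≤
      ENNReal.ofReal ((1 + ε) ^ m) •
        (volume.restrict (Metric.ball t₀ r)).map (fun t => (t + γ t : E n)) := by
  have hm : Measurable fun t : matKer A => (t + γ t : E n) :=
    measurable_subtype_coe.add (measurable_subtype_coe.comp hγ)
  refine Measure.le_iff.2 fun s hs => ?_
  rw [Measure.smul_apply, Measure.map_apply hm hs, Measure.restrict_apply (hm hs),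
    Measure.restrict_apply hs, ← euclideanHausdorffMeasure_matKer hmk hk]
  have hL : LipschitzOnWith (1 + ε).toNNReal (fun t : matKer A => (t + γ t : E n))
      ((fun t => (t + γ t : E n)) ⁻¹' s ∩ Metric.ball t₀ r) := by
    refine LipschitzOnWith.of_dist_le_mul fun t ht t' ht' => ?_
    rw [Real.coe_toNNReal _ (by positivity), dist_eq_norm, dist_eq_norm]
    calc ‖(t + γ t : E n) - (t' + γ t')‖ = ‖((t - t' : matKer A) : E n) +
          ((γ t - γ t' : (matKer A)ᗮ) : E n)‖ := by
            congr 1; simp only [Submodule.coe_sub]; abel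
      _ ≤ ‖t - t'‖ + ‖γ t - γ t'‖ := norm_add_le _ _
      _ ≤ ‖t - t'‖ + ε * ‖t - t'‖ := by gcongr; exact hlip t ht.2 t' ht'.2
      _ = _ := by ring
  have h1 := euclideanHausdorffMeasure_image_le hL m
  rw [ENNReal.ofReal_pow (by positivity), smul_eq_mul]
  refine (measure_mono ?_).trans h1
  rintro _ ⟨hxs, t, ht, rfl⟩
  exact ⟨t, ⟨hxs, ht⟩, rfl⟩

end Graph

/-- Local Laplace asymptotics near a point of a non-degenerate manifold of minima. -/
theorem exists_nhds_laplace {n m k : ℕ} (hmk : m + k = n) {S : E n → ℝ} {x₀ : E n}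
    (hS : ContDiffAt ℝ 2 S x₀) (h0 : S x₀ = 0) (hnn : ∀ᶠ x in 𝓝 x₀, 0 ≤ S x)
    (hrank : (hessian S x₀).rank = k)
    {i : E m → E n} {i' : E m →L[ℝ] E n} (hi : HasStrictFDerivAt i i' 0)
    (hi' : Function.Injective i') (hi0 : i 0 = x₀) (hiZ : ∀ᶠ s in 𝓝 0, S (i s) = 0)
    {ε : ℝ} (hε : 0 < ε) {W₀ : Set (E n)} (hW₀ : W₀ ∈ 𝓝 x₀) :
    ∃ W, IsOpen W ∧ x₀ ∈ W ∧ W ⊆ W₀ ∧ (μHE[m] : Measure (E n)) {x ∈ W | S x = 0} < ∞ ∧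
      0 < (μHE[m] : Measure (E n)) {x ∈ W | S x = 0} ∧
      ∀ (q : E n → ℝ≥0∞) (Cq : ℝ≥0∞), Measurable q → Cq ≠ ∞ → (∀ x, q x ≤ Cq) →
        ContinuousOn q W → (∀ x ∉ W, q x = 0) →
        ∀ (ι : Type) (l : Filter ι) (sc : ι → ℝ) (f : ι → ℝ → ℝ), l.IsCountablyGenerated →
          IsExpKernel l sc f → ∀ δ : ℝ≥0∞, 0 < δ →
          (∀ᶠ y in l, ENNReal.ofReal (sc y ^ ((k : ℝ) / 2)) *
              ∫⁻ x, q x * ENNReal.ofReal (f y (sc y * S x)) ≤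
            ENNReal.ofReal ((1 + ε) * ((2 * Real.pi) ^ ((k : ℝ) / 2) /
              √|pseudoDet (hessian S x₀)|)) * (∫⁻ x in {x ∈ W | S x = 0}, q x ∂μHE[m]) + δ) ∧
          (∀ᶠ y in l, ENNReal.ofReal ((1 - ε) * ((2 * Real.pi) ^ ((k : ℝ) / 2) /
              √|pseudoDet (hessian S x₀)|)) * (∫⁻ x in {x ∈ W | S x = 0}, q x ∂μHE[m]) ≤
            ENNReal.ofReal (sc y ^ ((k : ℝ) / 2)) *
              (∫⁻ x, q x * ENNReal.ofReal (f y (sc y * S x))) + δ) := by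
  -- choice of the slope
  obtain ⟨e, he0, he1, heu, hel⟩ : ∃ e : ℝ, 0 < e ∧ e < 1 ∧
      (1 / (1 - e)) ^ ((k : ℝ) / 2) ≤ 1 + ε ∧
      1 - ε ≤ (1 / (1 + e)) ^ ((k : ℝ) / 2) * ((1 + e) ^ m)⁻¹ := by
    have h1 : ContinuousAt (fun e : ℝ => (1 / (1 - e)) ^ ((k : ℝ) / 2)) 0 := by
      refine ContinuousAt.rpow_const (ContinuousAt.div continuousAt_const
        (by fun_prop) (by norm_num)) (Or.inl (by norm_num))
    have h2 : ContinuousAt (fun e : ℝ => (1 / (1 + e)) ^ ((k : ℝ) / 2) * ((1 + e) ^ m)⁻¹) 0 := by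
      refine ContinuousAt.mul (ContinuousAt.rpow_const (ContinuousAt.div continuousAt_const
        (by fun_prop) (by norm_num)) (Or.inl (by norm_num)))
        (ContinuousAt.inv₀ (by fun_prop) (by norm_num))
    have h3 := (h1.mono_left (nhdsWithin_le_nhds (s := Set.Ioi 0))).eventually
      (gt_mem_nhds (show (1 / (1 - (0 : ℝ))) ^ ((k : ℝ) / 2) < 1 + ε by norm_num; exact hε))
    have h4 := (h2.mono_left (nhdsWithin_le_nhds (s := Set.Ioi 0))).eventually
      (lt_mem_nhds (show 1 - ε < (1 / (1 + (0 : ℝ))) ^ ((k : ℝ) / 2) * ((1 + 0) ^ m)⁻¹ by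
        norm_num; exact hε))
    obtain ⟨e, ⟨⟨h5, h6⟩, h7⟩, h8⟩ := (((h3.and h4).and
      (nhdsWithin_le_nhds (gt_mem_nhds (zero_lt_one' ℝ)))).and self_mem_nhdsWithin).exists
    exact ⟨e, h8, h7, h5.le, h6.le⟩
  set A := hessian S x₀ with hAdef
  have hA : A.IsHermitian := hessian_isHermitian hS
  have hqnn : ∀ x, 0 ≤ quadForm A x := quadForm_hessian_nonneg hS h0 hnn
  obtain ⟨c, hc, hcoer⟩ := exists_coercive hA hqnn
  obtain ⟨r, ρ, γ', hG, hγ₀⟩ := exists_isMinGraph hmk hS h0 hnn hrank hi hi' hi0 hiZ he0 hW₀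
  set t₀ := (matKer A).orthogonalProjectionOnto x₀ with ht₀
  -- a measurable extension of the graph map
  obtain ⟨γ, hγm, hγeq⟩ : ∃ γ : matKer A → (matKer A)ᗮ, Measurable γ ∧
      ∀ t ∈ Metric.ball t₀ r, γ t = γ' t := by
    classical
    refine ⟨(Metric.ball t₀ r).piecewise γ' 0, ?_, fun t ht => Set.piecewise_eq_of_mem _ _ _ ht⟩
    refine ContinuousOn.measurable_piecewise ?_ continuousOn_const Metric.isOpen_ball.measurableSet
    have : LipschitzOnWith e.toNNReal γ' (Metric.ball t₀ r) :=
      LipschitzOnWith.of_dist_le_mul fun t ht t' ht' => by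
        rw [Real.coe_toNNReal _ he0.le, dist_eq_norm, dist_eq_norm]
        exact hG.lip t ht t' ht'
    exact this.continuousOn
  have hlip : ∀ t ∈ Metric.ball t₀ r, ∀ t' ∈ Metric.ball t₀ r, ‖γ t - γ t'‖ ≤ e * ‖t - t'‖ := by
    intro t ht t' ht'
    rw [hγeq t ht, hγeq t' ht']
    exact hG.lip t ht t' ht'
  have hγcont : ContinuousOn γ (Metric.ball t₀ r) := by
    have : LipschitzOnWith e.toNNReal γ (Metric.ball t₀ r) :=
      LipschitzOnWith.of_dist_le_mul fun t ht t' ht' => by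
        rw [Real.coe_toNNReal _ he0.le, dist_eq_norm, dist_eq_norm]
        exact hlip t ht t' ht'
    exact this.continuousOn
  set P := (matKer A).orthogonalProjectionOnto with hP
  set R := (matKer A)ᗮ.orthogonalProjectionOnto with hR
  have hdec : ∀ x : E n, x = P x + γ (P x) + ((R x - γ (P x) : (matKer A)ᗮ) : E n) := by
    intro x
    have := (matKer A).starProjection_add_starProjection_orthogonal x
    simp only [Submodule.starProjection_apply] at this
    rw [Submodule.coe_sub]
    nth_rewrite 1 [← this]
    abel
  -- The neighbourhood is a tube around the graph: any point of it has a base point in the ball and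
  -- a normal displacement shorter than `ρ`.
  set W : Set (E n) := {x | P x ∈ Metric.ball t₀ r ∧ ‖R x - γ (P x)‖ < ρ} with hWdef
  have hWopen : IsOpen W := by
    have h1 : IsOpen (P ⁻¹' Metric.ball t₀ r) := Metric.isOpen_ball.preimage P.continuous
    have h2 : ContinuousOn (fun x => R x - γ (P x)) (P ⁻¹' Metric.ball t₀ r) :=
      R.continuous.continuousOn.sub (hγcont.comp P.continuous.continuousOn fun x hx => hx)
    have h3 := h2.isOpen_inter_preimage h1 (Metric.isOpen_ball (x := 0) (ε := ρ))
    convert h3 using 1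
    ext x
    simp [hWdef]
  have hlow : ∀ x ∈ W, (1 - e) / 2 * quadForm A (R x - γ (P x) : (matKer A)ᗮ) ≤ S x := by
    intro x hx
    have := hG.lower _ hx.1 (R x - γ (P x)) hx.2
    rwa [← hγeq _ hx.1, ← hdec x] at this
  have hupp : ∀ x ∈ W, S x ≤ (1 + e) / 2 * quadForm A (R x - γ (P x) : (matKer A)ᗮ) := by
    intro x hx
    have := hG.upper _ hx.1 (R x - γ (P x)) hx.2
    rwa [← hγeq _ hx.1, ← hdec x] at this
  have hPg : ∀ t, P (t + γ t : E n) = t := fun t => orthogonalProjection_graph A t (γ t)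
  have hRg : ∀ t, R (t + γ t : E n) = γ t := fun t => orthogonalProjection_orthogonal_graph A t (γ t)
  -- Inside the tube the lower quadratic bound and coercivity force a zero to have no normal
  -- displacement; on the graph itself both bounds vanish.
  have hZ : {x ∈ W | S x = 0} = (fun t => (t + γ t : E n)) '' Metric.ball t₀ r := by
    ext x
    constructor
    · rintro ⟨hx, hx0⟩
      refine ⟨P x, hx.1, ?_⟩
      have h1 := hlow x hx
      rw [hx0] at h1
      have h2 := hcoer _ (R x - γ (P x)).2
      have h3 : quadForm A (R x - γ (P x) : (matKer A)ᗮ) ≤ 0 := by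
        by_contra hcon
        rw [not_le] at hcon
        have : 0 < (1 - e) / 2 := by linarith
        nlinarith [mul_pos this hcon]
      have h4 : ‖((R x - γ (P x) : (matKer A)ᗮ) : E n)‖ ^ 2 ≤ 0 := by
        by_contra hcon
        rw [not_le] at hcon
        nlinarith [mul_pos hc hcon]
      have h5 : ((R x - γ (P x) : (matKer A)ᗮ) : E n) = 0 := by
        rw [← norm_eq_zero]
        exact pow_eq_zero_iff (two_ne_zero) |>.1 (le_antisymm h4 (sq_nonneg _))
      have h6 := hdec x
      rw [h5, add_zero] at h6
      exact h6.symm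
    · rintro ⟨t, ht, rfl⟩
      have hmem : (t + γ t : E n) ∈ W := by
        refine ⟨by rwa [hPg], ?_⟩
        rw [hRg, hPg, sub_self, norm_zero]
        exact hG.rho_pos
      refine ⟨hmem, ?_⟩
      have h1 := hlow _ hmem
      have h2 := hupp _ hmem
      rw [hRg, hPg, sub_self] at h1 h2
      have h3 : quadForm A ((0 : (matKer A)ᗮ) : E n) = 0 := by simp [quadForm]
      rw [h3, mul_zero] at h1 h2
      exact le_antisymm h2 h1
  have hx₀W : x₀ ∈ W := by
    refine ⟨Metric.mem_ball_self hG.r_pos, ?_⟩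
    rw [hγeq _ (Metric.mem_ball_self hG.r_pos), hγ₀, sub_self, norm_zero]
    exact hG.rho_pos
  have hup := map_graph_le (t₀ := t₀) (r := r) hmk hrank hγm
  have hlo := le_map_graph hmk hrank hγm he0.le hlip
  rw [← hZ] at hup hlo
  have hm : Measurable fun t : matKer A => (t + γ t : E n) :=
    measurable_subtype_coe.add (measurable_subtype_coe.comp hγm)
  refine ⟨W, hWopen, hx₀W, ?_, ?_, ?_, ?_⟩
  · intro x hx
    have := hG.mem _ hx.1 (R x - γ (P x)) hx.2
    rwa [← hγeq _ hx.1, ← hdec x] at this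
  · have := hlo Set.univ
    rw [Measure.restrict_apply_univ, Measure.smul_apply, Measure.map_apply hm MeasurableSet.univ,
      Set.preimage_univ, Measure.restrict_apply_univ] at this
    exact this.trans_lt (ENNReal.mul_lt_top ENNReal.ofReal_lt_top measure_ball_lt_top)
  · have := hup Set.univ
    rw [Measure.restrict_apply_univ, Measure.map_apply hm MeasurableSet.univ,
      Set.preimage_univ, Measure.restrict_apply_univ] at this
    exact (Metric.measure_ball_pos volume t₀ hG.r_pos).trans_le this
  intro q Cq hq hCq hqC hqcont hq0 ι l sc f hl hf δ hδ
  have hq0' : ∀ x, P x ∉ Metric.ball t₀ r → q x = 0 := fun x hx => hq0 x fun h => hx h.1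
  have hqc : ∀ t ∈ Metric.ball t₀ r, ContinuousAt q (t + γ t : E n) := by
    intro t ht
    have : (t + γ t : E n) ∈ {x ∈ W | S x = 0} := by rw [hZ]; exact ⟨t, ht, rfl⟩
    exact hqcont.continuousAt (hWopen.mem_nhds this.1)
  have hI : ∫⁻ t : matKer A, q (t + γ t) =
      ∫⁻ x, q x ∂((volume.restrict (Metric.ball t₀ r)).map (fun t => (t + γ t : E n))) := by
    rw [lintegral_map hq hm, ← lintegral_indicator Metric.isOpen_ball.measurableSet]
    refine lintegral_congr fun t => ?_
    by_cases ht : t ∈ Metric.ball t₀ r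
    · rw [Set.indicator_of_mem ht]
    · rw [Set.indicator_of_notMem ht]
      apply hq0'
      rwa [hPg]
  set J := ∫⁻ t : matKer A, q (t + γ t) with hJ
  set I := ∫⁻ x in {x ∈ W | S x = 0}, q x ∂μHE[m] with hIdef
  have hJI : J ≤ I := by rw [hI]; exact lintegral_mono' hup le_rfl
  have hIJ : I ≤ ENNReal.ofReal ((1 + e) ^ m) * J := by
    rw [hI, ← smul_eq_mul, ← lintegral_smul_measure]
    exact lintegral_mono' hlo le_rfl
  have hJtop : J ≠ ∞ := by
    have : J ≤ ∫⁻ x, Cq ∂((volume.restrict (Metric.ball t₀ r)).map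
        (fun t => (t + γ t : E n))) := by rw [hI]; exact lintegral_mono hqC
    refine ne_top_of_le_ne_top ?_ this
    rw [lintegral_const, Measure.map_apply hm MeasurableSet.univ, Set.preimage_univ,
      Measure.restrict_apply_univ]
    exact ENNReal.mul_ne_top hCq measure_ball_lt_top.ne
  set D := √|pseudoDet A| with hD
  have hDpos : 0 < D := Real.sqrt_pos.2 (pseudoDet_pos_abs hA)
  have hsplit : ∀ a : ℝ, 0 < a → (2 * Real.pi / a) ^ ((k : ℝ) / 2) / D =
      (1 / a) ^ ((k : ℝ) / 2) * ((2 * Real.pi) ^ ((k : ℝ) / 2) / D) := by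
    intro a ha
    rw [div_eq_mul_one_div (2 * Real.pi), mul_comm (2 * Real.pi),
      Real.mul_rpow (by positivity) (by positivity), mul_div_assoc]
  have hc0 : 0 ≤ (2 * Real.pi) ^ ((k : ℝ) / 2) / D := by positivity
  constructor
  -- Since the kernel functions decrease, the lower bound on `S` bounds the integral from above.
  -- This is the exact Laplace limit with form scaled by `1 - e`; the other inequality uses `1 + e`.
  · have h1 := tendsto_laplace_graph hA hqnn hrank (a := 1 - e) (by linarith) hγm hq hCq hqC hq0'
      hqc hf
    have hle : J * ENNReal.ofReal ((2 * Real.pi / (1 - e)) ^ ((k : ℝ) / 2) / D) ≤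
        ENNReal.ofReal ((1 + ε) * ((2 * Real.pi) ^ ((k : ℝ) / 2) / D)) * I := by
      rw [mul_comm]
      refine mul_le_mul' (ENNReal.ofReal_le_ofReal ?_) hJI
      rw [hsplit _ (by linarith)]
      gcongr
    have hfin : J * ENNReal.ofReal ((2 * Real.pi / (1 - e)) ^ ((k : ℝ) / 2) / D) ≠ ∞ :=
      ENNReal.mul_ne_top hJtop ENNReal.ofReal_ne_top
    filter_upwards [h1.eventually (gt_mem_nhds (ENNReal.lt_add_right hfin hδ.ne')), hf.anti,
      hf.scale.eventually_ge_atTop 0] with y hy hanti hsc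
    refine le_trans ?_ (hy.le.trans (by gcongr))
    refine mul_le_mul' le_rfl (lintegral_mono fun x => ?_)
    by_cases hx : x ∈ W
    · exact mul_le_mul' le_rfl (ENNReal.ofReal_le_ofReal
        (hanti (mul_le_mul_of_nonneg_left (hlow x hx) hsc)))
    · rw [hq0 x hx, zero_mul, zero_mul]
  · have h1 := tendsto_laplace_graph hA hqnn hrank (a := 1 + e) (by linarith) hγm hq hCq hqC hq0'
      hqc hf
    have hle : ENNReal.ofReal ((1 - ε) * ((2 * Real.pi) ^ ((k : ℝ) / 2) / D)) * I ≤
        J * ENNReal.ofReal ((2 * Real.pi / (1 + e)) ^ ((k : ℝ) / 2) / D) := by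
      calc _ ≤ ENNReal.ofReal ((1 - ε) * ((2 * Real.pi) ^ ((k : ℝ) / 2) / D)) *
            (ENNReal.ofReal ((1 + e) ^ m) * J) := by gcongr
        _ = J * ENNReal.ofReal ((1 - ε) * ((2 * Real.pi) ^ ((k : ℝ) / 2) / D) * (1 + e) ^ m) := by
            rw [ENNReal.ofReal_mul' (q := (1 + e) ^ m) (by positivity)]; ring
        _ ≤ _ := by
            refine mul_le_mul' le_rfl (ENNReal.ofReal_le_ofReal ?_)
            rw [hsplit _ (by linarith), mul_right_comm]
            refine mul_le_mul_of_nonneg_right ?_ hc0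
            calc (1 - ε) * (1 + e) ^ m ≤
                ((1 / (1 + e)) ^ ((k : ℝ) / 2) * ((1 + e) ^ m)⁻¹) * (1 + e) ^ m := by gcongr
              _ = _ := by field_simp
    have hfin : J * ENNReal.ofReal ((2 * Real.pi / (1 + e)) ^ ((k : ℝ) / 2) / D) ≠ ∞ :=
      ENNReal.mul_ne_top hJtop ENNReal.ofReal_ne_top
    have h2 := h1.add (tendsto_const_nhds (x := δ))
    filter_upwards [h2.eventually (lt_mem_nhds (ENNReal.lt_add_right hfin hδ.ne')), hf.anti,
      hf.scale.eventually_ge_atTop 0] with y hy hanti hsc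
    refine hle.trans (hy.le.trans ?_)
    refine add_le_add_left (mul_le_mul' le_rfl (lintegral_mono fun x => ?_)) _
    by_cases hx : x ∈ W
    · exact mul_le_mul' le_rfl (ENNReal.ofReal_le_ofReal
        (hanti (mul_le_mul_of_nonneg_left (hupp x hx) hsc)))
    · rw [hq0 x hx, zero_mul, zero_mul]

end PolarChaos
end

/-! ### Spherical coordinates: recursive structure, orthonormal frame and derivative. -/

noncomputable section

namespace PolarChaos

section Frame

variable {d : ℕ}

/-- The product of sines `∏_{k ≤ l < i} sin φ_l`, set to `0` for `i < k`. -/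
def sinProd (φ : E (d - 1)) (k i : ℕ) : ℝ :=
  if k ≤ i then ∏ l : Fin (d - 1), (if k ≤ l.val ∧ l.val < i then Real.sin (φ l) else 1) else 0

lemma sinProd_self (φ : E (d - 1)) (k : ℕ) : sinProd φ k k = 1 := by
  rw [sinProd, if_pos le_rfl]
  refine Finset.prod_eq_one fun l _ => if_neg ?_
  omega

lemma sinProd_of_lt (φ : E (d - 1)) {k i : ℕ} (h : i < k) : sinProd φ k i = 0 :=
  if_neg (by omega)

lemma sinProd_succ (φ : E (d - 1)) (k : Fin (d - 1)) {i : ℕ} (h : i ≠ k) :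
    sinProd φ k i = Real.sin (φ k) * sinProd φ (k + 1) i := by
  rcases lt_or_gt_of_ne h with h | h
  · rw [sinProd_of_lt φ h, sinProd_of_lt φ (by omega), mul_zero]
  rw [sinProd, if_pos h.le, sinProd, if_pos (by omega),
    ← Finset.mul_prod_erase Finset.univ _ (Finset.mem_univ k),
    ← Finset.mul_prod_erase Finset.univ (fun l : Fin (d - 1) =>
      if k.val + 1 ≤ l.val ∧ l.val < i then Real.sin (φ l) else 1) (Finset.mem_univ k)]
  rw [if_pos ⟨le_rfl, h⟩, if_neg (by omega), one_mul]
  congr 1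
  refine Finset.prod_congr rfl fun l hl => ?_
  have hlk : l.val ≠ k.val := fun hc => (Finset.mem_erase.1 hl).1 (Fin.ext hc)
  congr 1
  exact propext ⟨fun hx => ⟨by omega, hx.2⟩, fun hx => ⟨by omega, hx.2⟩⟩

/-- The cosine factor of the `i`-th Cartesian coordinate. -/
def cosFactor (φ : E (d - 1)) (i : ℕ) : ℝ :=
  if h : i < d - 1 then Real.cos (φ ⟨i, h⟩) else 1

/-- The point of the sphere in the last coordinates determined by the angles from index `k` on. -/
def tailPoint (φ : E (d - 1)) (k : ℕ) : E d :=
  WithLp.toLp 2 fun i : Fin d => sinProd φ k i * cosFactor φ i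

lemma tailPoint_apply (φ : E (d - 1)) (k : ℕ) (i : Fin d) :
    tailPoint φ k i = sinProd φ k i * cosFactor φ i := rfl

lemma sphPoint_eq_tailPoint (φ : E (d - 1)) : sphPoint φ = tailPoint φ 0 := by
  ext i
  simp [sphPoint, tailPoint_apply, sinProd, cosFactor]

/-- The Cartesian basis vector with the index of an angle. -/
def axis (k : Fin (d - 1)) : E d := EuclideanSpace.single (k.castLE (Nat.sub_le d 1)) 1

/-- The recursion behind all computations with the coordinates: each angle rotates its own axis
towards the point determined by the later angles. -/
lemma tailPoint_succ (φ : E (d - 1)) (k : Fin (d - 1)) :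
    tailPoint φ k = Real.cos (φ k) • axis k + Real.sin (φ k) • tailPoint φ (k + 1) := by
  ext i
  simp only [PiLp.add_apply, PiLp.smul_apply, smul_eq_mul, tailPoint_apply, axis,
    PiLp.single_apply]
  by_cases hi : i.val = k.val
  · have : i = k.castLE (Nat.sub_le d 1) := Fin.ext hi
    rw [if_pos this, hi, sinProd_self, sinProd_of_lt φ (Nat.lt_succ_self _)]
    simp [cosFactor]
  · have : i ≠ k.castLE (Nat.sub_le d 1) := fun hc => hi (by rw [hc]; rfl)
    rw [if_neg this, sinProd_succ φ k hi]
    ring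

lemma tailPoint_last (φ : E (d - 1)) (hd : 1 ≤ d) :
    tailPoint φ (d - 1) = EuclideanSpace.single (⟨d - 1, by omega⟩ : Fin d) 1 := by
  ext i
  simp only [tailPoint_apply, PiLp.single_apply]
  by_cases hi : i.val = d - 1
  · rw [if_pos (Fin.ext hi), hi, sinProd_self]
    simp [cosFactor]
  · rw [if_neg (fun hc => hi (by rw [hc])), sinProd_of_lt φ (by omega), zero_mul]

lemma inner_axis (k : Fin (d - 1)) (x : E d) :
    inner ℝ (axis k) x = x (k.castLE (Nat.sub_le d 1)) := by
  rw [axis, EuclideanSpace.inner_single_left]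
  simp

lemma inner_axis_tailPoint (φ : E (d - 1)) (k : Fin (d - 1)) {j : ℕ} (h : k.val < j) :
    inner ℝ (axis k) (tailPoint φ j) = 0 := by
  rw [inner_axis, tailPoint_apply, sinProd_of_lt φ (by simpa using h), zero_mul]

lemma norm_axis (k : Fin (d - 1)) : ‖axis (d := d) k‖ = 1 := by simp [axis]

lemma decreasing_angle_induction {P : ℕ → Prop} (h0 : P (d - 1))
    (hs : ∀ k : Fin (d - 1), P (k + 1) → P k) {k : ℕ} (hk : k ≤ d - 1) : P k := by
  induction hk using Nat.decreasingInduction with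
  | of_succ k hk ih => exact hs ⟨k, hk⟩ ih
  | self => exact h0

lemma norm_tailPoint (φ : E (d - 1)) (hd : 1 ≤ d) {k : ℕ} (hk : k ≤ d - 1) :
    ‖tailPoint φ k‖ = 1 := by
  refine decreasing_angle_induction (P := fun k => ‖tailPoint φ k‖ = 1) ?_ (fun k ih => ?_) hk
  · rw [tailPoint_last φ hd]; simp
  · have h := inner_axis_tailPoint φ k (Nat.lt_succ_self _)
    have h2 : ‖tailPoint φ k‖ ^ 2 = 1 := by
      rw [tailPoint_succ, norm_add_sq_real, inner_smul_left, inner_smul_right, h, norm_smul,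
        norm_smul, ih, norm_axis]
      simp [Real.cos_sq_add_sin_sq]
    exact (pow_eq_one_iff_of_nonneg (norm_nonneg _) two_ne_zero).1 h2

lemma norm_sphPoint (φ : E (d - 1)) (hd : 1 ≤ d) : ‖sphPoint φ‖ = 1 := by
  rw [sphPoint_eq_tailPoint, norm_tailPoint φ hd (Nat.zero_le _)]

/-- The unit tangent vector in the direction of increasing `φ_k`. -/
def frame (φ : E (d - 1)) (k : Fin (d - 1)) : E d :=
  -Real.sin (φ k) • axis k + Real.cos (φ k) • tailPoint φ (k + 1)

lemma inner_axis_frame (φ : E (d - 1)) {j k : Fin (d - 1)} (h : j < k) :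
    inner ℝ (axis j) (frame φ k) = 0 := by
  rw [frame, inner_add_right, inner_smul_right, inner_smul_right,
    inner_axis_tailPoint φ j (by have : j.val < k.val := h; omega), inner_axis, axis,
    PiLp.single_apply, if_neg]
  · simp
  · intro hc
    have : j.val = k.val := congrArg (fun i : Fin d => i.val) hc
    exact absurd h (by rw [Fin.lt_def]; omega)

lemma inner_axis_self (k : Fin (d - 1)) : inner ℝ (axis (d := d) k) (axis k) = 1 := by
  rw [real_inner_self_eq_norm_sq, norm_axis]; norm_num

lemma inner_tailPoint_self (φ : E (d - 1)) (k : Fin (d - 1)) :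
    inner ℝ (tailPoint φ (k + 1)) (tailPoint φ (k + 1)) = 1 := by
  rw [real_inner_self_eq_norm_sq, norm_tailPoint φ (by have := k.2; omega)
    (by have := k.2; omega)]; norm_num

lemma inner_tailPoint_frame (φ : E (d - 1)) (k : Fin (d - 1)) {j : ℕ} (hj : j ≤ k) :
    inner ℝ (tailPoint φ j) (frame φ k) = 0 := by
  have h1 := inner_axis_tailPoint φ k (Nat.lt_succ_self _)
  induction hj using Nat.decreasingInduction with
  | of_succ j hj ih =>
    have hjk : (⟨j, by omega⟩ : Fin (d - 1)) < k := hj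
    rw [show j = (⟨j, by omega⟩ : Fin (d - 1)).val from rfl, tailPoint_succ, inner_add_left,
      inner_smul_left, inner_smul_left, inner_axis_frame φ hjk, ih]
    simp
  | self =>
    rw [tailPoint_succ, frame]
    simp only [inner_add_left, inner_add_right, inner_smul_left, inner_smul_right, h1,
      inner_axis_self, inner_tailPoint_self, real_inner_comm (axis k), conj_trivial]
    ring

/-- For `j < k` the vector `frame φ j` is a combination of `axis j` and `tailPoint φ (j + 1)`, both
of which are orthogonal to `frame φ k`. -/
lemma orthonormal_frame (φ : E (d - 1)) : Orthonormal ℝ (frame φ) := by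
  have hlt : ∀ j k : Fin (d - 1), j < k → inner ℝ (frame φ j) (frame φ k) = 0 := by
    intro j k hjk
    conv_lhs => rw [frame]
    rw [inner_add_left, inner_smul_left, inner_smul_left,
      inner_axis_frame φ hjk, inner_tailPoint_frame φ k (by have : j.val < k.val := hjk; omega)]
    simp
  rw [orthonormal_iff_ite]
  intro j k
  rcases lt_trichotomy j k with h | h | h
  · rw [if_neg h.ne, hlt j k h]
  · subst h
    have h1 := inner_axis_tailPoint φ j (Nat.lt_succ_self _)
    rw [if_pos rfl, frame]
    simp only [inner_add_left, inner_add_right, inner_smul_left, inner_smul_right, h1,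
      inner_axis_self, inner_tailPoint_self, real_inner_comm (axis j), conj_trivial]
    have := Real.cos_sq_add_sin_sq (φ j)
    linear_combination this
  · rw [if_neg h.ne', real_inner_comm, hlt k j h]

lemma inner_sphPoint_frame (φ : E (d - 1)) (k : Fin (d - 1)) :
    inner ℝ (sphPoint φ) (frame φ k) = 0 := by
  rw [sphPoint_eq_tailPoint]
  exact inner_tailPoint_frame φ k (Nat.zero_le _)

/-- The derivative of the spherical coordinates. -/
def frameDeriv (φ : E (d - 1)) (k : ℕ) : E (d - 1) →L[ℝ] E d :=
  ∑ j : Fin (d - 1), sinProd φ k j •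
    (EuclideanSpace.proj j : E (d - 1) →L[ℝ] ℝ).smulRight (frame φ j)

lemma frameDeriv_apply (φ : E (d - 1)) (k : ℕ) (h : E (d - 1)) :
    frameDeriv φ k h = ∑ j : Fin (d - 1), (sinProd φ k j * h j) • frame φ j := by
  simp [frameDeriv, sum_apply, smul_smul]

/-- Differentiating the recursion, the change of `φ k` itself contributes `frame φ k`, and the later
angles contribute the derivative at level `k + 1` times `sin (φ k)`. Thus each coordinate velocity
is a product of sines times a unit vector of the frame. -/
lemma hasFDerivAt_tailPoint (φ : E (d - 1)) (hd : 1 ≤ d) {k : ℕ} (hk : k ≤ d - 1) :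
    HasFDerivAt (fun φ => tailPoint φ k) (frameDeriv φ k) φ := by
  refine decreasing_angle_induction
    (P := fun k => HasFDerivAt (fun φ => tailPoint φ k) (frameDeriv φ k) φ) ?_ (fun k ih => ?_) hk
  · have : (fun φ : E (d - 1) => tailPoint φ (d - 1)) =
        fun _ => EuclideanSpace.single (⟨d - 1, by omega⟩ : Fin d) 1 := by
      funext φ; exact tailPoint_last φ hd
    rw [this]
    refine (hasFDerivAt_const _ _).congr_fderiv ?_
    ext1 h
    rw [frameDeriv_apply, zero_apply]
    refine (Finset.sum_eq_zero fun j _ => ?_).symm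
    rw [sinProd_of_lt φ j.2, zero_mul, zero_smul]
  · have hp : HasFDerivAt (fun φ : E (d - 1) => φ k)
        (EuclideanSpace.proj k : E (d - 1) →L[ℝ] ℝ) φ :=
      (EuclideanSpace.proj k : E (d - 1) →L[ℝ] ℝ).hasFDerivAt
    have h1 := (hp.cos.smul_const (axis (d := d) k)).add (hp.sin.smul ih)
    have : (fun φ : E (d - 1) => tailPoint φ k) = fun φ =>
        Real.cos (φ k) • axis k + Real.sin (φ k) • tailPoint φ (k + 1) := by
      funext φ; exact tailPoint_succ φ k
    rw [this]
    refine h1.congr_fderiv ?_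
    ext1 h
    have e : ∀ j : Fin (d - 1), (sinProd φ k j * h j) • frame φ j =
        (Real.sin (φ k) * (sinProd φ (k + 1) j * h j)) • frame φ j +
          if j = k then h k • frame φ k else 0 := by
      intro j
      by_cases hj : j = k
      · subst hj
        rw [sinProd_self, sinProd_of_lt φ (Nat.lt_succ_self _), if_pos rfl]
        simp
      · rw [if_neg hj, add_zero, sinProd_succ φ k (fun hc => hj (Fin.ext hc)), mul_assoc]
    rw [frameDeriv_apply, Finset.sum_congr rfl fun j _ => e j, Finset.sum_add_distrib]
    simp only [Finset.sum_ite_eq', Finset.mem_univ, if_true, add_apply, smul_apply,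
      ContinuousLinearMap.smulRight_apply, frameDeriv_apply, Finset.smul_sum, smul_smul,
      PiLp.proj_apply, smul_eq_mul]
    rw [frame]
    module

lemma hasFDerivAt_sphPoint (φ : E (d - 1)) (hd : 1 ≤ d) :
    HasFDerivAt sphPoint (frameDeriv φ 0) φ := by
  have : (sphPoint : E (d - 1) → E d) = fun φ => tailPoint φ 0 := by
    funext φ; exact sphPoint_eq_tailPoint φ
  rw [this]
  exact hasFDerivAt_tailPoint φ hd (Nat.zero_le _)

lemma contDiff_sphPoint {r : WithTop ℕ∞} : ContDiff ℝ r (sphPoint : E (d - 1) → E d) := by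
  rw [contDiff_piLp]
  intro i
  simp only [sphPoint]
  refine ContDiff.mul (contDiff_prod fun j _ => ?_) ?_
  · split_ifs
    · exact Real.contDiff_sin.comp (EuclideanSpace.proj j : E (d - 1) →L[ℝ] ℝ).contDiff
    · exact contDiff_const
  · split_ifs with h
    · exact Real.contDiff_cos.comp 
        (EuclideanSpace.proj (⟨i, h⟩ : Fin (d - 1)) : E (d - 1) →L[ℝ] ℝ).contDiff
    · exact contDiff_const

lemma continuous_sphPoint : Continuous (sphPoint : E (d - 1) → E d) :=
  (contDiff_sphPoint (r := 0)).continuous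

/-- The sine of angle `l` occurs once for every `j > l`, that is `d - 2 - l` times. Hence the
Jacobian is the product of the lengths of the coordinate velocities. -/
lemma prod_sinProd (φ : E (d - 1)) : ∏ j : Fin (d - 1), sinProd φ 0 j = sphJac φ := by
  unfold sphJac
  simp only [sinProd, Nat.zero_le, if_true, true_and]
  rw [Finset.prod_comm]
  refine Finset.prod_congr rfl fun l _ => ?_
  rw [Finset.prod_ite, Finset.prod_const, Finset.prod_const_one, mul_one]
  congr 1
  have : (Finset.univ.filter fun j : Fin (d - 1) => l.val < j.val) = Finset.Ioi l := by
    ext j; simp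
  rw [this, Fin.card_Ioi]
  omega

end Frame

end PolarChaos
end

/-! ### Boxes of angles: injectivity, surjectivity and the degenerate locus. -/

noncomputable section

namespace PolarChaos

open scoped ENNReal NNReal

section Angles

variable {d : ℕ}

/-- Non-degenerate angles with the last angle in `[a, a + 2π)`. -/
def regBox (d : ℕ) (a : ℝ) : Set (E (d - 1)) :=
  {φ | ∀ j : Fin (d - 1), if j.val + 1 = d - 1 then a ≤ φ j ∧ φ j < a + 2 * Real.pi
    else 0 < φ j ∧ φ j < Real.pi}

/-- Non-degenerate angles with the last angle in `(a, a + 2π)`. -/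
def openBox (d : ℕ) (a : ℝ) : Set (E (d - 1)) :=
  {φ | ∀ j : Fin (d - 1), if j.val + 1 = d - 1 then a < φ j ∧ φ j < a + 2 * Real.pi
    else 0 < φ j ∧ φ j < Real.pi}

/-- Angles with the last one in `[a, a + 2π]` and the other ones in `[0, π]`. -/
def closedBox (d : ℕ) (a : ℝ) : Set (E (d - 1)) :=
  {φ | ∀ j : Fin (d - 1), if j.val + 1 = d - 1 then a ≤ φ j ∧ φ j ≤ a + 2 * Real.pi
    else 0 ≤ φ j ∧ φ j ≤ Real.pi}

lemma regBox_subset_closedBox (a : ℝ) : regBox d a ⊆ closedBox d a := by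
  intro φ h j
  have := h j
  split_ifs at this ⊢
  · exact ⟨this.1, this.2.le⟩
  · exact ⟨this.1.le, this.2.le⟩

lemma openBox_subset_regBox (a : ℝ) : openBox d a ⊆ regBox d a := by
  intro φ h j
  have := h j
  split_ifs at this ⊢
  · exact ⟨this.1.le, this.2⟩
  · exact this

/-- The exponent of the sine in the Jacobian is positive exactly for the angles other than the last.
On `[0, π)` the non-vanishing of that sine only excludes 0. -/
lemma regAngles_eq_regBox : regAngles d = regBox d 0 := by
  ext φ
  constructor
  · rintro ⟨h1, h2⟩ j
    have h3 := h1 j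
    split_ifs at h3 ⊢ with hj
    · simpa using h3
    · refine ⟨lt_of_le_of_ne h3.1 fun hc => h2 ?_, h3.2⟩
      refine Finset.prod_eq_zero (Finset.mem_univ j) ?_
      rw [← hc, Real.sin_zero, zero_pow]
      have := j.2
      omega
  · intro h
    refine ⟨fun j => ?_, Finset.prod_ne_zero_iff.2 fun j _ => ?_⟩
    · have h3 := h j
      split_ifs at h3 ⊢ with hj
      · simpa using h3
      · exact ⟨h3.1.le, h3.2⟩
    · have h3 := h j
      split_ifs at h3 with hj
      · rw [show d - 2 - j.val = 0 by omega, pow_zero]; exact one_ne_zero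
      · exact pow_ne_zero _ (Real.sin_pos_of_pos_of_lt_pi h3.1 h3.2).ne'

lemma isOpen_openBox (a : ℝ) : IsOpen (openBox d a) := by
  have : openBox d a = ⋂ j : Fin (d - 1), {φ : E (d - 1) | if j.val + 1 = d - 1 then
      a < φ j ∧ φ j < a + 2 * Real.pi else 0 < φ j ∧ φ j < Real.pi} := by
    ext φ; simp [openBox]
  rw [this]
  refine isOpen_iInter_of_finite fun j => ?_
  have hc : Continuous fun φ : E (d - 1) => φ j := by fun_prop
  split_ifs
  · exact (isOpen_lt continuous_const hc).inter (isOpen_lt hc continuous_const)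
  · exact (isOpen_lt continuous_const hc).inter (isOpen_lt hc continuous_const)

lemma measurableSet_regBox (a : ℝ) : MeasurableSet (regBox d a) := by
  have : regBox d a = ⋂ j : Fin (d - 1), {φ : E (d - 1) | if j.val + 1 = d - 1 then
      a ≤ φ j ∧ φ j < a + 2 * Real.pi else 0 < φ j ∧ φ j < Real.pi} := by
    ext φ; simp [regBox]
  rw [this]
  refine MeasurableSet.iInter fun j => ?_
  have hc : Measurable fun φ : E (d - 1) => φ j := by fun_prop
  split_ifs
  · exact (measurableSet_le measurable_const hc).inter (measurableSet_lt hc measurable_const)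
  · exact (measurableSet_lt measurable_const hc).inter (measurableSet_lt hc measurable_const)

lemma isCompact_closedBox (a : ℝ) : IsCompact (closedBox d a) := by
  refine Metric.isCompact_of_isClosed_isBounded ?_ ?_
  · have : closedBox d a = ⋂ j : Fin (d - 1), {φ : E (d - 1) | if j.val + 1 = d - 1 then
        a ≤ φ j ∧ φ j ≤ a + 2 * Real.pi else 0 ≤ φ j ∧ φ j ≤ Real.pi} := by
      ext φ; simp [closedBox]
    rw [this]
    refine isClosed_iInter fun j => ?_
    have hc : Continuous fun φ : E (d - 1) => φ j := by fun_prop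
    split_ifs
    · exact (isClosed_le continuous_const hc).inter (isClosed_le hc continuous_const)
    · exact (isClosed_le continuous_const hc).inter (isClosed_le hc continuous_const)
  · rw [isBounded_iff_forall_norm_le]
    refine ⟨√(∑ _j : Fin (d - 1), (|a| + 2 * Real.pi) ^ 2), fun φ h => ?_⟩
    rw [EuclideanSpace.norm_eq]
    refine Real.sqrt_le_sqrt (Finset.sum_le_sum fun j _ => ?_)
    have hj := h j
    have hpi := Real.pi_pos
    refine pow_le_pow_left₀ (norm_nonneg _) ?_ 2
    rw [Real.norm_eq_abs, abs_le]
    split_ifs at hj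
    · constructor <;> linarith [neg_abs_le a, le_abs_self a]
    · constructor <;> linarith [abs_nonneg a]

/-- Angles giving the same point of the sphere. -/
lemma angles_of_sphPoint_eq {φ ψ : E (d - 1)}
    (hφ : ∀ j : Fin (d - 1), j.val + 1 ≠ d - 1 → 0 ≤ φ j ∧ φ j ≤ Real.pi)
    (hψ : ∀ j : Fin (d - 1), j.val + 1 ≠ d - 1 → 0 < ψ j ∧ ψ j < Real.pi)
    (h : sphPoint φ = sphPoint ψ) (j : Fin (d - 1)) :
    (j.val + 1 ≠ d - 1 → φ j = ψ j) ∧ Real.cos (φ j - ψ j) = 1 := by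
  have hd : 1 ≤ d := by have := j.2; omega
  have hcos : ∀ (χ : E (d - 1)) (k : Fin (d - 1)),
      tailPoint χ k (k.castLE (Nat.sub_le d 1)) = Real.cos (χ k) := by
    intro χ k
    rw [tailPoint_apply]
    simp [sinProd_self, cosFactor]
  -- Coordinates are peeled off one at a time: the cosine determines an angle of `[0, π]`, and its
  -- sine, nonzero by the condition on `ψ`, can be divided out.
  have htail : ∀ k : ℕ, k + 1 ≤ d - 1 → tailPoint φ k = tailPoint ψ k := by
    intro k
    induction k with
    | zero => intro _; rw [← sphPoint_eq_tailPoint, ← sphPoint_eq_tailPoint, h]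
    | succ k ih =>
      intro hk
      have h1 := ih (by omega)
      let k' : Fin (d - 1) := ⟨k, by omega⟩
      have h2 : φ k' = ψ k' := by
        have := congrArg (fun x : E d => x (k'.castLE (Nat.sub_le d 1))) h1
        simp only at this
        rw [show k = k'.val from rfl, hcos, hcos] at this
        have h4 := hψ k' (by simp only [k']; omega)
        exact Real.injOn_cos (hφ k' (by simp only [k']; omega)) ⟨h4.1.le, h4.2.le⟩ this
      rw [show k = k'.val from rfl, tailPoint_succ, tailPoint_succ, h2] at h1
      have h3 := add_left_cancel h1
      have h4 := hψ k' (by simp only [k']; omega)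
      exact smul_right_injective _ (Real.sin_pos_of_pos_of_lt_pi h4.1 h4.2).ne' h3
  have h1 := htail j (by have := j.2; omega)
  have hc : Real.cos (φ j) = Real.cos (ψ j) := by
    have := congrArg (fun x : E d => x (j.castLE (Nat.sub_le d 1))) h1
    simp only at this
    rwa [hcos, hcos] at this
  by_cases hj : j.val + 1 = d - 1
  · refine ⟨fun hn => absurd hj hn, ?_⟩
    rw [tailPoint_succ, tailPoint_succ, hj, tailPoint_last φ hd, tailPoint_last ψ hd, hc] at h1
    have h2 := congrArg (fun x : E d => x ⟨d - 1, by omega⟩) (add_left_cancel h1)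
    have hs : Real.sin (φ j) = Real.sin (ψ j) := by simpa using h2
    rw [Real.cos_sub, hc, hs]
    have := Real.cos_sq_add_sin_sq (ψ j)
    linarith [this, sq (Real.cos (ψ j)), sq (Real.sin (ψ j))]
  · have : φ j = ψ j := by
      have h4 := hψ j hj
      exact Real.injOn_cos (hφ j hj) ⟨h4.1.le, h4.2.le⟩ hc
    exact ⟨fun _ => this, by rw [this, sub_self, Real.cos_zero]⟩

/-- The last angles differ by strictly less than `2π`, so a difference with cosine 1 is 0. The
asymmetric form is what compactness arguments need: an interior point of the box has no second
preimage even on the boundary. -/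
lemma eq_of_sphPoint_eq {a : ℝ} {φ ψ : E (d - 1)} (hφ : φ ∈ closedBox d a) (hψ : ψ ∈ openBox d a)
    (h : sphPoint φ = sphPoint ψ) : φ = ψ := by
  ext j
  have h1 := angles_of_sphPoint_eq (fun j hj => by simpa [hj] using hφ j)
    (fun j hj => by simpa [hj] using hψ j) h j
  by_cases hj : j.val + 1 = d - 1
  · have h2 := hφ j
    have h3 := hψ j
    rw [if_pos hj] at h2 h3
    have := (Real.cos_eq_one_iff_of_lt_of_lt (by linarith) (by linarith)).1 h1.2
    linarith
  · exact h1.1 hj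

lemma injOn_sphPoint_regBox (a : ℝ) : Set.InjOn sphPoint (regBox d a) := by
  intro φ hφ ψ hψ h
  ext j
  have h1 := angles_of_sphPoint_eq
    (fun j hj => by have := hφ j; rw [if_neg hj] at this; exact ⟨this.1.le, this.2.le⟩)
    (fun j hj => by simpa [hj] using hψ j) h j
  by_cases hj : j.val + 1 = d - 1
  · have h2 := hφ j
    have h3 := hψ j
    rw [if_pos hj] at h2 h3
    have := (Real.cos_eq_one_iff_of_lt_of_lt (by linarith) (by linarith)).1 h1.2
    linarith
  · exact h1.1 hj

lemma sinProd_ne_zero {φ : E (d - 1)}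
    (hφ : ∀ j : Fin (d - 1), j.val + 1 ≠ d - 1 → Real.sin (φ j) ≠ 0) {i : ℕ} (hi : i + 1 ≤ d - 1) :
    sinProd φ 0 i ≠ 0 := by
  rw [sinProd, if_pos (Nat.zero_le _), Finset.prod_ne_zero_iff]
  intro l _
  split_ifs with h
  · exact hφ l (by omega)
  · exact one_ne_zero

/-- The last two Cartesian coordinates are a nonzero product of sines times the cosine and sine of
the last angle, which do not vanish together. -/
lemma sphPoint_notMem_sphSing (hd : 2 ≤ d) {φ : E (d - 1)}
    (hφ : ∀ j : Fin (d - 1), j.val + 1 ≠ d - 1 → Real.sin (φ j) ≠ 0) :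
    sphPoint φ ∉ sphSing d := by
  intro h
  have hs := sinProd_ne_zero hφ (i := d - 2) (by omega)
  let k : Fin (d - 1) := ⟨d - 2, by omega⟩
  have h1 : sphPoint φ ⟨d - 2, by omega⟩ = 0 := h.2 _ (by simp; omega)
  have h2 : sphPoint φ ⟨d - 1, by omega⟩ = 0 := h.2 _ (by simp; omega)
  rw [sphPoint_eq_tailPoint, tailPoint_apply] at h1 h2
  have e1 : cosFactor φ (d - 2) = Real.cos (φ k) := by
    rw [cosFactor, dif_pos (show d - 2 < d - 1 by omega)]
  have e2 : cosFactor φ (d - 1) = 1 := by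
    rw [cosFactor, dif_neg (lt_irrefl _)]
  have e3 : sinProd φ 0 (d - 1) = Real.sin (φ k) * sinProd φ 0 (d - 2) := by
    rw [sinProd, if_pos (Nat.zero_le _), sinProd, if_pos (Nat.zero_le _),
      ← Finset.mul_prod_erase Finset.univ _ (Finset.mem_univ k),
      ← Finset.mul_prod_erase Finset.univ (fun l : Fin (d - 1) =>
        if 0 ≤ l.val ∧ l.val < d - 2 then Real.sin (φ l) else 1) (Finset.mem_univ k)]
    rw [if_pos ⟨Nat.zero_le _, k.2⟩, if_neg (by simp [k]), one_mul]
    congr 1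
    refine Finset.prod_congr rfl fun l hl => ?_
    have hlk : l.val ≠ k.val := fun hc => (Finset.mem_erase.1 hl).1 (Fin.ext hc)
    have hk : k.val = d - 2 := rfl
    have := l.2
    congr 1
    exact propext ⟨fun hx => ⟨by omega, by omega⟩, fun hx => ⟨by omega, by omega⟩⟩
  simp only [e1, e2, e3] at h1 h2
  have h3 : Real.cos (φ k) = 0 := by
    rcases mul_eq_zero.1 h1 with h | h
    · exact absurd h hs
    · exact h
  have h4 : Real.sin (φ k) = 0 := by simpa [hs] using h2
  have := Real.cos_sq_add_sin_sq (φ k)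
  rw [h3, h4] at this
  norm_num at this

lemma sphPoint_notMem_sphSing_of_regBox (hd : 2 ≤ d) {a : ℝ} {φ : E (d - 1)}
    (hφ : φ ∈ regBox d a) : sphPoint φ ∉ sphSing d :=
  sphPoint_notMem_sphSing hd fun j hj => by
    have := hφ j
    rw [if_neg hj] at this
    exact (Real.sin_pos_of_pos_of_lt_pi this.1 this.2).ne'

lemma tailPoint_congr {φ ψ : E (d - 1)} {k : ℕ} (h : ∀ j : Fin (d - 1), k ≤ j.val → φ j = ψ j) :
    tailPoint φ k = tailPoint ψ k := by
  ext i
  rw [tailPoint_apply, tailPoint_apply]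
  by_cases hi : k ≤ i.val
  · congr 1
    · rw [sinProd, if_pos hi, sinProd, if_pos hi]
      refine Finset.prod_congr rfl fun l _ => ?_
      split_ifs with hl
      · rw [h l hl.1]
      · rfl
    · unfold cosFactor
      split_ifs with hl
      · rw [h ⟨i, hl⟩ hi]
      · rfl
  · rw [sinProd_of_lt φ (by omega), sinProd_of_lt ψ (by omega), zero_mul, zero_mul]

/-- Descending induction: the angle `k` is the arccosine of coordinate `k`, its sine is the norm of
the remaining vector, and the later angles parametrize the normalized remainder. -/
lemma exists_tailPoint_eq (hd : 2 ≤ d) {k : ℕ} (hk : k ≤ d - 2) : ∀ x : E d, ‖x‖ = 1 →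
    (∀ i : Fin d, i.val < k → x i = 0) → ∃ φ ∈ closedBox d 0, tailPoint φ k = x := by
  have hpi := Real.pi_pos
  induction hk using Nat.decreasingInduction with
  | of_succ k hk ih =>
    intro x hx hx0
    let k' : Fin (d - 1) := ⟨k, by omega⟩
    set c := x (k'.castLE (Nat.sub_le d 1)) with hc
    set y := x - c • axis k' with hy
    have hinner : inner ℝ (axis k') y = 0 := by
      rw [hy, inner_sub_right, inner_smul_right, inner_axis_self, inner_axis, ← hc]; ring
    have hsum : x = c • axis k' + y := by rw [hy]; abel
    have hny : c ^ 2 + ‖y‖ ^ 2 = 1 := by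
      have h1 : ‖x‖ ^ 2 = 1 := by rw [hx]; norm_num
      rw [hsum, norm_add_sq_real, inner_smul_left, hinner, norm_smul, norm_axis] at h1
      simpa using h1
    have hc1 : -1 ≤ c := by nlinarith [sq_nonneg ‖y‖]
    have hc2 : c ≤ 1 := by nlinarith [sq_nonneg ‖y‖]
    have hsin : Real.sin (Real.arccos c) = ‖y‖ := by
      rw [Real.sin_arccos, show 1 - c ^ 2 = ‖y‖ ^ 2 by linarith, Real.sqrt_sq (norm_nonneg _)]
    have hcos : Real.cos (Real.arccos c) = c := Real.cos_arccos hc1 hc2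
    -- If the remainder vanishes its direction is undefined, but it is multiplied by 0 and any later
    -- angles will do; they are set to 0.
    have key : ∃ φ ∈ closedBox d 0, ‖y‖ • tailPoint φ (k + 1) = y := by
      by_cases hy0 : y = 0
      · refine ⟨0, fun j => ?_, by simp [hy0]⟩
        split_ifs <;> simp <;> positivity
      · have hyn : ‖y‖ ≠ 0 := norm_ne_zero_iff.2 hy0
        obtain ⟨φ, hφ, hφ2⟩ := ih (‖y‖⁻¹ • y) (by
          rw [norm_smul, norm_inv, norm_norm, inv_mul_cancel₀ hyn]) (by
          intro i hi
          rw [PiLp.smul_apply, hy, PiLp.sub_apply, PiLp.smul_apply]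
          rcases lt_or_eq_of_le (Nat.lt_succ_iff.1 hi) with h | h
          · rw [hx0 i h, axis, PiLp.single_apply, if_neg]
            · simp
            · intro hcc
              have : i.val = k := congrArg (fun i : Fin d => i.val) hcc
              omega
          · have : i = k'.castLE (Nat.sub_le d 1) := Fin.ext h
            rw [this, ← hc, axis, PiLp.single_apply, if_pos rfl]
            simp)
        exact ⟨φ, hφ, by rw [hφ2, smul_smul, mul_inv_cancel₀ hyn, one_smul]⟩
    obtain ⟨φ, hφ, hφy⟩ := key
    let ψ : E (d - 1) := WithLp.toLp 2 (Function.update φ k' (Real.arccos c))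
    have hψk : ψ k' = Real.arccos c := by simp [ψ]
    have hψ : ∀ j, j ≠ k' → ψ j = φ j := fun j hj => by simp [ψ, Function.update_of_ne hj]
    refine ⟨ψ, fun j => ?_, ?_⟩
    · by_cases hj : j = k'
      · subst hj
        rw [if_neg (by simp only [k']; omega), hψk]
        exact ⟨Real.arccos_nonneg c, Real.arccos_le_pi c⟩
      · rw [hψ j hj]; exact hφ j
    · have h2 : tailPoint ψ (k + 1) = tailPoint φ (k + 1) :=
        tailPoint_congr fun j hj => hψ j fun hcc => by
          have : j.val = k := congrArg Fin.val hcc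
          omega
      rw [show k = k'.val from rfl, tailPoint_succ, hψk, hcos, hsin,
        show k'.val + 1 = k + 1 from rfl, h2, hφy, ← hsum]
  | self =>
    intro x hx hx0
    let k' : Fin (d - 1) := ⟨d - 2, by omega⟩
    let l' : Fin d := ⟨d - 1, by omega⟩
    set a := x (k'.castLE (Nat.sub_le d 1)) with ha
    set b := x l' with hb
    have hxe : x = a • axis k' + b • EuclideanSpace.single l' 1 := by
      ext i
      rw [PiLp.add_apply, PiLp.smul_apply, PiLp.smul_apply, axis, PiLp.single_apply,
        PiLp.single_apply]
      rcases lt_trichotomy i.val (d - 2) with h | h | h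
      · rw [hx0 i h, if_neg, if_neg]
        · simp
        · intro hc; rw [hc] at h; simp only [l'] at h; omega
        · intro hc; rw [hc] at h; simp [k'] at h
      · have : i = k'.castLE (Nat.sub_le d 1) := Fin.ext h
        rw [this, if_pos rfl, if_neg, ← ha]
        · simp
        · intro hc
          have : d - 2 = d - 1 := congrArg (fun i : Fin d => i.val) hc
          omega
      · have : i = l' := Fin.ext (by simp only [l']; omega)
        rw [this, if_pos rfl, if_neg, ← hb]
        · simp
        · intro hc
          have : d - 1 = d - 2 := congrArg (fun i : Fin d => i.val) hc
          omega
    have hab : a ^ 2 + b ^ 2 = 1 := by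
      have h1 : ‖x‖ ^ 2 = 1 := by rw [hx]; norm_num
      rw [hxe, norm_add_sq_real, inner_smul_left, inner_smul_right, inner_axis, PiLp.single_apply,
        if_neg, norm_smul, norm_smul, norm_axis] at h1
      · simpa using h1
      · intro hc
        have : d - 2 = d - 1 := congrArg (fun i : Fin d => i.val) hc
        omega
    have ha1 : -1 ≤ a := by nlinarith [sq_nonneg b]
    have ha2 : a ≤ 1 := by nlinarith [sq_nonneg b]
    have hsin : Real.sin (Real.arccos a) = |b| := by
      rw [Real.sin_arccos, show 1 - a ^ 2 = b ^ 2 by linarith, Real.sqrt_sq_eq_abs]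
    -- The last angle runs over a full circle, so the sign of `b` decides between `arccos a` and `2π
    -- - arccos a`.
    obtain ⟨t, ht0, ht1, htc, hts⟩ : ∃ t : ℝ, 0 ≤ t ∧ t ≤ 2 * Real.pi ∧ Real.cos t = a ∧
        Real.sin t = b := by
      rcases le_total 0 b with h | h
      · refine ⟨Real.arccos a, Real.arccos_nonneg a, ?_, Real.cos_arccos ha1 ha2, ?_⟩
        · linarith [Real.arccos_le_pi a]
        · rw [hsin, abs_of_nonneg h]
      · refine ⟨2 * Real.pi - Real.arccos a, ?_, ?_, ?_, ?_⟩
        · linarith [Real.arccos_le_pi a]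
        · linarith [Real.arccos_nonneg a]
        · rw [Real.cos_two_pi_sub, Real.cos_arccos ha1 ha2]
        · rw [Real.sin_two_pi_sub, hsin, abs_of_nonpos h, neg_neg]
    let ψ : E (d - 1) := WithLp.toLp 2 (Function.update 0 k' t)
    have hψk : ψ k' = t := by simp [ψ]
    have hψ : ∀ j, j ≠ k' → ψ j = 0 := fun j hj => by simp [ψ, Function.update_of_ne hj]
    refine ⟨ψ, fun j => ?_, ?_⟩
    · by_cases hj : j = k'
      · subst hj
        rw [if_pos (by simp only [k']; omega), hψk]
        exact ⟨ht0, by linarith⟩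
      · rw [if_neg, hψ j hj]
        · exact ⟨le_rfl, hpi.le⟩
        · intro hc
          exact hj (Fin.ext (by simp only [k']; omega))
    · rw [show d - 2 = k'.val from rfl, tailPoint_succ, hψk, htc, hts,
        show k'.val + 1 = d - 1 by simp only [k']; omega, tailPoint_last _ (by omega)]
      exact hxe.symm

/-- Spherical coordinates cover the sphere. -/
lemma exists_sphPoint_eq (hd : 2 ≤ d) {x : E d} (hx : ‖x‖ = 1) :
    ∃ φ ∈ closedBox d 0, sphPoint φ = x := by
  obtain ⟨φ, hφ, h⟩ := exists_tailPoint_eq hd (Nat.zero_le _) x hx (by simp)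
  exact ⟨φ, hφ, by rw [sphPoint_eq_tailPoint, h]⟩

end Angles

end PolarChaos
end

/-! ### Orthonormal frames of tangent hyperplanes. -/

noncomputable section

namespace PolarChaos

section TangentFrame

variable {d n : ℕ}

/-- The linear map with values `u i` at the standard basis. -/
def frameMap (u : Fin n → E d) : E n →L[ℝ] E d :=
  ∑ i, (EuclideanSpace.proj i : E n →L[ℝ] ℝ).smulRight (u i)

/-- The inner products with the vectors `u i`. -/
def frameProj (u : Fin n → E d) : E d →L[ℝ] E n :=
  ((EuclideanSpace.equiv (Fin n) ℝ).symm : (Fin n → ℝ) →L[ℝ] E n) ∘L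
    ContinuousLinearMap.pi fun i => innerSL ℝ (u i)

lemma frameMap_apply (u : Fin n → E d) (t : E n) : frameMap u t = ∑ i, t i • u i := by
  simp [frameMap, sum_apply]

lemma frameProj_apply (u : Fin n → E d) (x : E d) (i : Fin n) :
    frameProj u x i = inner ℝ (u i) x := by
  simp [frameProj]

lemma frameProj_frameMap {u : Fin n → E d} (hu : Orthonormal ℝ u) (t : E n) :
    frameProj u (frameMap u t) = t := by
  ext i
  rw [frameProj_apply, frameMap_apply, inner_sum]
  simp [inner_smul_right, orthonormal_iff_ite.1 hu]

/-- An orthonormal basis of the orthogonal complement of a unit vector. -/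
structure IsTangentFrame (v : E d) (u : Fin (d - 1) → E d) : Prop where
  norm_eq : ‖v‖ = 1
  orthonormal : Orthonormal ℝ u
  inner_eq : ∀ i, inner ℝ (u i) v = 0

lemma dim_pos_of_norm {v : E d} (hv : ‖v‖ = 1) : 1 ≤ d := by
  rcases Nat.eq_zero_or_pos d with h | h
  · subst h
    rw [Subsingleton.elim v 0, norm_zero] at hv
    norm_num at hv
  · exact h

lemma exists_isTangentFrame {v : E d} (hv : ‖v‖ = 1) : ∃ u, IsTangentFrame v u := by
  have hd := dim_pos_of_norm hv
  have : Fact (Module.finrank ℝ (E d) = (d - 1) + 1) := ⟨by simp; omega⟩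
  have hv0 : v ≠ 0 := by rintro rfl; simp at hv
  let b := OrthonormalBasis.fromOrthogonalSpanSingleton (𝕜 := ℝ) (d - 1) hv0
  refine ⟨fun i => b i, hv, ?_, fun i => ?_⟩
  · exact b.orthonormal.comp_linearIsometry (Submodule.subtypeₗᵢ _)
  · have := (b i).2
    rw [Submodule.mem_orthogonal_singleton_iff_inner_left] at this
    exact this

lemma isTangentFrame_frame (hd : 1 ≤ d) (φ : E (d - 1)) :
    IsTangentFrame (sphPoint φ) (frame φ) :=
  ⟨norm_sphPoint φ hd, orthonormal_frame φ, fun i => by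
    rw [real_inner_comm]; exact inner_sphPoint_frame φ i⟩

namespace IsTangentFrame

variable {v : E d} {u : Fin (d - 1) → E d} (h : IsTangentFrame v u)
include h

/-- The orthonormal basis formed by `v` and the frame. -/
lemma orthonormal_option : Orthonormal ℝ (fun o : Option (Fin (d - 1)) => o.elim v u) := by
  rw [orthonormal_iff_ite]
  have h1 := orthonormal_iff_ite.1 h.orthonormal
  rintro (_ | i) (_ | j)
  · simp [h.norm_eq]
  · simpa [real_inner_comm] using h.inner_eq j
  · simp [h.inner_eq]
  · simp [h1]

lemma eq_add (x : E d) : x = inner ℝ v x • v + frameMap u (frameProj u x) := by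
  have hd := dim_pos_of_norm h.norm_eq
  have hcard : Fintype.card (Option (Fin (d - 1))) = Module.finrank ℝ (E d) := by
    simp; omega
  let b := (basisOfOrthonormalOfCardEqFinrank h.orthonormal_option hcard).toOrthonormalBasis
    (by simpa using h.orthonormal_option)
  have hb : ∀ o, b o = o.elim v u := fun o => by simp [b]
  have := b.sum_repr' x
  rw [Fintype.sum_option] at this
  simp only [hb, Option.elim] at this
  rw [frameMap_apply]
  simp only [frameProj_apply]
  exact this.symm

lemma inner_frameMap (t : E (d - 1)) : inner ℝ v (frameMap u t) = 0 := by
  rw [frameMap_apply, inner_sum]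
  refine Finset.sum_eq_zero fun i _ => ?_
  rw [inner_smul_right, real_inner_comm, h.inner_eq, mul_zero]

lemma norm_frameMap (t : E (d - 1)) : ‖frameMap u t‖ = ‖t‖ := by
  have : ‖frameMap u t‖ ^ 2 = ‖t‖ ^ 2 := by
    have e : ∀ i, inner ℝ (u i) (frameMap u t) = t i := fun i => by
      rw [← frameProj_apply, frameProj_frameMap h.orthonormal]
    rw [← real_inner_self_eq_norm_sq]
    nth_rewrite 1 [frameMap_apply]
    rw [sum_inner, EuclideanSpace.norm_sq_eq]
    refine Finset.sum_congr rfl fun i _ => ?_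
    rw [inner_smul_left, e]
    simp [sq]
  exact (sq_eq_sq₀ (norm_nonneg _) (norm_nonneg _)).1 this

lemma norm_sq (x : E d) : ‖x‖ ^ 2 = (inner ℝ v x) ^ 2 + ‖frameProj u x‖ ^ 2 := by
  conv_lhs => rw [h.eq_add x, norm_add_sq_real, inner_smul_left, h.inner_frameMap, norm_smul,
    h.norm_eq, h.norm_frameMap]
  simp

lemma norm_frameProj_le (x : E d) : ‖frameProj u x‖ ≤ ‖x‖ := by
  have := h.norm_sq x
  refine (sq_le_sq₀ (norm_nonneg _) (norm_nonneg _)).1 ?_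
  nlinarith [sq_nonneg (inner ℝ v x)]

lemma lipschitz_frameProj : LipschitzWith 1 (frameProj u) := by
  refine LipschitzWith.of_dist_le_mul fun x y => ?_
  rw [dist_eq_norm, dist_eq_norm, ← map_sub, NNReal.coe_one, one_mul]
  exact h.norm_frameProj_le _

lemma frameProj_self : frameProj u v = 0 := by
  ext i; rw [frameProj_apply, h.inner_eq]; rfl

/-- On the open hemisphere around `v`, the norm condition recovers the component along `v` from the
tangential one. -/
lemma eq_of_frameProj_eq {x y : E d} (hx : ‖x‖ = 1) (hy : ‖y‖ = 1) (hx0 : 0 < inner ℝ v x)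
    (hy0 : 0 < inner ℝ v y) (hxy : frameProj u x = frameProj u y) : x = y := by
  have h1 := h.norm_sq x
  have h2 := h.norm_sq y
  rw [hx] at h1
  rw [hy, ← hxy] at h2
  have : inner ℝ v x = inner ℝ v y :=
    (sq_eq_sq₀ hx0.le hy0.le).1 (by linarith)
  rw [h.eq_add x, h.eq_add y, this, hxy]

lemma eq_frameMap_of_inner_eq_zero {x : E d} (hx : inner ℝ v x = 0) :
    x = frameMap u (frameProj u x) := by
  conv_lhs => rw [h.eq_add x, hx, zero_smul, zero_add]

end IsTangentFrame

end TangentFrame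

end PolarChaos
end

/-! ### The defect of homogeneity and its Hessian in a tangent hyperplane. -/

noncomputable section

namespace PolarChaos

section Hessian

variable {d n : ℕ}

/-- Congruent Hessians have the same rank. -/
lemma rank_hessian_comp {F : E n → ℝ} {G : E n → ℝ} {x₀ y₀ : E n} (hF : ContDiffAt ℝ 2 F x₀)
    (hG : ContDiffAt ℝ 2 G y₀) {B : E n →L[ℝ] E n} (hB : Function.Injective B)
    (h : ∀ a b, fderiv ℝ (fderiv ℝ F) x₀ a b = fderiv ℝ (fderiv ℝ G) y₀ (B a) (B b)) :
    (hessian F x₀).rank = (hessian G y₀).rank := by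
  set P : Matrix (Fin n) (Fin n) ℝ := Matrix.of fun i j => B (EuclideanSpace.single j 1) i with hP
  have hPB : ∀ x : E n, Matrix.toEuclideanLin P x = B x := by
    intro x
    have e : x = ∑ i, x i • EuclideanSpace.single i (1 : ℝ) := by
      ext j
      simp [WithLp.ofLp_sum, Finset.sum_apply, Pi.single_apply]
    conv_rhs => rw [e, map_sum]
    ext i
    simp [Matrix.toEuclideanLin, Matrix.mulVec, dotProduct, hP, mul_comm]
  have hunit : IsUnit P.det := by
    rw [← Matrix.isUnit_iff_isUnit_det, ← Matrix.mulVec_injective_iff_isUnit]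
    intro x y hxy
    have h1 : Matrix.toEuclideanLin P (WithLp.toLp 2 x) = Matrix.toEuclideanLin P (WithLp.toLp 2 y) := by
      simp only [Matrix.toLpLin_toLp]
      simpa using hxy
    rw [hPB, hPB] at h1
    exact (WithLp.toLp_injective 2) (hB h1)
  have key : hessian F x₀ = P.transpose * hessian G y₀ * P := by
    ext i j
    rw [hessian_apply hF, h, snd_fderiv_eq_inner hG]
    simp only [PiLp.inner_apply, Matrix.toEuclideanLin, Matrix.toLpLin_apply, Matrix.mulVec,
      dotProduct, RCLike.inner_apply, conj_trivial, Finset.sum_mul,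
      Matrix.mul_apply, Matrix.transpose_apply, hP, Matrix.of_apply]
    rw [Finset.sum_comm]
    refine Finset.sum_congr rfl fun i _ => Finset.sum_congr rfl fun j _ => ?_
    ring
  rw [key, Matrix.rank_mul_eq_left_of_isUnit_det _ _ hunit,
    Matrix.rank_mul_eq_right_of_isUnit_det _ _ (by rwa [Matrix.det_transpose])]

/-- Chain rule for second derivatives at a critical point. -/
lemma snd_fderiv_comp {F : E d → ℝ} {Ψ : E n → E d} {x₀ : E n} (hF : ContDiffAt ℝ 2 F (Ψ x₀))
    (hΨ : ContDiffAt ℝ 2 Ψ x₀) (hcrit : fderiv ℝ F (Ψ x₀) = 0) (a b : E n) :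
    fderiv ℝ (fderiv ℝ (fun x => F (Ψ x))) x₀ a b =
      fderiv ℝ (fderiv ℝ F) (Ψ x₀) (fderiv ℝ Ψ x₀ a) (fderiv ℝ Ψ x₀ b) := by
  have hd : fderiv ℝ (fun x => F (Ψ x)) =ᶠ[𝓝 x₀] fun x => (fderiv ℝ F (Ψ x)).comp (fderiv ℝ Ψ x) := by
    have h1 : ∀ᶠ x in 𝓝 x₀, ContDiffAt ℝ 2 Ψ x := hΨ.eventually (by simp)
    have h2 : ∀ᶠ x in 𝓝 x₀, ContDiffAt ℝ 2 F (Ψ x) :=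
      hΨ.continuousAt.eventually (hF.eventually (by simp))
    filter_upwards [h1, h2] with x hx1 hx2
    exact fderiv_comp x (hx2.differentiableAt (by norm_num)) (hx1.differentiableAt (by norm_num))
  have h1 : HasFDerivAt (fun x => fderiv ℝ F (Ψ x))
      ((fderiv ℝ (fderiv ℝ F) (Ψ x₀)).comp (fderiv ℝ Ψ x₀)) x₀ :=
    (((hF.fderiv_right (m := 1) (by norm_num)).differentiableAt (by norm_num)).hasFDerivAt).comp x₀
      (hΨ.differentiableAt (by norm_num)).hasFDerivAt
  have h2 : HasFDerivAt (fderiv ℝ Ψ) (fderiv ℝ (fderiv ℝ Ψ) x₀) x₀ :=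
    ((hΨ.fderiv_right (m := 1) (by norm_num)).differentiableAt (by norm_num)).hasFDerivAt
  rw [hd.fderiv_eq, (h1.clm_comp h2).fderiv]
  simp [hcrit]

end Hessian

section Setup

variable {d m : ℕ} {α : ℝ} {g : E d → ℝ}

/-- A homogeneous function of class `C²` whose set of maximum points on the unit sphere is an
`m`-dimensional submanifold, approached non-degenerately. -/
structure IsNondegenerateMax (m : ℕ) (α : ℝ) (g : E d → ℝ) : Prop where
  dim : m + 2 ≤ d
  order_pos : 0 < α
  hom : ∀ (c : ℝ) (u : E d), 0 < c → g (c • u) = c ^ α * g u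
  smooth : ContDiffOn ℝ 2 g {0}ᶜ
  max_pos : 0 < maxVal g
  submanifold : IsC2Submanifold m (maxSet g)
  rank : ∀ v ∈ maxSet g, ∀ u : Fin (d - 1) → E d, Orthonormal ℝ u → (∀ i, inner ℝ (u i) v = 0) →
    ((maxVal g * α)⁻¹ • tangentHessian g v u - 1).rank = d - 1 - m

/-- The difference of the extremal homogeneous function and `g`. -/
def defect (α : ℝ) (g : E d → ℝ) (x : E d) : ℝ := maxVal g * ‖x‖ ^ α - g x

namespace IsNondegenerateMax

variable (hg : IsNondegenerateMax m α g)
include hg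

lemma contDiffAt {x : E d} (hx : x ≠ 0) : ContDiffAt ℝ 2 g x :=
  (hg.smooth x hx).contDiffAt (isOpen_compl_singleton.mem_nhds hx)

lemma continuousOn_sphere : ContinuousOn g (Metric.sphere 0 1) :=
  hg.smooth.continuousOn.mono fun x hx => by
    rw [mem_sphere_zero_iff_norm] at hx
    rintro rfl
    simp at hx

lemma bddAbove : BddAbove (g '' Metric.sphere 0 1) :=
  ((isCompact_sphere 0 1).image_of_continuousOn hg.continuousOn_sphere).bddAbove

lemma le_maxVal {x : E d} (hx : ‖x‖ = 1) : g x ≤ maxVal g :=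
  le_csSup hg.bddAbove ⟨x, by simpa using hx, rfl⟩

lemma maxSet_nonempty : (maxSet g).Nonempty := by
  have : Nontrivial (E d) := by
    have := hg.dim
    have : Nonempty (Fin d) := ⟨⟨0, by omega⟩⟩
    infer_instance
  have hne : (Metric.sphere (0 : E d) 1).Nonempty := NormedSpace.sphere_nonempty.2 zero_le_one
  obtain ⟨v, hv, hmax⟩ := (isCompact_sphere (0 : E d) 1).exists_isMaxOn hne hg.continuousOn_sphere
  refine ⟨v, hv, le_antisymm (hg.le_maxVal (by simpa using hv)) ?_⟩
  exact csSup_le (hne.image g) (by rintro _ ⟨x, hx, rfl⟩; exact hmax hx)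

lemma isClosed_maxSet : IsClosed (maxSet g) := by
  have := hg.continuousOn_sphere.preimage_isClosed_of_isClosed Metric.isClosed_sphere
    (isClosed_singleton (x := maxVal g))
  convert this using 1
  ext x; simp [maxSet]

omit hg in
lemma defect_eq {x : E d} (hx : ‖x‖ = 1) : defect α g x = maxVal g - g x := by
  rw [defect, hx, Real.one_rpow, mul_one]

lemma defect_nonneg {x : E d} (hx : x ≠ 0) : 0 ≤ defect α g x := by
  have hn : 0 < ‖x‖ := norm_pos_iff.2 hx
  have h1 : x = ‖x‖ • (‖x‖⁻¹ • x) := by rw [smul_smul, mul_inv_cancel₀ hn.ne', one_smul]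
  have h2 : g x = ‖x‖ ^ α * g (‖x‖⁻¹ • x) := by
    conv_lhs => rw [h1]
    exact hg.hom _ _ hn
  have h3 : g (‖x‖⁻¹ • x) ≤ maxVal g := hg.le_maxVal (by
    rw [norm_smul, norm_inv, norm_norm, inv_mul_cancel₀ hn.ne'])
  rw [defect, h2]
  nlinarith [Real.rpow_nonneg hn.le α]

lemma contDiffAt_defect {x : E d} (hx : x ≠ 0) : ContDiffAt ℝ 2 (defect α g) x := by
  have h1 : ContDiffAt ℝ 2 (fun x : E d => ‖x‖) x := contDiffAt_norm ℝ hx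
  exact (contDiffAt_const.mul (h1.rpow_const_of_ne (norm_ne_zero_iff.2 hx))).sub
    (hg.contDiffAt hx)

omit hg in
lemma norm_of_mem {v : E d} (hv : v ∈ maxSet g) : ‖v‖ = 1 := by simpa using hv.1

omit hg in
lemma ne_zero_of_mem {v : E d} (hv : v ∈ maxSet g) : v ≠ 0 := by
  rintro rfl
  simpa using norm_of_mem hv

/-- This is why the defect is defined off the sphere: a maximum point is a minimum of it in the full
space, so the whole derivative vanishes, not only its tangential part. The chain rule for second
derivatives then contains no second derivative of the parametrization. -/
lemma fderiv_defect {v : E d} (hv : v ∈ maxSet g) : fderiv ℝ (defect α g) v = 0 := by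
  apply IsLocalMin.fderiv_eq_zero
  have h0 : v ≠ 0 := ne_zero_of_mem hv
  filter_upwards [isOpen_compl_singleton.mem_nhds h0] with x hx
  rw [defect_eq (norm_of_mem hv), hv.2, sub_self]
  exact hg.defect_nonneg hx

end IsNondegenerateMax

/-- The Hessian of `‖v + U t‖ ^ α` at the origin, for an isometry `U` onto the complement
of `v`. -/
lemma hessian_norm_rpow {v : E d} {u : Fin (d - 1) → E d} (h : IsTangentFrame v u) (α : ℝ) :
    hessian (fun t : E (d - 1) => ‖v + frameMap u t‖ ^ α) 0 = α • 1 := by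
  -- By orthogonality the norm depends on `t` only through `‖t‖ ^ 2`, which makes the Hessian at 0 a
  -- multiple of the identity.
  have hn : ∀ t : E (d - 1), ‖v + frameMap u t‖ ^ α = (1 + ‖t‖ ^ 2) ^ (α / 2) := by
    intro t
    have : ‖v + frameMap u t‖ ^ 2 = 1 + ‖t‖ ^ 2 := by
      rw [norm_add_sq_real, h.inner_frameMap, h.norm_frameMap, h.norm_eq]; ring
    rw [← this, ← Real.rpow_natCast, ← Real.rpow_mul (norm_nonneg _)]
    congr 1
    push_cast; ring
  simp only [hn]
  have hpos : ∀ t : E (d - 1), 0 < 1 + ‖t‖ ^ 2 := fun t => by positivity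
  have hd : ∀ t b : E (d - 1), fderiv ℝ (fun t : E (d - 1) => (1 + ‖t‖ ^ 2) ^ (α / 2)) t b =
      (α * (1 + ‖t‖ ^ 2) ^ (α / 2 - 1)) * inner ℝ t b := by
    intro t b
    have h1 : HasFDerivAt (fun t : E (d - 1) => 1 + ‖t‖ ^ 2) (2 • innerSL ℝ t) t :=
      (hasStrictFDerivAt_norm_sq t).hasFDerivAt.const_add 1
    have h2 := h1.rpow_const (p := α / 2) (Or.inl (hpos t).ne')
    rw [h2.fderiv]
    simp
    ring
  ext i j
  rw [hessian, Matrix.of_apply]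
  simp only [hd]
  have h1 : DifferentiableAt ℝ (fun t : E (d - 1) => α * (1 + ‖t‖ ^ 2) ^ (α / 2 - 1)) 0 := by
    have h1 : HasFDerivAt (fun t : E (d - 1) => 1 + ‖t‖ ^ 2) (2 • innerSL ℝ (0 : E (d - 1))) 0 :=
      (hasStrictFDerivAt_norm_sq 0).hasFDerivAt.const_add 1
    exact (h1.rpow_const (p := α / 2 - 1) (Or.inl (hpos 0).ne')).differentiableAt.const_mul α
  have h2 : HasFDerivAt (fun t : E (d - 1) => inner ℝ t (EuclideanSpace.single j (1 : ℝ)))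
      (innerSL ℝ (EuclideanSpace.single j (1 : ℝ))) 0 := by
    have := (innerSL ℝ (EuclideanSpace.single j (1 : ℝ)) : E (d - 1) →L[ℝ] ℝ).hasFDerivAt (x := 0)
    simpa [real_inner_comm] using this
  rw [(h1.hasFDerivAt.fun_mul h2).fderiv, Matrix.smul_apply]
  simp [Matrix.one_apply, EuclideanSpace.inner_single_left, eq_comm]

namespace IsNondegenerateMax

variable (hg : IsNondegenerateMax m α g)
include hg

/-- In the tangent hyperplane the Hessian of the defect is `maxVal g * α` times the identity minus
the normalized Hessian of `g`; a nonzero factor and a sign do not change the rank. -/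
lemma rank_hessian_defect {v : E d} (hv : v ∈ maxSet g) {u : Fin (d - 1) → E d}
    (h : IsTangentFrame v u) :
    (hessian (fun t : E (d - 1) => defect α g (v + frameMap u t)) 0).rank = d - 1 - m := by
  have hM := hg.max_pos
  have hα := hg.order_pos
  rw [← hg.rank v hv u h.orthonormal h.inner_eq]
  have h0 : v + frameMap u 0 ≠ 0 := by simpa using ne_zero_of_mem hv
  have hc : ContDiffAt ℝ 2 (fun t : E (d - 1) => v + frameMap u t) 0 := by fun_prop
  have hN : ContDiffAt ℝ 2 (fun t : E (d - 1) => ‖v + frameMap u t‖ ^ α) 0 :=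
    (hc.norm ℝ h0).rpow_const_of_ne (norm_ne_zero_iff.2 h0)
  have hgc : ContDiffAt ℝ 2 (fun t : E (d - 1) => g (v + frameMap u t)) 0 :=
    ContDiffAt.comp (0 : E (d - 1)) (hg.contDiffAt h0) hc
  have key : hessian (fun t : E (d - 1) => defect α g (v + frameMap u t)) 0 =
      (maxVal g * α) • -((maxVal g * α)⁻¹ • tangentHessian g v u - 1) := by
    have e1 : hessian (fun t : E (d - 1) => defect α g (v + frameMap u t)) 0 =
        maxVal g • hessian (fun t : E (d - 1) => ‖v + frameMap u t‖ ^ α) 0 -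
          hessian (fun t : E (d - 1) => g (v + frameMap u t)) 0 := by
      have hD : ContDiffAt ℝ 2 (fun t : E (d - 1) => defect α g (v + frameMap u t)) 0 :=
        ContDiffAt.comp (0 : E (d - 1)) (hg.contDiffAt_defect h0) hc
      have hev : fderiv ℝ (fun t : E (d - 1) => defect α g (v + frameMap u t)) =ᶠ[𝓝 0]
          fun t => maxVal g • fderiv ℝ (fun t : E (d - 1) => ‖v + frameMap u t‖ ^ α) t -
            fderiv ℝ (fun t : E (d - 1) => g (v + frameMap u t)) t := by
        filter_upwards [hN.eventually (by simp), hgc.eventually (by simp)] with t h1 h2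
        have d1 := h1.differentiableAt (by norm_num)
        have d2 := h2.differentiableAt (by norm_num)
        exact ((d1.hasFDerivAt.const_mul (maxVal g)).sub d2.hasFDerivAt).fderiv
      ext i j
      rw [Matrix.sub_apply, Matrix.smul_apply, hessian_apply hD, hessian_apply hN,
        hessian_apply hgc, hev.fderiv_eq]
      rw [(((hasStrictFDerivAt_fderiv hN).hasFDerivAt.fun_const_smul (maxVal g)).fun_sub
        (hasStrictFDerivAt_fderiv hgc).hasFDerivAt).fderiv]
      simp
    have e2 : hessian (fun t : E (d - 1) => g (v + frameMap u t)) 0 = tangentHessian g v u := by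
      unfold tangentHessian
      simp only [frameMap_apply]
    rw [e1, hessian_norm_rpow h, e2, smul_neg, smul_sub, smul_smul, smul_smul,
      mul_inv_cancel₀ (by positivity), one_smul, neg_sub]
  rw [key]
  have hrk : ∀ (c : ℝ) (A : Matrix (Fin (d - 1)) (Fin (d - 1)) ℝ), c ≠ 0 →
      (c • A).rank = A.rank := fun c A hc => by
    rw [← Matrix.rank_smul_of_mem_nonZeroDivisors A (mem_nonZeroDivisors_of_ne_zero hc)]
  rw [hrk _ _ (by positivity), rank_neg]

end IsNondegenerateMax

end Setup

end PolarChaos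
end

/-! ### Charts of the sphere and parametrizations of the maximum set. -/

noncomputable section

namespace PolarChaos

open scoped ENNReal NNReal

section Charts

variable {d m : ℕ} {α : ℝ} {g : E d → ℝ}

lemma inner_fderiv_eq_zero {n : ℕ} {f : E n → E d} {f' : E n →L[ℝ] E d} {x : E n}
    (hf : HasFDerivAt f f' x) (h1 : ∀ᶠ y in 𝓝 x, ‖f y‖ = 1) (a : E n) :
    inner ℝ (f x) (f' a) = 0 := by
  have h2 := hf.norm_sq
  have h3 : (fun y => ‖f y‖ ^ 2) =ᶠ[𝓝 x] fun _ => (1 : ℝ) := by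
    filter_upwards [h1] with y hy
    rw [hy]; norm_num
  have h4 := h2.unique ((hasFDerivAt_const (1 : ℝ) x).congr_of_eventuallyEq h3)
  have h5 := congrArg (fun L : E n →L[ℝ] ℝ => L a) h4
  simpa using h5

lemma hessian_congr {n : ℕ} {F G : E n → ℝ} {x : E n} (h : F =ᶠ[𝓝 x] G) :
    hessian F x = hessian G x := by
  ext i j
  rw [hessian, hessian, Matrix.of_apply, Matrix.of_apply]
  have : (fun y => fderiv ℝ F y (EuclideanSpace.single j 1)) =ᶠ[𝓝 x]
      fun y => fderiv ℝ G y (EuclideanSpace.single j 1) := by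
    filter_upwards [h.eventuallyEq_nhds] with y hy
    rw [hy.fderiv_eq]
  rw [this.fderiv_eq]

/-- A local parametrization of class `C²` of the unit sphere. -/
structure IsSphereChart (Ψ : E (d - 1) → E d) (x₀ : E (d - 1)) : Prop where
  smooth : ContDiffAt ℝ 2 Ψ x₀
  norm_eq : ∀ᶠ x in 𝓝 x₀, ‖Ψ x‖ = 1
  injective : Function.Injective (fderiv ℝ Ψ x₀)

namespace IsSphereChart

variable {Ψ : E (d - 1) → E d} {x₀ : E (d - 1)} (hΨ : IsSphereChart Ψ x₀)
include hΨ

lemma hasStrictFDerivAt : HasStrictFDerivAt Ψ (fderiv ℝ Ψ x₀) x₀ :=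
  hΨ.smooth.hasStrictFDerivAt (by norm_num)

lemma injective_frameProj {u : Fin (d - 1) → E d} (h : IsTangentFrame (Ψ x₀) u) :
    Function.Injective ((frameProj u).comp (fderiv ℝ Ψ x₀)) := by
  intro a b hab
  apply hΨ.injective
  have h1 := fun a => h.eq_frameMap_of_inner_eq_zero
    (inner_fderiv_eq_zero hΨ.hasStrictFDerivAt.hasFDerivAt hΨ.norm_eq a)
  rw [h1 a, h1 b]
  exact congrArg _ hab

lemma defect_eventuallyEq :
    (fun x => maxVal g - g (Ψ x)) =ᶠ[𝓝 x₀] fun x => defect α g (Ψ x) := by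
  filter_upwards [hΨ.norm_eq] with x hx
  rw [IsNondegenerateMax.defect_eq hx]

variable (hg : IsNondegenerateMax m α g) (hv : Ψ x₀ ∈ maxSet g)
include hg

lemma contDiffAt_comp : ContDiffAt ℝ 2 (fun x => maxVal g - g (Ψ x)) x₀ := by
  refine contDiffAt_const.sub (ContDiffAt.comp x₀ (hg.contDiffAt ?_) hΨ.smooth)
  intro h0
  have := hΨ.norm_eq.self_of_nhds
  rw [h0] at this
  simp at this

include hv

/-- In the chart and in the tangent hyperplane alike, the Hessian is the second derivative of the
defect pulled back by the derivative of the parametrization. The derivative of a chart is tangent to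
the sphere, so it factors through the frame by an injective endomorphism, and the two Hessians are
congruent. -/
lemma rank_hessian : (hessian (fun x => maxVal g - g (Ψ x)) x₀).rank = d - 1 - m := by
  obtain ⟨u, hu⟩ := exists_isTangentFrame (IsNondegenerateMax.norm_of_mem hv)
  rw [hessian_congr (hΨ.defect_eventuallyEq (α := α)), ← hg.rank_hessian_defect hv hu]
  have h0 : Ψ x₀ ≠ 0 := IsNondegenerateMax.ne_zero_of_mem hv
  have h0' : Ψ x₀ + frameMap u 0 ≠ 0 := by simpa using h0
  have hc : ContDiffAt ℝ 2 (fun t : E (d - 1) => Ψ x₀ + frameMap u t) 0 := by fun_prop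
  have hD := hg.contDiffAt_defect h0
  have hD' : ContDiffAt ℝ 2 (defect α g) (Ψ x₀ + frameMap u 0) := by simpa using hD
  refine rank_hessian_comp (ContDiffAt.comp x₀ hD hΨ.smooth)
    (ContDiffAt.comp (g := defect α g) (0 : E (d - 1)) hD' hc) (hΨ.injective_frameProj hu) fun a b => ?_
  rw [snd_fderiv_comp hD hΨ.smooth (hg.fderiv_defect hv),
    snd_fderiv_comp (Ψ := fun t : E (d - 1) => Ψ x₀ + frameMap u t) hD' hc (by simpa using hg.fderiv_defect hv)]
  have e1 : fderiv ℝ (fun t : E (d - 1) => Ψ x₀ + frameMap u t) 0 = frameMap u := by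
    rw [fderiv_const_add]; exact (frameMap u).fderiv
  have e2 : ∀ a, frameMap u ((frameProj u).comp (fderiv ℝ Ψ x₀) a) = fderiv ℝ Ψ x₀ a := fun a =>
    (hu.eq_frameMap_of_inner_eq_zero
      (inner_fderiv_eq_zero hΨ.hasStrictFDerivAt.hasFDerivAt hΨ.norm_eq a)).symm
  rw [e1, e2, e2]
  simp

end IsSphereChart

/-- Padding a vector with zeros. -/
def padZero (m d : ℕ) : E m →L[ℝ] E d :=
  LinearMap.toContinuousLinearMap
    { toFun := fun s => WithLp.toLp 2 fun i : Fin d => if h : i.val < m then s ⟨i, h⟩ else 0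
      map_add' := fun a b => by ext i; by_cases h : i.val < m <;> simp [h]
      map_smul' := fun c a => by ext i; by_cases h : i.val < m <;> simp [h] }

lemma padZero_apply (s : E m) (i : Fin d) :
    padZero m d s i = if h : i.val < m then s ⟨i, h⟩ else 0 := rfl

lemma padZero_injective (h : m ≤ d) : Function.Injective (padZero m d) := by
  intro a b hab
  ext i
  have := congrArg (fun z : E d => z (i.castLE h)) hab
  simpa [padZero_apply] using this

/-- A submanifold is locally parametrized by an immersion. -/
lemma IsC2Submanifold.exists_immersion (hmd : m ≤ d) {M : Set (E d)} (hM : IsC2Submanifold m M)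
    {v : E d} (hv : v ∈ M) :
    ∃ (i : E m → E d) (i' : E m →L[ℝ] E d), HasStrictFDerivAt i i' 0 ∧ Function.Injective i' ∧
      i 0 = v ∧ ∀ᶠ s in 𝓝 0, i s ∈ M := by
  obtain ⟨e, hve, he, hes, himg⟩ := hM v hv
  have hz : e v ∈ e.target := e.map_source hve
  have h1 : HasStrictFDerivAt e (fderiv ℝ e v) v :=
    ((he v hve).contDiffAt (e.open_source.mem_nhds hve)).hasStrictFDerivAt (by norm_num)
  have h2 : HasStrictFDerivAt e.symm (fderiv ℝ e.symm (e v)) (e v) :=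
    ((hes _ hz).contDiffAt (e.open_target.mem_nhds hz)).hasStrictFDerivAt (by norm_num)
  have hinj : Function.Injective (fderiv ℝ e.symm (e v)) := by
    have h3 : HasFDerivAt (fun z => e (e.symm z)) ((fderiv ℝ e v).comp (fderiv ℝ e.symm (e v))) (e v) := by
      have h1' : HasFDerivAt e (fderiv ℝ e v) (e.symm (e v)) := by
        rw [e.left_inv hve]; exact h1.hasFDerivAt
      exact h1'.comp (e v) h2.hasFDerivAt
    have h4 : (fun z => e (e.symm z)) =ᶠ[𝓝 (e v)] fun z => z := by
      filter_upwards [e.open_target.mem_nhds hz] with z hz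
      exact e.right_inv hz
    have h5 := h3.unique ((hasFDerivAt_id (e v)).congr_of_eventuallyEq h4)
    intro a b hab
    have := congrArg (fun L : E d →L[ℝ] E d => L a) h5
    have h6 := congrArg (fun L : E d →L[ℝ] E d => L b) h5
    simp only [ContinuousLinearMap.comp_apply, ContinuousLinearMap.id_apply] at this h6
    rw [← this, ← h6, hab]
  have h3 : HasStrictFDerivAt (fun s : E m => e v + padZero m d s) (padZero m d) 0 :=
    (padZero m d).hasStrictFDerivAt.const_add (e v)
  refine ⟨fun s => e.symm (e v + padZero m d s), (fderiv ℝ e.symm (e v)).comp (padZero m d),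
    ?_, hinj.comp (padZero_injective hmd), ?_, ?_⟩
  · have h2' : HasStrictFDerivAt e.symm (fderiv ℝ e.symm (e v)) (e v + padZero m d 0) := by
      simpa using h2
    exact h2'.comp (0 : E m) h3
  · simpa using e.left_inv hve
  · have hc : Tendsto (fun s : E m => e v + padZero m d s) (𝓝 0) (𝓝 (e v)) := by
      simpa using h3.continuousAt.tendsto
    filter_upwards [hc.eventually (e.open_target.mem_nhds hz)] with s hs
    have hz0 : e v ∈ e '' (e.source ∩ M) := ⟨v, ⟨hve, hv⟩, rfl⟩
    rw [himg] at hz0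
    -- The image of `v` satisfies the slice equations, and padding changes only the first `m`
    -- coordinates.
    have : e v + padZero m d s ∈ e '' (e.source ∩ M) := by
      rw [himg]
      refine ⟨hs, fun i hi => ?_⟩
      rw [PiLp.add_apply, hz0.2 i hi, padZero_apply, dif_neg (by omega), add_zero]
    obtain ⟨x, hx, hxe⟩ := this
    rw [← hxe, e.left_inv hx.1]
    exact hx.2

namespace IsSphereChart

variable {Ψ : E (d - 1) → E d} {x₀ : E (d - 1)} (hΨ : IsSphereChart Ψ x₀)
include hΨ

/-- The immersion into the maximum set is lifted through the chart: it is projected to the tangent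
hyperplane and the local inverse of the projected chart is applied. On the hemisphere the projection
is injective, so the lift lies over the original immersion. -/
lemma exists_immersion (hg : IsNondegenerateMax m α g) (hv : Ψ x₀ ∈ maxSet g) :
    ∃ (i : E m → E (d - 1)) (i' : E m →L[ℝ] E (d - 1)), HasStrictFDerivAt i i' 0 ∧
      Function.Injective i' ∧ i 0 = x₀ ∧ ∀ᶠ s in 𝓝 0, maxVal g - g (Ψ (i s)) = 0 := by
  have hmd := hg.dim
  have hnv := IsNondegenerateMax.norm_of_mem hv
  obtain ⟨u, hu⟩ := exists_isTangentFrame hnv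
  obtain ⟨i, i', hi, hinj, hi0, hiM⟩ := hg.submanifold.exists_immersion (by omega) hv
  set B := (frameProj u).comp (fderiv ℝ Ψ x₀) with hB
  have hBinj : Function.Injective B := hΨ.injective_frameProj hu
  let Be : E (d - 1) ≃L[ℝ] E (d - 1) :=
    (LinearEquiv.ofInjectiveEndo (B : E (d - 1) →ₗ[ℝ] E (d - 1)) hBinj).toContinuousLinearEquiv
  have hBe : (Be : E (d - 1) →L[ℝ] E (d - 1)) = B := by ext; rfl
  set θ : E (d - 1) → E (d - 1) := fun x => frameProj u (Ψ x) with hθ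
  have hθd : HasStrictFDerivAt θ (Be : E (d - 1) →L[ℝ] E (d - 1)) x₀ := by
    rw [hBe]
    exact (frameProj u).hasStrictFDerivAt.comp x₀ hΨ.hasStrictFDerivAt
  set κ := hθd.localInverse θ Be x₀ with hκ
  have hκd : HasStrictFDerivAt κ (Be.symm : E (d - 1) →L[ℝ] E (d - 1)) (θ x₀) :=
    hθd.to_localInverse
  have hκ0 : κ (θ x₀) = x₀ := hθd.localInverse_apply_image
  have hκr : ∀ᶠ y in 𝓝 (θ x₀), θ (κ y) = y := hθd.eventually_right_inverse
  have hθi : frameProj u (i 0) = θ x₀ := by rw [hi0]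
  have hgd : HasStrictFDerivAt (fun s => frameProj u (i s)) ((frameProj u).comp i') 0 :=
    (frameProj u).hasStrictFDerivAt.comp 0 hi
  have hgc : Tendsto (fun s => frameProj u (i s)) (𝓝 0) (𝓝 (θ x₀)) := by
    rw [← hθi]; exact hgd.continuousAt.tendsto
  have hκc : Tendsto (fun s => κ (frameProj u (i s))) (𝓝 0) (𝓝 x₀) := by
    have := hκd.continuousAt.tendsto.comp hgc
    rwa [hκ0] at this
  have hnorm : ∀ᶠ s in 𝓝 0, ‖i s‖ = 1 := hiM.mono fun s hs => IsNondegenerateMax.norm_of_mem hs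
  refine ⟨fun s => κ (frameProj u (i s)),
    (Be.symm : E (d - 1) →L[ℝ] E (d - 1)).comp ((frameProj u).comp i'), ?_, ?_, ?_, ?_⟩
  · have hκd' : HasStrictFDerivAt κ (Be.symm : E (d - 1) →L[ℝ] E (d - 1)) (frameProj u (i 0)) := by
      rwa [hθi]
    exact hκd'.comp 0 hgd
  · refine Be.symm.injective.comp fun a b hab => ?_
    apply hinj
    have h1 := fun a => hu.eq_frameMap_of_inner_eq_zero (x := i' a) (by
      have := inner_fderiv_eq_zero hi.hasFDerivAt hnorm a
      rwa [hi0] at this)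
    rw [h1 a, h1 b]
    exact congrArg _ hab
  · simp only [hθi, hκ0]
  · have hpos : ∀ᶠ x in 𝓝 x₀, 0 < inner ℝ (Ψ x₀) (Ψ x) := by
      have hc : ContinuousAt (fun x => inner ℝ (Ψ x₀) (Ψ x)) x₀ :=
        ContinuousAt.inner (𝕜 := ℝ) continuousAt_const hΨ.smooth.continuousAt
      refine hc.eventually (lt_mem_nhds ?_)
      simp [hnv]
    have hpos' : ∀ᶠ s in 𝓝 0, 0 < inner ℝ (Ψ x₀) (i s) := by
      have hc : ContinuousAt (fun s => inner ℝ (Ψ x₀) (i s)) 0 :=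
        ContinuousAt.inner (𝕜 := ℝ) continuousAt_const hi.continuousAt
      refine hc.eventually (lt_mem_nhds ?_)
      simp [hi0, hnv]
    filter_upwards [hgc.eventually hκr, hκc.eventually hΨ.norm_eq, hκc.eventually hpos, hpos',
      hnorm, hiM] with s h1 h2 h3 h4 h5 h6
    have : Ψ (κ (frameProj u (i s))) = i s := hu.eq_of_frameProj_eq h2 h5 h3 h4 h1
    rw [this, h6.2, sub_self]

end IsSphereChart

end Charts

end PolarChaos
end

/-! ### Laplace asymptotics of the polar kernel in a chart. -/

noncomputable section

namespace PolarChaos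

open scoped ENNReal NNReal

section ChartLaplace

variable {d m : ℕ} {α : ℝ} {g : E d → ℝ}

lemma IsExpKernel.const_mul {ι : Type*} {l : Filter ι} {A : ι → ℝ} {f : ι → ℝ → ℝ}
    (h : IsExpKernel l A f) {c : ℝ} (hc : 0 < c) : IsExpKernel l (fun y => c * A y) f :=
  ⟨h.scale.const_mul_atTop hc, h.nonneg, h.meas, h.anti, h.lim, h.bound⟩

/-- The exponential kernel in the variable `A (max g / g - 1)`. -/
def polarKernel (g : E d → ℝ) (A : ℝ) (f : ℝ → ℝ) (x : E d) : ℝ :=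
  if 0 < g x then f (A * (maxVal g / g x - 1)) else 0

/-- The weight `(2π max g) ^ (k/2) / √|det|` of a point of the maximum set in local
coordinates. -/
def chartWeight (g : E d → ℝ) (m : ℕ) (Ψ : E (d - 1) → E d) (x : E (d - 1)) : ℝ :=
  (2 * Real.pi * maxVal g) ^ (((d - 1 - m : ℕ) : ℝ) / 2) /
    √|pseudoDet (hessian (fun y => g (Ψ y)) x)|

namespace IsSphereChart

variable {Ψ : E (d - 1) → E d} {x₀ : E (d - 1)} (hΨ : IsSphereChart Ψ x₀)
include hΨ

lemma eventually : ∀ᶠ x in 𝓝 x₀, IsSphereChart Ψ x := by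
  have h1 : ContinuousAt (fderiv ℝ Ψ) x₀ :=
    (hΨ.smooth.fderiv_right (m := 1) (by norm_num)).continuousAt
  have h2 := h1.eventually (ContinuousLinearMap.isOpen_injective.mem_nhds hΨ.injective)
  filter_upwards [hΨ.smooth.eventually (by simp), hΨ.norm_eq.eventually_nhds, h2] with x a b c
  exact ⟨a, b, c⟩

variable (hg : IsNondegenerateMax m α g)
include hg

lemma contDiffAt_g : ContDiffAt ℝ 2 (fun x => g (Ψ x)) x₀ := by
  have := (contDiffAt_const (c := maxVal g)).sub (hΨ.contDiffAt_comp hg)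
  simpa using this

lemma abs_pseudoDet_eq :
    |pseudoDet (hessian (fun x => maxVal g - g (Ψ x)) x₀)| =
      |pseudoDet (hessian (fun x => g (Ψ x)) x₀)| := by
  have h1 := hΨ.contDiffAt_g hg
  rw [← abs_pseudoDet_neg (hessian_isHermitian h1)]
  congr 2
  have h2 : (fderiv ℝ fun x => maxVal g - g (Ψ x)) =ᶠ[𝓝 x₀]
      fun x => -fderiv ℝ (fun x => g (Ψ x)) x := by
    refine Eventually.of_forall fun x => ?_
    rw [fderiv_const_sub]
  ext i j
  rw [hessian_apply (hΨ.contDiffAt_comp hg), Matrix.neg_apply, hessian_apply h1, h2.fderiv_eq,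
    fderiv_fun_neg]
  simp

lemma abs_pseudoDet_eq_coeff (hv : Ψ x₀ ∈ maxSet g) :
    |pseudoDet (hessian (fun x => maxVal g - g (Ψ x)) x₀)| =
      |(hessian (fun x => maxVal g - g (Ψ x)) x₀).charpoly.coeff (d - 1 - (d - 1 - m))| :=
  abs_pseudoDet_eq_abs_coeff (hessian_isHermitian (hΨ.contDiffAt_comp hg))
    (hΨ.rank_hessian hg hv)

lemma continuousAt_hessian :
    ContinuousAt (hessian (fun x => maxVal g - g (Ψ x))) x₀ := by
  have h1 := hΨ.contDiffAt_comp hg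
  have h2 : ContinuousAt (fderiv ℝ (fderiv ℝ (fun x => maxVal g - g (Ψ x)))) x₀ :=
    ((h1.fderiv_right (m := 1) (by norm_num)).fderiv_right (m := 0) (by norm_num)).continuousAt
  refine continuousAt_pi.2 fun i => continuousAt_pi.2 fun j => ?_
  have h3 : ContinuousAt (fun x => fderiv ℝ (fderiv ℝ (fun x => maxVal g - g (Ψ x))) x
      (EuclideanSpace.single i 1) (EuclideanSpace.single j 1)) x₀ :=
    (h2.clm_apply continuousAt_const).clm_apply continuousAt_const
  refine h3.congr ?_
  filter_upwards [hΨ.eventually] with x hx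
  rw [hessian_apply (hx.contDiffAt_comp hg)]

omit hΨ in
lemma chartWeight_pos (hΨ : IsSphereChart Ψ x₀) : 0 < chartWeight g m Ψ x₀ := by
  have h1 := pseudoDet_pos_abs (hessian_isHermitian (hΨ.contDiffAt_g hg))
  have := hg.max_pos
  unfold chartWeight
  positivity

/-- On the maximum set the rank is constant, so the pseudo-determinant is a fixed coefficient of the
characteristic polynomial, continuous in the base point. Off that set the rank may jump, hence the
restriction to maximum points. -/
lemma eventually_chartWeight_near {e : ℝ} (he : 0 < e) (hv : Ψ x₀ ∈ maxSet g) :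
    ∀ᶠ x in 𝓝 x₀, Ψ x ∈ maxSet g → (1 - e) * chartWeight g m Ψ x ≤ chartWeight g m Ψ x₀ ∧
      chartWeight g m Ψ x₀ ≤ (1 + e) * chartWeight g m Ψ x := by
  set C := (2 * Real.pi * maxVal g) ^ (((d - 1 - m : ℕ) : ℝ) / 2)
  set F : E (d - 1) → ℝ := fun x => C / √|(hessian (fun x => maxVal g - g (Ψ x)) x).charpoly.coeff
    (d - 1 - (d - 1 - m))| with hF
  have hFe : ∀ x, IsSphereChart Ψ x → Ψ x ∈ maxSet g → chartWeight g m Ψ x = F x := by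
    intro x h1 h2
    rw [chartWeight, ← h1.abs_pseudoDet_eq hg, h1.abs_pseudoDet_eq_coeff hg h2]
  have hpos : 0 < F x₀ := by rw [← hFe x₀ hΨ hv]; exact chartWeight_pos hg hΨ
  have hc : ContinuousAt F x₀ := by
    refine ContinuousAt.div continuousAt_const (Real.continuous_sqrt.continuousAt.comp
      (continuous_abs.continuousAt.comp ((continuous_charpoly_coeff _).continuousAt.comp
        (hΨ.continuousAt_hessian hg)))) ?_
    -- Division by zero returns 0, so positivity of `F x₀` already shows that its denominator is
    -- nonzero.
    intro h0
    exact hpos.ne' ((congrArg (fun z => C / z) h0).trans (div_zero C))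
  have h1 : ∀ᶠ x in 𝓝 x₀, (1 - e) * F x < F x₀ :=
    ((hc.const_mul (1 - e)).eventually (gt_mem_nhds (by nlinarith)))
  have h2 : ∀ᶠ x in 𝓝 x₀, F x₀ < (1 + e) * F x :=
    ((hc.const_mul (1 + e)).eventually (lt_mem_nhds (by nlinarith)))
  filter_upwards [h1, h2, hΨ.eventually] with x a b c hx
  rw [hFe x c hx, hFe x₀ hΨ hv]
  exact ⟨a.le, b.le⟩

-- Where `g x > 0`, the phase is `(maxVal g - g x) / g x`; since `g x ≤ maxVal g` it is at least
-- `(maxVal g - g x) / maxVal g`, and `f` decreases.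
omit hΨ hg in
lemma polarKernel_le {x : E d} (hx : 0 ≤ maxVal g - g x) {A : ℝ}
    (hA : 0 ≤ A) {f : ℝ → ℝ} (hf : Antitone f) (hf0 : ∀ s, 0 ≤ f s) :
    polarKernel g A f x ≤ f ((maxVal g)⁻¹ * A * (maxVal g - g x)) := by
  unfold polarKernel
  split_ifs with h
  · apply hf
    have : maxVal g / g x - 1 = (maxVal g - g x) / g x := by field_simp
    rw [this, mul_comm _ A, mul_assoc]
    refine mul_le_mul_of_nonneg_left ?_ hA
    rw [inv_mul_eq_div]
    gcongr
    linarith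
  · exact hf0 _

-- Close to the maximum set, replacing `g x` by `maxVal g` in the denominator of the phase costs at
-- most a factor `1 + e`.
omit hΨ hg in
lemma le_polarKernel (hpos : 0 < maxVal g) {x : E d} (hx : 0 ≤ maxVal g - g x) {A e : ℝ}
    (hA : 0 ≤ A) (hge : maxVal g ≤ (1 + e) * g x) (he : 0 < e) {f : ℝ → ℝ} (hf : Antitone f) :
    f ((1 + e) * (maxVal g)⁻¹ * A * (maxVal g - g x)) ≤ polarKernel g A f x := by
  have hgx : 0 < g x := by
    by_contra hn
    push Not at hn
    nlinarith
  rw [polarKernel, if_pos hgx]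
  apply hf
  have : maxVal g / g x - 1 = (maxVal g - g x) / g x := by field_simp
  rw [this]
  have h1 : (maxVal g - g x) / g x ≤ (1 + e) * (maxVal g)⁻¹ * (maxVal g - g x) := by
    rw [div_eq_inv_mul]
    refine mul_le_mul_of_nonneg_right ?_ hx
    rw [← div_eq_mul_inv, le_div_iff₀ hpos, inv_mul_le_iff₀ hgx]
    linarith
  calc _ ≤ A * ((1 + e) * (maxVal g)⁻¹ * (maxVal g - g x)) := mul_le_mul_of_nonneg_left h1 hA
    _ = _ := by ring

/-- Laplace asymptotics of the polar kernel in a chart of the sphere. -/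
theorem exists_nhds_laplace (hv : Ψ x₀ ∈ maxSet g) {ε : ℝ} (hε : 0 < ε) {W₀ : Set (E (d - 1))}
    (hW₀ : W₀ ∈ 𝓝 x₀) :
    ∃ W, IsOpen W ∧ x₀ ∈ W ∧ W ⊆ W₀ ∧
      (μHE[m] : Measure (E (d - 1))) {x ∈ W | Ψ x ∈ maxSet g} < ∞ ∧
      0 < (μHE[m] : Measure (E (d - 1))) {x ∈ W | Ψ x ∈ maxSet g} ∧
      MeasurableSet {x ∈ W | Ψ x ∈ maxSet g} ∧
      (∀ x ∈ W, Ψ x ∈ maxSet g → chartWeight g m Ψ x ≤ 2 * chartWeight g m Ψ x₀ ∧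
        chartWeight g m Ψ x₀ ≤ 2 * chartWeight g m Ψ x) ∧
      ∀ (q : E (d - 1) → ℝ≥0∞) (Cq : ℝ≥0∞), Measurable q → Cq ≠ ∞ → (∀ x, q x ≤ Cq) →
        ContinuousOn q W → (∀ x ∉ W, q x = 0) →
        ∀ (ι : Type) (l : Filter ι) (A : ι → ℝ) (f : ι → ℝ → ℝ), l.IsCountablyGenerated →
          IsExpKernel l A f → ∀ δ : ℝ≥0∞, 0 < δ →
          (∀ᶠ y in l, ENNReal.ofReal (A y ^ (((d - 1 - m : ℕ) : ℝ) / 2)) *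
              ∫⁻ x, q x * ENNReal.ofReal (polarKernel g (A y) (f y) (Ψ x)) ≤
            ENNReal.ofReal (1 + ε) * (∫⁻ x in {x ∈ W | Ψ x ∈ maxSet g},
              q x * ENNReal.ofReal (chartWeight g m Ψ x) ∂μHE[m]) + δ) ∧
          (∀ᶠ y in l, ENNReal.ofReal (1 - ε) * (∫⁻ x in {x ∈ W | Ψ x ∈ maxSet g},
              q x * ENNReal.ofReal (chartWeight g m Ψ x) ∂μHE[m]) ≤
            ENNReal.ofReal (A y ^ (((d - 1 - m : ℕ) : ℝ) / 2)) *
              (∫⁻ x, q x * ENNReal.ofReal (polarKernel g (A y) (f y) (Ψ x))) + δ) := by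
  have hpos := hg.max_pos
  have hdim := hg.dim
  set κ : ℝ := ((d - 1 - m : ℕ) : ℝ) / 2 with hκ
  -- One factor `1 ± e` pays for the Laplace error and one for the variation of the chart weight.
  -- The lower bound also loses `(1 / (1 + e)) ^ κ` from the comparison of phases, and `e < 1 / 2`
  -- gives the comparison of weights within a factor 2.
  obtain ⟨e, he0, he1, heu, hel⟩ : ∃ e : ℝ, 0 < e ∧ e < 1 / 2 ∧ (1 + e) * (1 + e) ≤ 1 + ε ∧
      1 - ε ≤ (1 / (1 + e)) ^ κ * ((1 - e) * (1 - e)) := by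
    have h1 : ContinuousAt (fun e : ℝ => (1 + e) * (1 + e)) 0 := by fun_prop
    have h2 : ContinuousAt (fun e : ℝ => (1 / (1 + e)) ^ κ * ((1 - e) * (1 - e))) 0 := by
      refine ContinuousAt.mul (ContinuousAt.rpow_const (ContinuousAt.div continuousAt_const
        (by fun_prop) (by norm_num)) (Or.inl (by norm_num))) (by fun_prop)
    have h3 := (h1.mono_left (nhdsWithin_le_nhds (s := Set.Ioi 0))).eventually
      (gt_mem_nhds (show (1 + (0 : ℝ)) * (1 + 0) < 1 + ε by linarith))
    have h4 := (h2.mono_left (nhdsWithin_le_nhds (s := Set.Ioi 0))).eventually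
      (lt_mem_nhds (show 1 - ε < (1 / (1 + (0 : ℝ))) ^ κ * ((1 - 0) * (1 - 0)) by simp [hε]))
    have h5 : ∀ᶠ e : ℝ in 𝓝[>] 0, e ∈ Set.Ioo (0 : ℝ) (1 / 2) := Ioo_mem_nhdsGT (by norm_num)
    obtain ⟨e, h3, h4, h5⟩ := (h3.and (h4.and h5)).exists
    exact ⟨e, h5.1, h5.2, h3.le, h4.le⟩
  obtain ⟨i, i', hi, hi', hi0, hiZ⟩ := hΨ.exists_immersion hg hv
  set S : E (d - 1) → ℝ := fun x => maxVal g - g (Ψ x) with hS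
  have hgc : ContinuousAt (fun x => g (Ψ x)) x₀ := (hΨ.contDiffAt_g hg).continuousAt
  have hW₁ : {x | IsSphereChart Ψ x ∧ (Ψ x ∈ maxSet g →
      (1 - e) * chartWeight g m Ψ x ≤ chartWeight g m Ψ x₀ ∧
      chartWeight g m Ψ x₀ ≤ (1 + e) * chartWeight g m Ψ x) ∧
      maxVal g ≤ (1 + e) * g (Ψ x) ∧ x ∈ W₀} ∈ 𝓝 x₀ := by
    have h2 : ∀ᶠ x in 𝓝 x₀, maxVal g < (1 + e) * g (Ψ x) := by
      refine (hgc.const_mul (1 + e)).eventually (lt_mem_nhds ?_)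
      show maxVal g < (1 + e) * g (Ψ x₀)
      rw [hv.2]; nlinarith
    filter_upwards [hΨ.eventually, hΨ.eventually_chartWeight_near hg he0 hv, h2, hW₀] with x a b c d
    exact ⟨a, b, c.le, d⟩
  obtain ⟨W, hWo, hxW, hWsub, hfin, hWpos, hmain⟩ := PolarChaos.exists_nhds_laplace
    (show m + (d - 1 - m) = d - 1 by omega) (hΨ.contDiffAt_comp hg)
    (by rw [hv.2, sub_self]) (by
      filter_upwards [hΨ.norm_eq] with x hx
      exact sub_nonneg.2 (hg.le_maxVal hx)) (hΨ.rank_hessian hg hv) hi hi' hi0 hiZ he0 hW₁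
  have hSnn : ∀ x ∈ W, 0 ≤ S x := fun x hx =>
    sub_nonneg.2 (hg.le_maxVal (hWsub hx).1.norm_eq.self_of_nhds)
  have hZ : {x ∈ W | Ψ x ∈ maxSet g} = {x ∈ W | S x = 0} := by
    ext x
    refine and_congr_right fun hx => ⟨fun h => by simp only [hS]; rw [h.2, sub_self], fun h => ?_⟩
    exact ⟨by simpa using (hWsub hx).1.norm_eq.self_of_nhds, (sub_eq_zero.1 h).symm⟩
  have hZm : MeasurableSet {x ∈ W | Ψ x ∈ maxSet g} := by
    have hSc : ContinuousOn S W := fun x hx =>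
      ((hWsub hx).1.contDiffAt_comp hg).continuousAt.continuousWithinAt
    have h1 : IsOpen (W ∩ S ⁻¹' {0}ᶜ) := hSc.isOpen_inter_preimage hWo isOpen_compl_singleton
    have h2 : {x ∈ W | Ψ x ∈ maxSet g} = W \ (W ∩ S ⁻¹' {0}ᶜ) := by
      rw [hZ]; ext x; simp
    rw [h2]
    exact hWo.measurableSet.diff h1.measurableSet
  have hcw : ∀ x ∈ W, 0 < chartWeight g m Ψ x := fun x hx => chartWeight_pos hg (hWsub hx).1
  refine ⟨W, hWo, hxW, fun x hx => (hWsub hx).2.2.2, by rwa [hZ], by rwa [hZ], hZm, ?_, ?_⟩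
  · intro x hx hxM
    have h1 := (hWsub hx).2.1 hxM
    have h2 := hcw x hx
    constructor <;> nlinarith
  intro q Cq hq hCq hqC hqc hq0 ι l A f hl hf δ hδ
  set I : ι → ℝ≥0∞ := fun y => ∫⁻ x, q x * ENNReal.ofReal (polarKernel g (A y) (f y) (Ψ x)) with hI
  set Z := {x ∈ W | Ψ x ∈ maxSet g} with hZdef
  set c₀ : ℝ := (2 * Real.pi) ^ κ / √|pseudoDet (hessian S x₀)| with hc₀
  have hcw0 : chartWeight g m Ψ x₀ = maxVal g ^ κ * c₀ := by
    rw [chartWeight, hc₀, hΨ.abs_pseudoDet_eq hg, Real.mul_rpow (by positivity) hpos.le]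
    ring
  have hc₀pos : 0 ≤ c₀ := by positivity
  constructor
  · have hb : 0 < (maxVal g) ^ κ := by positivity
    -- The Laplace limit is used at scale `A / maxVal g`; returning to `A` multiplies everything by
    -- `maxVal g ^ κ`, so the error is divided by it beforehand.
    have hδ' : 0 < δ / ENNReal.ofReal (maxVal g ^ κ) := ENNReal.div_pos hδ.ne' ENNReal.ofReal_ne_top
    have h1 := (hmain q Cq hq hCq hqC hqc hq0 ι l (fun y => (maxVal g)⁻¹ * A y) f hl
      (hf.const_mul (inv_pos.2 hpos)) _ hδ').1
    filter_upwards [h1, hf.scale.eventually_ge_atTop 0, hf.anti] with y hy hA hanti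
    have hle : I y ≤ ∫⁻ x, q x * ENNReal.ofReal (f y ((maxVal g)⁻¹ * A y * S x)) := by
      refine lintegral_mono fun x => ?_
      by_cases hx : x ∈ W
      · gcongr
        exact polarKernel_le (hSnn x hx) hA hanti (hf.nonneg y)
      · simp [hq0 x hx]
    have hint : ENNReal.ofReal (maxVal g ^ κ * ((1 + e) * c₀)) * ∫⁻ x in Z, q x ∂μHE[m] ≤
        ENNReal.ofReal (1 + ε) * ∫⁻ x in Z, q x * ENNReal.ofReal (chartWeight g m Ψ x) ∂μHE[m] := by
      rw [← lintegral_const_mul' _ _ ENNReal.ofReal_ne_top,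
        ← lintegral_const_mul' _ _ ENNReal.ofReal_ne_top]
      refine setLIntegral_mono' hZm fun x hx => ?_
      rw [mul_left_comm (ENNReal.ofReal (1 + ε)) (q x),
        ← ENNReal.ofReal_mul (show 0 ≤ 1 + ε by linarith), mul_comm _ (q x)]
      refine mul_le_mul' le_rfl (ENNReal.ofReal_le_ofReal ?_)
      have h2 := ((hWsub hx.1).2.1 hx.2).2
      have h3 := hcw x hx.1
      calc maxVal g ^ κ * ((1 + e) * c₀) = (1 + e) * chartWeight g m Ψ x₀ := by rw [hcw0]; ring
        _ ≤ (1 + e) * ((1 + e) * chartWeight g m Ψ x) := by gcongr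
        _ = (1 + e) * (1 + e) * chartWeight g m Ψ x := by ring
        _ ≤ _ := by gcongr
    calc ENNReal.ofReal (A y ^ κ) * I y
        ≤ ENNReal.ofReal (A y ^ κ) *
          ∫⁻ x, q x * ENNReal.ofReal (f y ((maxVal g)⁻¹ * A y * S x)) := by gcongr
      _ = ENNReal.ofReal (maxVal g ^ κ) * (ENNReal.ofReal (((maxVal g)⁻¹ * A y) ^ κ) *
          ∫⁻ x, q x * ENNReal.ofReal (f y ((maxVal g)⁻¹ * A y * S x))) := by
        rw [← mul_assoc, ← ENNReal.ofReal_mul (by positivity),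
          ← Real.mul_rpow hpos.le (by positivity), mul_inv_cancel_left₀ hpos.ne']
      _ ≤ ENNReal.ofReal (maxVal g ^ κ) * (ENNReal.ofReal ((1 + e) * c₀) *
          (∫⁻ x in Z, q x ∂μHE[m]) + δ / ENNReal.ofReal (maxVal g ^ κ)) := by
        rw [hZ]; gcongr
      _ ≤ _ := by
        rw [mul_add, ← mul_assoc, ← ENNReal.ofReal_mul hb.le]
        exact add_le_add hint ENNReal.mul_div_le
  · set b : ℝ := (maxVal g / (1 + e)) ^ κ with hbdef
    have hb : 0 < b := by positivity
    have hδ' : 0 < δ / ENNReal.ofReal b := ENNReal.div_pos hδ.ne' ENNReal.ofReal_ne_top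
    have h1 := (hmain q Cq hq hCq hqC hqc hq0 ι l (fun y => (1 + e) * (maxVal g)⁻¹ * A y) f hl
      (hf.const_mul (by positivity)) _ hδ').2
    filter_upwards [h1, hf.scale.eventually_ge_atTop 0, hf.anti] with y hy hA hanti
    have hle : ∫⁻ x, q x * ENNReal.ofReal (f y ((1 + e) * (maxVal g)⁻¹ * A y * S x)) ≤ I y := by
      refine lintegral_mono fun x => ?_
      by_cases hx : x ∈ W
      · gcongr
        exact le_polarKernel hpos (hSnn x hx) hA (hWsub hx).2.2.1 he0 hanti
      · simp [hq0 x hx]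
    have hint : ENNReal.ofReal (1 - ε) * ∫⁻ x in Z, q x * ENNReal.ofReal (chartWeight g m Ψ x)
        ∂μHE[m] ≤ ENNReal.ofReal (b * ((1 - e) * c₀)) * ∫⁻ x in Z, q x ∂μHE[m] := by
      rw [← lintegral_const_mul' _ _ ENNReal.ofReal_ne_top,
        ← lintegral_const_mul' _ _ ENNReal.ofReal_ne_top]
      refine setLIntegral_mono' hZm fun x hx => ?_
      have h3 := hcw x hx.1
      rw [mul_left_comm (ENNReal.ofReal (1 - ε)) (q x), ← ENNReal.ofReal_mul' h3.le,
        mul_comm _ (q x)]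
      refine mul_le_mul' le_rfl (ENNReal.ofReal_le_ofReal ?_)
      have h2 := ((hWsub hx.1).2.1 hx.2).1
      have hb2 : b = (1 / (1 + e)) ^ κ * maxVal g ^ κ := by
        rw [hbdef, ← Real.mul_rpow (by positivity) hpos.le]; congr 1; ring
      calc (1 - ε) * chartWeight g m Ψ x
          ≤ ((1 / (1 + e)) ^ κ * ((1 - e) * (1 - e))) * chartWeight g m Ψ x := by gcongr
        _ = (1 / (1 + e)) ^ κ * (1 - e) * ((1 - e) * chartWeight g m Ψ x) := by ring
        _ ≤ (1 / (1 + e)) ^ κ * (1 - e) * chartWeight g m Ψ x₀ := by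
          have : 0 ≤ 1 - e := by linarith
          gcongr
        _ = b * ((1 - e) * c₀) := by rw [hcw0, hb2]; ring
    have hbA : ENNReal.ofReal b * ENNReal.ofReal (((1 + e) * (maxVal g)⁻¹ * A y) ^ κ) =
        ENNReal.ofReal (A y ^ κ) := by
      rw [← ENNReal.ofReal_mul hb.le, hbdef, ← Real.mul_rpow (by positivity) (by positivity)]
      congr 2
      field_simp
    calc _ ≤ ENNReal.ofReal b * (ENNReal.ofReal ((1 - e) * c₀) * ∫⁻ x in Z, q x ∂μHE[m]) := by
          rw [← mul_assoc, ← ENNReal.ofReal_mul hb.le]; exact hint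
      _ ≤ ENNReal.ofReal b * (ENNReal.ofReal (((1 + e) * (maxVal g)⁻¹ * A y) ^ κ) *
          (∫⁻ x, q x * ENNReal.ofReal (f y ((1 + e) * (maxVal g)⁻¹ * A y * S x))) +
            δ / ENNReal.ofReal b) := by rw [hZ]; gcongr
      _ ≤ _ := by
        rw [mul_add, ← mul_assoc, hbA]
        exact add_le_add (by gcongr) ENNReal.mul_div_le

end IsSphereChart

end ChartLaplace

end PolarChaos
end

/-! ### From local comparison of measures to convergence of total masses. -/

noncomputable section

namespace PolarChaos

open scoped ENNReal NNReal

section LocalToGlobal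

variable {X : Type*} [MetricSpace X] [MeasurableSpace X] [BorelSpace X] {ι : Type*} {l : Filter ι}

/-- The integrals of cutoff functions supported in `U` against `I y` are eventually within the
factors `1 ± ε` of those against `Λ`, up to small errors. -/
def IsLocallyClose (l : Filter ι) (I : ι → Measure X) (Λ : Measure X) (ε : ℝ) (U : Set X) : Prop :=
  ∀ ψ : C(X, ℝ), (∀ x, 0 ≤ ψ x) → (∀ x, ψ x ≤ 1) → (∀ x ∉ U, ψ x = 0) → ∀ δ : ℝ≥0∞, 0 < δ →
    ∀ᶠ y in l, ∫⁻ x, ENNReal.ofReal (ψ x) ∂I y ≤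
        ENNReal.ofReal (1 + ε) * ∫⁻ x, ENNReal.ofReal (ψ x) ∂Λ + δ ∧
      ENNReal.ofReal (1 - ε) * ∫⁻ x, ENNReal.ofReal (ψ x) ∂Λ ≤
        ∫⁻ x, ENNReal.ofReal (ψ x) ∂I y + δ

/-- A finite subcover and a subordinate partition of unity write a cutoff equal to 1 on `C` as a
finite sum of local cutoffs; the factors `1 ± ε` are common to all summands and the additive error
is shared among them. -/
lemma exists_cutoff_close {I : ι → Measure X} {Λ : Measure X} {C : Set X} (hC : IsCompact C)
    {ε : ℝ} (h : ∀ v ∈ C, ∃ U, IsOpen U ∧ v ∈ U ∧ Λ U < ∞ ∧ IsLocallyClose l I Λ ε U) :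
    ∃ Ψ : X → ℝ≥0∞, (∀ x, Ψ x ≤ 1) ∧ (∀ x ∈ C, Ψ x = 1) ∧ ∫⁻ x, Ψ x ∂Λ < ∞ ∧
      ∀ δ : ℝ≥0∞, 0 < δ → ∀ᶠ y in l,
        ∫⁻ x, Ψ x ∂I y ≤ ENNReal.ofReal (1 + ε) * ∫⁻ x, Ψ x ∂Λ + δ ∧
        ENNReal.ofReal (1 - ε) * ∫⁻ x, Ψ x ∂Λ ≤ ∫⁻ x, Ψ x ∂I y + δ := by
  choose! U hUo hUv hUΛ hU using h
  obtain ⟨t, htC, ht⟩ := hC.elim_nhds_subcover U fun v hv => (hUo v hv).mem_nhds (hUv v hv)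
  obtain ⟨f, hf⟩ := PartitionOfUnity.exists_isSubordinate hC.isClosed (fun i : t => U i)
    (fun i => hUo i (htC i i.2)) (by
      intro x hx
      obtain ⟨i, hi, hxi⟩ := Set.mem_iUnion₂.1 (ht hx)
      exact Set.mem_iUnion.2 ⟨⟨i, hi⟩, hxi⟩)
  have hf0 : ∀ i : t, ∀ x ∉ U i, f i x = 0 := fun i x hx => by
    by_contra hne
    exact hx (hf i (subset_tsupport _ hne))
  have hsum : ∀ x, ∑ i : t, ENNReal.ofReal (f i x) = ENNReal.ofReal (∑ᶠ i, f i x) := fun x => by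
    rw [finsum_eq_sum_of_fintype, ENNReal.ofReal_sum_of_nonneg fun i _ => f.nonneg i x]
  have hmeas : ∀ i : t, Measurable fun x => ENNReal.ofReal (f i x) := fun i =>
    ENNReal.measurable_ofReal.comp (f i).continuous.measurable
  have hint : ∀ ρ : Measure X, ∫⁻ x, ∑ i : t, ENNReal.ofReal (f i x) ∂ρ =
      ∑ i : t, ∫⁻ x, ENNReal.ofReal (f i x) ∂ρ := fun ρ =>
    lintegral_finsetSum _ fun i _ => hmeas i
  refine ⟨fun x => ∑ i : t, ENNReal.ofReal (f i x), fun x => ?_, fun x hx => ?_, ?_,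
    fun δ hδ => ?_⟩
  · simp only [hsum]
    rw [← ENNReal.ofReal_one]
    exact ENNReal.ofReal_le_ofReal (f.sum_le_one x)
  · simp only [hsum, f.sum_eq_one hx, ENNReal.ofReal_one]
  · rw [hint]
    refine ENNReal.sum_lt_top.2 fun i _ => lt_of_le_of_lt ?_ (hUΛ i (htC i i.2))
    rw [← lintegral_indicator_one (hUo i (htC i i.2)).measurableSet]
    refine lintegral_mono fun x => ?_
    by_cases hx : x ∈ U i
    · simp [hx, f.le_one i x]
    · simp [hf0 i x hx]
  · have hδ' : 0 < δ / Fintype.card t :=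
      ENNReal.div_pos hδ.ne' (ENNReal.natCast_ne_top _)
    have hδs : ∑ _i : t, δ / Fintype.card t ≤ δ := by
      rw [Finset.sum_const, Finset.card_univ, nsmul_eq_mul]
      exact ENNReal.mul_div_le
    have := fun i : t => hU i (htC i i.2) (f i) (f.nonneg i) (f.le_one i) (hf0 i) _ hδ'
    filter_upwards [eventually_all.2 this] with y hy
    rw [hint, hint, Finset.mul_sum, Finset.mul_sum]
    constructor
    · calc _ ≤ ∑ i : t, (ENNReal.ofReal (1 + ε) * ∫⁻ x, ENNReal.ofReal (f i x) ∂Λ +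
            δ / Fintype.card t) := Finset.sum_le_sum fun i _ => (hy i).1
        _ ≤ _ := by rw [Finset.sum_add_distrib]; gcongr
    · calc _ ≤ ∑ i : t, (∫⁻ x, ENNReal.ofReal (f i x) ∂I y + δ / Fintype.card t) :=
            Finset.sum_le_sum fun i _ => (hy i).2
        _ ≤ _ := by rw [Finset.sum_add_distrib]; gcongr

/-- Convergence of the total masses from local comparison off a closed null set and smallness
near that set. -/
theorem tendsto_measure_univ_of_local [l.NeBot] {I : ι → Measure X} {Λ : Measure X} {S K : Set X}
    (hS : IsCompact S) (hIS : ∀ y, I y Sᶜ = 0) (hΛS : Λ Sᶜ = 0) (hK : IsClosed K) (hΛK : Λ K = 0)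
    (hsmall : ∀ η : ℝ≥0∞, 0 < η → ∃ O, IsOpen O ∧ K ⊆ O ∧ ∀ᶠ y in l, I y O ≤ η)
    (hloc : ∀ ε : ℝ, 0 < ε → ∀ v ∈ S \ K, ∃ U, IsOpen U ∧ v ∈ U ∧ Λ U < ∞ ∧
      IsLocallyClose l I Λ ε U) :
    Λ Set.univ < ∞ ∧ Tendsto (fun y => I y Set.univ) l (𝓝 (Λ Set.univ)) := by
  have hcut : ∀ O, IsOpen O → K ⊆ O → ∀ ε : ℝ, 0 < ε → _ := fun O hO hKO ε hε =>
    exists_cutoff_close (l := l) (I := I) (Λ := Λ) (hS.diff hO) (ε := ε)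
      fun v hv => hloc ε hε v ⟨hv.1, fun h => hv.2 (hKO h)⟩
  have hlow : ∀ (ρ : Measure X) (C : Set X) (Ψ : X → ℝ≥0∞), MeasurableSet C →
      (∀ x ∈ C, Ψ x = 1) → ρ C ≤ ∫⁻ x, Ψ x ∂ρ := by
    intro ρ C Ψ hC h
    rw [← lintegral_indicator_one hC]
    refine lintegral_mono fun x => ?_
    by_cases hx : x ∈ C <;> simp [hx, h]
  have hup : ∀ (ρ : Measure X) (Ψ : X → ℝ≥0∞), (∀ x, Ψ x ≤ 1) → ∫⁻ x, Ψ x ∂ρ ≤ ρ Set.univ := by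
    intro ρ Ψ h
    rw [← lintegral_one]
    exact lintegral_mono h
  have huniv : ∀ y O, I y Set.univ ≤ I y O + I y (S \ O) := by
    intro y O
    calc I y Set.univ ≤ I y (Sᶜ ∪ (O ∪ S \ O)) := by
          refine measure_mono fun x _ => ?_
          by_cases h1 : x ∈ S <;> by_cases h2 : x ∈ O <;> simp [h1, h2]
      _ ≤ _ := (measure_union_le _ _).trans (by rw [hIS, zero_add]; exact measure_union_le _ _)
  -- upper bound
  have hupper : ∀ η : ℝ≥0∞, 0 < η → ∀ ε : ℝ, 0 < ε → ∃ L ≤ Λ Set.univ, L < ∞ ∧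
      ∀ᶠ y in l, I y Set.univ ≤ η + (ENNReal.ofReal (1 + ε) * L + η) := by
    intro η hη ε hε
    obtain ⟨O, hO, hKO, hI1⟩ := hsmall η hη
    obtain ⟨Ψ, h1, h2, h3, h4⟩ := hcut O hO hKO ε hε
    refine ⟨_, hup Λ Ψ h1, h3, ?_⟩
    filter_upwards [hI1, h4 η hη] with y a b
    exact (huniv y O).trans (add_le_add a
      ((hlow _ _ Ψ (hS.measurableSet.diff hO.measurableSet) h2).trans b.1))
  -- The cutoff is 1 on `S \ O` and at most 1 everywhere, so it mediates between the limit mass of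
  -- the former and the total mass of `I y`.
  have hlower : ∀ O, IsOpen O → K ⊆ O → ∀ ε : ℝ, 0 < ε → ∀ η : ℝ≥0∞, 0 < η →
      ∀ᶠ y in l, ENNReal.ofReal (1 - ε) * Λ (S \ O) ≤ I y Set.univ + η := by
    intro O hO hKO ε hε η hη
    obtain ⟨Ψ, h1, h2, h3, h4⟩ := hcut O hO hKO ε hε
    filter_upwards [h4 η hη] with y b
    calc _ ≤ ENNReal.ofReal (1 - ε) * ∫⁻ x, Ψ x ∂Λ := by
          gcongr
          exact hlow _ _ Ψ (hS.measurableSet.diff hO.measurableSet) h2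
      _ ≤ _ := b.2.trans (by gcongr; exact hup _ Ψ h1)
  -- Complements of shrinking thickenings exhaust the complement of the closed set `K`. Since `Λ`
  -- charges neither `K` nor the complement of `S`, the whole mass is recovered.
  have hexh : Tendsto (fun n : ℕ => Λ (S \ Metric.thickening (1 / ((n : ℝ) + 1)) K)) atTop
      (𝓝 (Λ Set.univ)) := by
    have e1 : Λ Set.univ = Λ (⋃ n : ℕ, S \ Metric.thickening (1 / ((n : ℝ) + 1)) K) := by
      have e2 : (⋃ n : ℕ, S \ Metric.thickening (1 / ((n : ℝ) + 1)) K) = S \ K := by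
        rw [← Set.sdiff_iInter]
        congr 1
        have e := Metric.closure_eq_iInter_thickening' K
          (Set.range fun n : ℕ => 1 / ((n : ℝ) + 1)) (by
            rintro _ ⟨n, rfl⟩
            exact Set.mem_Ioi.2 Nat.one_div_pos_of_nat) (by
            intro ε hε
            obtain ⟨n, hn⟩ := exists_nat_one_div_lt hε
            exact ⟨_, ⟨n, rfl⟩, Nat.one_div_pos_of_nat, hn.le⟩)
        rw [hK.closure_eq, Set.biInter_range] at e
        exact e.symm
      rw [e2]
      refine le_antisymm ?_ (measure_mono (Set.subset_univ _))
      calc Λ Set.univ ≤ Λ (Sᶜ ∪ (K ∪ S \ K)) := by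
            refine measure_mono fun x _ => ?_
            by_cases h1 : x ∈ S <;> by_cases h2 : x ∈ K <;> simp [h1, h2]
        _ ≤ Λ Sᶜ + (Λ K + Λ (S \ K)) :=
            (measure_union_le _ _).trans (by gcongr; exact measure_union_le _ _)
        _ = _ := by rw [hΛS, hΛK, zero_add, zero_add]
    rw [e1]
    refine tendsto_measure_iUnion_atTop fun a b hab => Set.sdiff_subset_sdiff_right ?_
    exact Metric.thickening_mono (one_div_le_one_div_of_le (by positivity) (by gcongr)) K
  have hthick : ∀ n : ℕ, IsOpen (Metric.thickening (1 / ((n : ℝ) + 1)) K) ∧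
      K ⊆ Metric.thickening (1 / ((n : ℝ) + 1)) K := fun n =>
    ⟨Metric.isOpen_thickening, Metric.self_subset_thickening Nat.one_div_pos_of_nat K⟩
  -- Finiteness is derived: the masses of `I y` are eventually bounded, and each exhausting piece
  -- has limit mass at most twice such a bound plus a constant.
  have hfin : Λ Set.univ < ∞ := by
    obtain ⟨L, -, hL, hev⟩ := hupper 1 one_pos 1 one_pos
    set B : ℝ≥0∞ := 1 + (ENNReal.ofReal (1 + 1) * L + 1) with hB
    have hBfin : B < ∞ := by
      simp only [hB, ENNReal.add_lt_top, ENNReal.one_lt_top, true_and, and_true]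
      exact ENNReal.mul_lt_top ENNReal.ofReal_lt_top hL
    have : ENNReal.ofReal (1 - 1 / 2) * Λ Set.univ ≤ B + 1 := by
      refine le_of_tendsto (ENNReal.Tendsto.const_mul hexh (Or.inr ENNReal.ofReal_ne_top))
        (Eventually.of_forall fun n => ?_)
      obtain ⟨y, hy1, hy2⟩ := (hev.and (hlower _ (hthick n).1 (hthick n).2 (1 / 2) (by norm_num)
        1 one_pos)).exists
      exact hy2.trans (by gcongr)
    by_contra htop
    rw [not_lt, top_le_iff] at htop
    rw [htop, ENNReal.mul_top (by norm_num)] at this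
    exact (ENNReal.add_lt_top.2 ⟨hBfin, ENNReal.one_lt_top⟩).ne (top_le_iff.1 this)
  refine ⟨hfin, tendsto_of_le_liminf_of_limsup_le ?_ ?_⟩
  · refine le_of_tendsto hexh (Eventually.of_forall fun n => ?_)
    set a := Λ (S \ Metric.thickening (1 / ((n : ℝ) + 1)) K)
    have h1 : ∀ ε : ℝ, 0 < ε → ENNReal.ofReal (1 - ε) * a ≤ liminf (fun y => I y Set.univ) l := by
      intro ε hε
      refine ENNReal.le_of_forall_pos_le_add fun η hη _ => ?_
      rw [← tsub_le_iff_right]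
      refine le_liminf_of_le (by isBoundedDefault) ?_
      filter_upwards [hlower _ (hthick n).1 (hthick n).2 ε hε η (by exact_mod_cast hη)] with y hy
      rwa [tsub_le_iff_right]
    have h2 : Tendsto (fun ε : ℝ => ENNReal.ofReal (1 - ε) * a) (𝓝[>] 0)
        (𝓝 (ENNReal.ofReal (1 - 0) * a)) := by
      refine ENNReal.Tendsto.mul_const ?_ (Or.inl (by simp))
      refine (ENNReal.continuous_ofReal.tendsto _).comp ?_
      exact (Continuous.tendsto (by fun_prop : Continuous fun ε : ℝ => 1 - ε) 0).mono_left
        nhdsWithin_le_nhds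
    rw [sub_zero, ENNReal.ofReal_one, one_mul] at h2
    exact le_of_tendsto h2 (by filter_upwards [self_mem_nhdsWithin] with ε hε using h1 ε hε)
  · have h1 : ∀ ε : ℝ, 0 < ε → limsup (fun y => I y Set.univ) l ≤
        ENNReal.ofReal (1 + ε) * Λ Set.univ := by
      intro ε hε
      refine ENNReal.le_of_forall_pos_le_add fun η hη _ => ?_
      obtain ⟨L, hL, -, hev⟩ := hupper ((η : ℝ≥0∞) / 2)
        (ENNReal.div_pos (by exact_mod_cast hη.ne') (by norm_num)) ε hε
      refine limsup_le_of_le (by isBoundedDefault) ?_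
      filter_upwards [hev] with y hy
      calc _ ≤ _ := hy
        _ ≤ (η : ℝ≥0∞) / 2 + (ENNReal.ofReal (1 + ε) * Λ Set.univ + η / 2) := by gcongr
        _ = ENNReal.ofReal (1 + ε) * Λ Set.univ + (η / 2 + η / 2 : ℝ≥0∞) := by ring
        _ = _ := by rw [ENNReal.add_halves]
    have h2 : Tendsto (fun ε : ℝ => ENNReal.ofReal (1 + ε) * Λ Set.univ) (𝓝[>] 0)
        (𝓝 (ENNReal.ofReal (1 + 0) * Λ Set.univ)) := by
      refine ENNReal.Tendsto.mul_const ?_ (Or.inl (by simp))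
      refine (ENNReal.continuous_ofReal.tendsto _).comp ?_
      exact (Continuous.tendsto (by fun_prop : Continuous fun ε : ℝ => 1 + ε) 0).mono_left
        nhdsWithin_le_nhds
    rw [add_zero, ENNReal.ofReal_one, one_mul] at h2
    exact ge_of_tendsto h2 (by filter_upwards [self_mem_nhdsWithin] with ε hε using h1 ε hε)

/-- Smallness near a compact set that is null for local majorants. -/
lemma exists_nhds_measure_le {I : ι → Measure X} {K : Set X} (hK : IsCompact K)
    (h : ∀ v ∈ K, ∃ U, IsOpen U ∧ v ∈ U ∧ ∃ Λ : Measure X, Λ Set.univ < ∞ ∧ Λ K = 0 ∧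
      ∀ ψ : C(X, ℝ), (∀ x, 0 ≤ ψ x) → (∀ x, ψ x ≤ 1) → (∀ x ∉ U, ψ x = 0) → ∀ δ : ℝ≥0∞, 0 < δ →
        ∀ᶠ y in l, ∫⁻ x, ENNReal.ofReal (ψ x) ∂I y ≤ ∫⁻ x, ENNReal.ofReal (ψ x) ∂Λ + δ) :
    ∀ η : ℝ≥0∞, 0 < η → ∃ O, IsOpen O ∧ K ⊆ O ∧ ∀ᶠ y in l, I y O ≤ η := by
  -- The property is stable under finite unions, so by compactness it suffices to treat small
  -- compact pieces of `K`.
  refine hK.induction_on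
    (p := fun s => ∀ η : ℝ≥0∞, 0 < η → ∃ O, IsOpen O ∧ s ⊆ O ∧ ∀ᶠ y in l, I y O ≤ η) ?_ ?_ ?_ ?_
  · exact fun η _ => ⟨∅, isOpen_empty, subset_rfl, by simp⟩
  · intro s t hst ht η hη
    obtain ⟨O, h1, h2, h3⟩ := ht η hη
    exact ⟨O, h1, hst.trans h2, h3⟩
  · intro s t hs ht η hη
    have hη2 : 0 < η / 2 := ENNReal.div_pos hη.ne' (by norm_num)
    obtain ⟨O, h1, h2, h3⟩ := hs (η / 2) hη2
    obtain ⟨O', h1', h2', h3'⟩ := ht (η / 2) hη2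
    refine ⟨O ∪ O', h1.union h1', Set.union_subset_union h2 h2', ?_⟩
    filter_upwards [h3, h3'] with y a b
    exact (measure_union_le _ _).trans ((add_le_add a b).trans (ENNReal.add_halves η).le)
  · intro v hv
    obtain ⟨U, hU, hvU, Λ, hΛ, hΛK, hψ⟩ := h v hv
    obtain ⟨r, hr, hrU⟩ := Metric.isOpen_iff.1 hU v hvU
    refine ⟨K ∩ Metric.closedBall v (r / 2), inter_mem_nhdsWithin _
      (Metric.closedBall_mem_nhds v (by positivity)), fun η hη => ?_⟩
    set C := K ∩ Metric.closedBall v (r / 2) with hCdef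
    have hC : IsCompact C := hK.inter_right Metric.isClosed_closedBall
    have hCU : C ⊆ U := Set.inter_subset_right.trans
      ((Metric.closedBall_subset_ball (by linarith)).trans hrU)
    have : IsFiniteMeasure Λ := ⟨hΛ⟩
    have hη2 : 0 < η / 2 := ENNReal.div_pos hη.ne' (by norm_num)
    -- Outer regularity of the finite majorant puts the null piece in an open set of small mass; an
    -- Urysohn function supported there transfers the smallness to `I y`.
    obtain ⟨V, hCV, hV, hVη⟩ := C.exists_isOpen_lt_of_lt (μ := Λ) (η / 2)
      (lt_of_le_of_lt (measure_mono Set.inter_subset_left) (by rw [hΛK]; exact hη2))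
    obtain ⟨δ, hδ, hδV⟩ := hC.exists_cthickening_subset_open (hV.inter hU)
      (Set.subset_inter hCV hCU)
    obtain ⟨f, hf0, hf1, hf⟩ := exists_continuous_zero_one_of_isClosed
      (hV.inter hU).isClosed_compl (Metric.isClosed_cthickening (δ := δ) (E := C))
      (Set.disjoint_left.2 fun x hx hx' => hx (hδV hx'))
    refine ⟨Metric.thickening δ C, Metric.isOpen_thickening,
      Metric.self_subset_thickening hδ C, ?_⟩
    have hfV : ∀ x ∉ V ∩ U, f x = 0 := fun x hx => hf0 hx
    filter_upwards [hψ f (fun x => (hf x).1) (fun x => (hf x).2)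
      (fun x hx => hfV x fun h => hx h.2) (η / 2) hη2] with y hy
    calc I y (Metric.thickening δ C) ≤ ∫⁻ x, ENNReal.ofReal (f x) ∂I y := by
          rw [← lintegral_indicator_one Metric.isOpen_thickening.measurableSet]
          refine lintegral_mono fun x => ?_
          by_cases hx : x ∈ Metric.thickening δ C
          · simp [hx, hf1 (Metric.thickening_subset_cthickening _ _ hx)]
          · simp [hx]
      _ ≤ ∫⁻ x, ENNReal.ofReal (f x) ∂Λ + η / 2 := hy
      _ ≤ Λ V + η / 2 := by
          gcongr
          rw [← lintegral_indicator_one hV.measurableSet]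
          refine lintegral_mono fun x => ?_
          by_cases hx : x ∈ V
          · simp [hx, (hf x).2]
          · simp [hfV x fun h => hx h.1]
      _ ≤ η / 2 + η / 2 := by gcongr
      _ = η := ENNReal.add_halves η

end LocalToGlobal

end PolarChaos
end

/-! ### Periodicity in the last angle, and the angular density on the sphere. -/

noncomputable section

namespace PolarChaos

open scoped ENNReal NNReal

section AngleShift

variable {d : ℕ}

/-- The translation of the last angle by a full turn. -/
def fullTurn (d : ℕ) : E (d - 1) :=
  WithLp.toLp 2 fun j : Fin (d - 1) => if j.val + 1 = d - 1 then 2 * Real.pi else 0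

lemma fullTurn_apply (j : Fin (d - 1)) :
    fullTurn d j = if j.val + 1 = d - 1 then 2 * Real.pi else 0 := rfl

lemma sphPoint_congr_angle {φ ψ : E (d - 1)}
    (h : ∀ j, Real.cos (φ j) = Real.cos (ψ j) ∧ Real.sin (φ j) = Real.sin (ψ j)) :
    sphPoint φ = sphPoint ψ := by
  ext i
  simp only [sphPoint, h]

lemma sphPoint_add_fullTurn (φ : E (d - 1)) : sphPoint (φ + fullTurn d) = sphPoint φ := by
  refine sphPoint_congr_angle fun j => ?_
  rw [PiLp.add_apply, fullTurn_apply]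
  split_ifs <;> simp

lemma mem_sphSing_of_sin_eq_zero (hd : 1 ≤ d) {φ : E (d - 1)} {j : Fin (d - 1)}
    (hj : j.val + 1 ≠ d - 1) (h : Real.sin (φ j) = 0) : sphPoint φ ∈ sphSing d := by
  refine ⟨by simpa using norm_sphPoint φ hd, fun i hi => ?_⟩
  rw [sphPoint_eq_tailPoint, tailPoint_apply, sinProd, if_pos (Nat.zero_le _),
    Finset.prod_eq_zero (Finset.mem_univ j), zero_mul]
  rw [if_pos ⟨Nat.zero_le _, by have := j.2; omega⟩, h]

/-- The points of the sphere where the angular coordinates are non-degenerate. -/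
lemma exists_regBox_eq (hd : 2 ≤ d) {x : E d} (hx : ‖x‖ = 1) (hxS : x ∉ sphSing d) (a : ℝ) :
    ∃ φ ∈ regBox d a, sphPoint φ = x := by
  obtain ⟨φ, hφ, rfl⟩ := exists_sphPoint_eq hd hx
  let ψ : E (d - 1) := WithLp.toLp 2 fun j : Fin (d - 1) =>
    if j.val + 1 = d - 1 then toIcoMod Real.two_pi_pos a (φ j) else φ j
  have hψ : ∀ j, ψ j = if j.val + 1 = d - 1 then toIcoMod Real.two_pi_pos a (φ j) else φ j :=
    fun j => rfl
  refine ⟨ψ, fun j => ?_, sphPoint_congr_angle fun j => ?_⟩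
  · rw [hψ]
    have h := hφ j
    split_ifs at h ⊢ with hj
    · exact toIcoMod_mem_Ico Real.two_pi_pos a (φ j)
    · have hs : Real.sin (φ j) ≠ 0 := fun h0 =>
        hxS (mem_sphSing_of_sin_eq_zero (by omega) hj h0)
      refine ⟨lt_of_le_of_ne h.1 fun hc => hs ?_, lt_of_le_of_ne h.2 fun hc => hs ?_⟩
      · rw [← hc, Real.sin_zero]
      · rw [hc, Real.sin_pi]
  · rw [hψ]
    split_ifs
    · have h := toIcoMod_add_toIcoDiv_zsmul Real.two_pi_pos a (φ j)
      rw [zsmul_eq_mul] at h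
      have h1 := Real.cos_add_int_mul_two_pi (toIcoMod Real.two_pi_pos a (φ j))
        (toIcoDiv Real.two_pi_pos a (φ j))
      have h2 := Real.sin_add_int_mul_two_pi (toIcoMod Real.two_pi_pos a (φ j))
        (toIcoDiv Real.two_pi_pos a (φ j))
      rw [h] at h1 h2
      exact ⟨h1.symm, h2.symm⟩
    · exact ⟨rfl, rfl⟩

lemma image_regBox (hd : 2 ≤ d) (a : ℝ) :
    sphPoint '' regBox d a = Metric.sphere 0 1 \ sphSing d := by
  ext x
  constructor
  · rintro ⟨φ, hφ, rfl⟩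
    exact ⟨by simpa using norm_sphPoint φ (by omega), sphPoint_notMem_sphSing_of_regBox hd hφ⟩
  · rintro ⟨hx, hxS⟩
    exact exists_regBox_eq hd (by simpa using hx) hxS a

/-- A regular point whose last angle is 0 lies on the cut of the standard box, but in the interior
of the box with last angle in `[-π, π)`. Two boxes thus suffice to put every regular point in the
interior of one. -/
lemma exists_openBox_eq (hd : 2 ≤ d) {x : E d} (hx : ‖x‖ = 1) (hxS : x ∉ sphSing d) :
    ∃ a, (a = 0 ∨ a = -Real.pi) ∧ ∃ φ ∈ openBox d a, sphPoint φ = x := by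
  have hpi := Real.pi_pos
  obtain ⟨φ, hφ, rfl⟩ := exists_regBox_eq hd hx hxS 0
  by_cases h0 : φ ⟨d - 2, by omega⟩ = 0
  · refine ⟨-Real.pi, Or.inr rfl, φ, fun j => ?_, rfl⟩
    have h := hφ j
    split_ifs at h ⊢ with hj
    · have : j = ⟨d - 2, by omega⟩ := Fin.ext (by simp; omega)
      rw [this, h0]
      constructor <;> linarith
    · exact h
  · refine ⟨0, Or.inl rfl, φ, fun j => ?_, rfl⟩
    have h := hφ j
    split_ifs at h ⊢ with hj
    · have : j = ⟨d - 2, by omega⟩ := Fin.ext (by simp; omega)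
      exact ⟨lt_of_le_of_ne h.1 fun hc => h0 (by rw [← this, ← hc]), h.2⟩
    · exact h

lemma isClosed_sphSing : IsClosed (sphSing d) := by
  have : sphSing d = Metric.sphere 0 1 ∩ ⋂ i : Fin d, {v : E d | d ≤ i.val + 2 → v i = 0} := by
    ext v; simp [sphSing]
  rw [this]
  refine Metric.isClosed_sphere.inter (isClosed_iInter fun i => ?_)
  by_cases h : d ≤ i.val + 2
  · simp only [h, forall_true_left]
    exact isClosed_eq (by fun_prop) continuous_const
  · simp [h]

/-- Integrals of periodic functions do not depend on the choice of the period interval. -/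
lemma setLIntegral_regBox (hd : 2 ≤ d) {ρ : Measure (E (d - 1))}
    (hρ : MeasurePreserving (fun φ : E (d - 1) => φ + fullTurn d) ρ ρ) {F : E (d - 1) → ℝ≥0∞}
    (hF : ∀ φ, F (φ + fullTurn d) = F φ) {a : ℝ} (ha : a = 0 ∨ a = -Real.pi) :
    ∫⁻ φ in regBox d a, F φ ∂ρ = ∫⁻ φ in regBox d 0, F φ ∂ρ := by
  have hpi := Real.pi_pos
  rcases ha with rfl | rfl
  · rfl
  let k : Fin (d - 1) := ⟨d - 2, by omega⟩
  have hk : k.val + 1 = d - 1 := by simp only [k]; omega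
  have hkj : ∀ j : Fin (d - 1), j.val + 1 = d - 1 → j = k := fun j hj => Fin.ext (by omega)
  have hm : Measurable fun φ : E (d - 1) => φ k := by fun_prop
  have hemb : MeasurableEmbedding fun φ : E (d - 1) => φ + fullTurn d :=
    (MeasurableEquiv.addRight (fullTurn d)).measurableEmbedding
  have hneg : MeasurableSet {φ : E (d - 1) | φ k < 0} := measurableSet_lt hm measurable_const
  have hpim : MeasurableSet {φ : E (d - 1) | φ k < Real.pi} := measurableSet_lt hm measurable_const
  rw [← lintegral_inter_add_sdiff F (regBox d (-Real.pi)) hneg,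
    ← lintegral_inter_add_sdiff F (regBox d 0) hpim, add_comm]
  congr 1
  · congr 2
    ext φ
    simp only [Set.mem_sdiff, Set.mem_inter_iff, Set.mem_ofPred_eq]
    constructor
    · rintro ⟨h, h1⟩
      refine ⟨fun j => ?_, ?_⟩
      · have := h j
        split_ifs at this ⊢ with hj
        · rw [hkj j hj] at this ⊢
          exact ⟨not_lt.1 h1, by linarith⟩
        · exact this
      · have := h k
        rw [if_pos hk] at this
        linarith
    · rintro ⟨h, h1⟩
      refine ⟨fun j => ?_, ?_⟩
      · have := h j
        split_ifs at this ⊢ with hj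
        · rw [hkj j hj] at this ⊢
          exact ⟨by linarith, by linarith⟩
        · exact this
      · have := h k
        rw [if_pos hk] at this
        exact not_lt.2 this.1
  -- A full turn carries the last angles in `[-π, 0)` onto those in `[π, 2π)`; the remaining parts
  -- of the two boxes coincide.
  · have hpre : regBox d (-Real.pi) ∩ {φ | φ k < 0} =
        (fun φ : E (d - 1) => φ + fullTurn d) ⁻¹' (regBox d 0 \ {φ | φ k < Real.pi}) := by
      ext φ
      simp only [Set.mem_sdiff, Set.mem_inter_iff, Set.mem_ofPred_eq, Set.mem_preimage]
      have e : ∀ j : Fin (d - 1), (φ + fullTurn d) j =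
          φ j + if j.val + 1 = d - 1 then 2 * Real.pi else 0 := fun j => rfl
      constructor
      · rintro ⟨h, h1⟩
        refine ⟨fun j => ?_, ?_⟩
        · have := h j
          rw [e]
          split_ifs at this ⊢ with hj
          · rw [hkj j hj] at this ⊢
            exact ⟨by linarith, by linarith⟩
          · simpa using this
        · have := h k
          rw [if_pos hk] at this
          rw [e, if_pos hk]
          linarith
      · rintro ⟨h, h1⟩
        have h2 := h k
        rw [e, if_pos hk, if_pos hk] at h2
        rw [e, if_pos hk] at h1
        refine ⟨fun j => ?_, by linarith⟩
        have := h j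
        rw [e] at this
        split_ifs at this ⊢ with hj
        · rw [hkj j hj]
          exact ⟨by linarith, by linarith⟩
        · simpa using this
    have h := hρ.setLIntegral_comp_preimage_emb hemb F (regBox d 0 \ {φ | φ k < Real.pi})
    simp only [hF] at h
    rw [hpre, h]

lemma measurePreserving_add_volume (c : E (d - 1)) :
    MeasurePreserving (fun φ : E (d - 1) => φ + c) volume volume :=
  measurePreserving_add_right volume c

lemma measurePreserving_add_euclideanHausdorff (m : ℕ) (c : E (d - 1)) :
    MeasurePreserving (fun φ : E (d - 1) => φ + c) (μHE[m]) (μHE[m]) :=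
  (IsometryEquiv.addRight c).measurePreserving_euclideanHausdorffMeasure m

lemma hessian_comp_add {n : ℕ} (F : E n → ℝ) (c x : E n) :
    hessian (fun y => F (y + c)) x = hessian F (x + c) := by
  ext i j
  simp only [hessian, Matrix.of_apply]
  simp only [fderiv_comp_add_right]
  exact congrArg (fun L : E n →L[ℝ] ℝ => L (EuclideanSpace.single i 1))
    (fderiv_comp_add_right (f := fun y => fderiv ℝ F y (EuclideanSpace.single j 1)) c)

end AngleShift

section Density

variable {d : ℕ} {p : E (d - 1) → ℝ}

open Classical in
/-- The density of the angles as a function on the sphere. -/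
def sphDensity (p : E (d - 1) → ℝ) (v : E d) : ℝ :=
  if v ∈ sphPoint '' regBox d 0 then p (Function.invFunOn sphPoint (regBox d 0) v) else 0

lemma sphDensity_sphPoint {φ : E (d - 1)} (hφ : φ ∈ regBox d 0) :
    sphDensity p (sphPoint φ) = p φ := by
  have h : sphPoint φ ∈ sphPoint '' regBox d 0 := ⟨φ, hφ, rfl⟩
  rw [sphDensity, if_pos h]
  congr 1
  exact injOn_sphPoint_regBox 0 (Function.invFunOn_mem h) hφ (Function.invFunOn_eq h)

lemma exists_regBox_sphDensity {v : E d} (hv : v ∈ sphPoint '' regBox d 0) :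
    ∃ φ ∈ regBox d 0, sphPoint φ = v ∧ sphDensity p v = p φ := by
  obtain ⟨φ, hφ, rfl⟩ := hv
  exact ⟨φ, hφ, rfl, sphDensity_sphPoint hφ⟩

lemma sphDensity_of_notMem {v : E d} (hv : v ∉ sphPoint '' regBox d 0) : sphDensity p v = 0 := by
  rw [sphDensity, if_neg hv]

lemma sphDensity_pos (hp : ∀ φ ∈ regAngles d, 0 < p φ) {v : E d}
    (hv : v ∈ sphPoint '' regBox d 0) : 0 < sphDensity p v := by
  obtain ⟨φ, hφ, -, h⟩ := exists_regBox_sphDensity (p := p) hv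
  rw [h]
  exact hp φ (by rwa [regAngles_eq_regBox])

lemma sphDensity_nonneg (hp : ∀ φ ∈ regAngles d, 0 < p φ) (v : E d) : 0 ≤ sphDensity p v := by
  by_cases h : v ∈ sphPoint '' regBox d 0
  · exact (sphDensity_pos hp h).le
  · rw [sphDensity_of_notMem h]

lemma sphDensity_le {C : ℝ} (hC : 0 ≤ C) (hp : ∀ φ ∈ regAngles d, p φ ≤ C) (v : E d) :
    sphDensity p v ≤ C := by
  by_cases h : v ∈ sphPoint '' regBox d 0
  · obtain ⟨φ, hφ, -, h⟩ := exists_regBox_sphDensity (p := p) h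
    rw [h]
    exact hp φ (by rwa [regAngles_eq_regBox])
  · rwa [sphDensity_of_notMem h]

/-- Continuity for the topology induced by the coordinates is continuity on the image, once the
coordinates are injective on the box. -/
lemma continuousOn_sphDensity (hp : AngularContinuous p) :
    ContinuousOn (sphDensity p) (sphPoint '' regBox d 0) := by
  rintro _ ⟨φ, hφ, rfl⟩
  have hφ' : φ ∈ regAngles d := by rwa [regAngles_eq_regBox]
  have h1 := hp φ hφ'
  unfold ContinuousWithinAt at h1 ⊢
  rw [sphDensity_sphPoint hφ]
  rw [Filter.tendsto_def] at h1 ⊢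
  intro N hN
  have h2 := h1 N hN
  rw [@mem_nhdsWithin_iff_exists_mem_nhds_inter, nhds_induced] at h2
  obtain ⟨u, ⟨V, hV, hVu⟩, hu⟩ := h2
  rw [mem_nhdsWithin_iff_exists_mem_nhds_inter]
  refine ⟨V, hV, ?_⟩
  rintro _ ⟨hx, ψ, hψ, rfl⟩
  rw [Set.mem_preimage, sphDensity_sphPoint hψ]
  exact hu ⟨hVu hx, by rwa [regAngles_eq_regBox]⟩

lemma measurable_sphDensity (hd : 2 ≤ d) (hp : AngularContinuous p) :
    Measurable (sphDensity p) := by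
  classical
  have hm : MeasurableSet (sphPoint '' regBox d 0 : Set (E d)) := by
    rw [image_regBox hd]
    exact Metric.isClosed_sphere.measurableSet.diff isClosed_sphSing.measurableSet
  have := (continuousOn_sphDensity hp).measurable_piecewise
    (continuousOn_const (c := (0 : ℝ)) (s := (sphPoint '' regBox d 0)ᶜ)) hm
  convert this using 1
  ext v
  by_cases h : v ∈ sphPoint '' regBox d 0
  · rw [Set.piecewise_eq_of_mem _ _ _ h]
  · rw [Set.piecewise_eq_of_notMem _ _ _ h, sphDensity_of_notMem h]

/-- Read through the sphere, the density is continuous in the angles of every box, in particular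
across the cut of the standard one. -/
lemma continuousOn_sphDensity_comp (hd : 2 ≤ d) (hp : AngularContinuous p) (a : ℝ) :
    ContinuousOn (fun φ : E (d - 1) => sphDensity p (sphPoint φ)) (regBox d a) :=
  (continuousOn_sphDensity hp).comp continuous_sphPoint.continuousOn fun φ hφ => by
    rw [image_regBox hd, ← image_regBox hd a]
    exact ⟨φ, hφ, rfl⟩

/-- The degenerate part of the box lies in the hyperplanes where some angle is 0. -/
lemma volume_angleBox_diff : volume (angleBox d \ regBox d 0) = 0 := by
  have hsub : angleBox d \ regBox d 0 ⊆ ⋃ j : Fin (d - 1), {φ : E (d - 1) | φ j = 0} := by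
    rintro φ ⟨h1, h2⟩
    by_contra hn
    simp only [Set.mem_iUnion, not_exists] at hn
    refine h2 fun j => ?_
    have := h1 j
    split_ifs at this ⊢ with hj
    · simpa using this
    · exact ⟨lt_of_le_of_ne this.1 fun h => hn j h.symm, this.2⟩
  refine measure_mono_null hsub ((measure_iUnion_null_iff).2 fun j => ?_)
  have : {φ : E (d - 1) | φ j = 0} =
      (LinearMap.ker (EuclideanSpace.proj j : E (d - 1) →L[ℝ] ℝ).toLinearMap : Set (E (d - 1))) := by
    ext φ; simp
  rw [this]
  refine Measure.addHaar_submodule _ _ fun htop => ?_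
  have h1 : EuclideanSpace.single j (1 : ℝ) ∈
      LinearMap.ker (EuclideanSpace.proj j : E (d - 1) →L[ℝ] ℝ).toLinearMap := by
    rw [htop]; trivial
  simp at h1

/-- Integrals with respect to the law of the direction. -/
lemma lintegral_direction (hd : 2 ≤ d) {Ω : Type*} [MeasurableSpace Ω] {μ : Measure Ω}
    {ν : Ω → E (d - 1)} (hν : Measurable ν)
    (hlaw : μ.map ν = (volume.restrict (angleBox d)).withDensity fun φ => ENNReal.ofReal (p φ))
    (hp : AngularContinuous p) {h : E d → ℝ≥0∞} (hh : Measurable h) :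
    ∫⁻ x, h x ∂(μ.map fun ω => sphPoint (ν ω)) =
      ∫⁻ φ in regBox d 0, ENNReal.ofReal (sphDensity p (sphPoint φ)) * h (sphPoint φ) := by
  have hΦ : Measurable (sphPoint : E (d - 1) → E d) := continuous_sphPoint.measurable
  have hae : (volume.restrict (angleBox d) : Measure (E (d - 1))) = volume.restrict (regBox d 0) := by
    refine Measure.restrict_congr_set ?_
    have hsub : regBox d 0 ⊆ angleBox d := by
      rw [← regAngles_eq_regBox]; exact fun φ h => h.1
    exact ae_eq_set.2 ⟨volume_angleBox_diff, by rw [sdiff_eq_bot_iff.2 hsub]; exact measure_empty⟩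
  have hden : (fun φ => ENNReal.ofReal (p φ)) =ᵐ[volume.restrict (regBox d 0)]
      fun φ => ENNReal.ofReal (sphDensity p (sphPoint φ)) :=
    (ae_restrict_iff' (measurableSet_regBox 0)).2 (Eventually.of_forall fun φ hφ => by
      simp only [sphDensity_sphPoint hφ])
  have hmap : (μ.map fun ω => sphPoint (ν ω)) = (μ.map ν).map sphPoint := by
    rw [Measure.map_map hΦ hν]; rfl
  rw [hmap, lintegral_map hh hΦ, hlaw, hae, withDensity_congr_ae hden]
  exact lintegral_withDensity_eq_lintegral_mul _
    (((measurable_sphDensity hd hp).comp hΦ).ennreal_ofReal) (hh.comp hΦ)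

end Density

end PolarChaos
end

/-! ### The orthographic chart and domination of the law near degenerate angles. -/

noncomputable section

namespace PolarChaos

open scoped ENNReal NNReal

section OrthoChart

variable {d : ℕ} {v : E d} {u : Fin (d - 1) → E d}

/-- The inverse of the orthogonal projection from the half sphere around `v` to the tangent
plane. -/
def orthoChart (v : E d) (u : Fin (d - 1) → E d) (t : E (d - 1)) : E d :=
  √(1 - ‖t‖ ^ 2) • v + frameMap u t

lemma orthoChart_zero : orthoChart v u 0 = v := by simp [orthoChart]

lemma measurable_orthoChart : Measurable (orthoChart v u) := by
  unfold orthoChart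
  have : Continuous fun t : E (d - 1) => √(1 - ‖t‖ ^ 2) • v + frameMap u t := by fun_prop
  exact this.measurable

namespace IsTangentFrame

variable (h : IsTangentFrame v u)
include h

lemma frameProj_orthoChart (t : E (d - 1)) : frameProj u (orthoChart v u t) = t := by
  rw [orthoChart, map_add, map_smul, h.frameProj_self, smul_zero, zero_add,
    frameProj_frameMap h.orthonormal]

lemma inner_orthoChart (t : E (d - 1)) : inner ℝ v (orthoChart v u t) = √(1 - ‖t‖ ^ 2) := by
  rw [orthoChart, inner_add_right, h.inner_frameMap, inner_smul_right,
    real_inner_self_eq_norm_sq, h.norm_eq]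
  simp

lemma norm_orthoChart {t : E (d - 1)} (ht : ‖t‖ ≤ 1) : ‖orthoChart v u t‖ = 1 := by
  have h1 := h.norm_sq (orthoChart v u t)
  have h2 : ‖t‖ ^ 2 ≤ 1 := by nlinarith [norm_nonneg t]
  rw [h.inner_orthoChart, h.frameProj_orthoChart, Real.sq_sqrt (by linarith), sub_add_cancel] at h1
  exact (pow_eq_one_iff_of_nonneg (norm_nonneg _) two_ne_zero).1 (by linarith)

lemma orthoChart_frameProj {x : E d} (hx : ‖x‖ = 1) (hx0 : 0 ≤ inner ℝ v x) :
    orthoChart v u (frameProj u x) = x := by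
  have h1 := h.norm_sq x
  rw [hx] at h1
  conv_rhs => rw [h.eq_add x]
  rw [orthoChart, show 1 - ‖frameProj u x‖ ^ 2 = inner ℝ v x ^ 2 by linarith, Real.sqrt_sq hx0]

lemma isSphereChart : IsSphereChart (orthoChart v u) 0 := by
  have hsm : ContDiffAt ℝ 2 (orthoChart v u) 0 := by
    unfold orthoChart
    have h1 : ContDiffAt ℝ 2 (fun t : E (d - 1) => √(1 - ‖t‖ ^ 2)) 0 := by
      refine ContDiffAt.sqrt ?_ (by simp)
      exact contDiffAt_const.sub (contDiff_norm_sq ℝ).contDiffAt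
    exact (h1.smul contDiffAt_const).add (frameMap u).contDiff.contDiffAt
  refine ⟨hsm, ?_, ?_⟩
  · filter_upwards [Metric.ball_mem_nhds (0 : E (d - 1)) one_pos] with t ht
    exact h.norm_orthoChart (by simpa using (mem_ball_zero_iff.1 ht).le)
  · have h1 : HasFDerivAt (fun t => frameProj u (orthoChart v u t))
        ((frameProj u).comp (fderiv ℝ (orthoChart v u) 0)) 0 :=
      (frameProj u).hasFDerivAt.comp 0 (hsm.differentiableAt (by norm_num)).hasFDerivAt
    simp only [h.frameProj_orthoChart] at h1
    have h2 := h1.unique (hasFDerivAt_id (0 : E (d - 1)))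
    intro a b hab
    have ha := congrArg (fun L : E (d - 1) →L[ℝ] E (d - 1) => L a) h2
    have hb := congrArg (fun L : E (d - 1) →L[ℝ] E (d - 1) => L b) h2
    simp only [ContinuousLinearMap.comp_apply, ContinuousLinearMap.id_apply] at ha hb
    rw [← ha, ← hb, hab]

end IsTangentFrame

/-- The image of the unit ball contains the ball of radius `c`; comparing volumes gives the bound.
-/
lemma pow_le_abs_det {n : ℕ} (N : E n →L[ℝ] E n) {c : ℝ} (hc : 0 < c)
    (h : ∀ t, c * ‖t‖ ≤ ‖N t‖) : c ^ n ≤ |N.det| := by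
  have hinj : Function.Injective N := by
    rw [injective_iff_map_eq_zero]
    intro t ht
    have := h t
    rw [ht, norm_zero] at this
    exact norm_eq_zero.1 (le_antisymm (by nlinarith [norm_nonneg t]) (norm_nonneg t))
  have hsurj : Function.Surjective N := LinearMap.surjective_of_injective
    (f := (N : E n →ₗ[ℝ] E n)) hinj
  have hsub : Metric.ball (0 : E n) c ⊆ N '' Metric.ball 0 1 := by
    intro y hy
    obtain ⟨t, rfl⟩ := hsurj y
    refine ⟨t, ?_, rfl⟩
    rw [mem_ball_zero_iff] at hy ⊢
    have := h t
    by_contra hn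
    push Not at hn
    nlinarith
  have h1 := measure_mono (μ := (volume : Measure (E n))) hsub
  rw [Measure.addHaar_ball_of_pos _ _ hc, Measure.addHaar_image_continuousLinearMap, finrank_euclideanSpace,
    Fintype.card_fin] at h1
  have h2 := (ENNReal.mul_le_mul_iff_left (Metric.measure_ball_pos volume (0 : E n) one_pos).ne'
    Metric.isBounded_ball.measure_lt_top.ne).1 h1
  exact (ENNReal.ofReal_le_ofReal_iff (abs_nonneg _)).1 h2

/-- The derivative of the projected coordinates is the diagonal map of sine products, of determinant
`sphJac φ`, followed by the projection of the frame at `φ`. Frame vectors are orthogonal to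
`sphPoint φ`, which is within `1 / 2` of `v`, so projecting them along `v` shrinks lengths by at
most a factor 2. -/
lemma IsTangentFrame.abs_sphJac_le (h : IsTangentFrame v u) {φ : E (d - 1)}
    (hφ : ‖v - sphPoint φ‖ ≤ 1 / 2) :
    |sphJac φ| ≤ 2 ^ (d - 1) * |((frameProj u).comp (frameDeriv φ 0)).det| := by
  have hd := dim_pos_of_norm h.norm_eq
  have hf := isTangentFrame_frame hd φ
  set N : E (d - 1) →L[ℝ] E (d - 1) := (frameProj u).comp (frameMap (frame φ)) with hN
  set D : E (d - 1) →ₗ[ℝ] E (d - 1) :=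
    Matrix.toEuclideanLin (Matrix.diagonal fun j : Fin (d - 1) => sinProd φ 0 j) with hD
  have hcomp : ((frameProj u).comp (frameDeriv φ 0) : E (d - 1) →ₗ[ℝ] E (d - 1)) =
      (N : E (d - 1) →ₗ[ℝ] E (d - 1)) ∘ₗ D := by
    ext t : 1
    have : frameDeriv φ 0 t = frameMap (frame φ) (D t) := by
      rw [frameDeriv_apply, frameMap_apply]
      refine Finset.sum_congr rfl fun j _ => ?_
      congr 1
      simp [hD, Matrix.toLpLin_apply, Matrix.mulVec_diagonal]
    simp [hN, this]
  have hDdet : LinearMap.det D = sphJac φ := by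
    rw [hD, Matrix.toEuclideanLin_eq_toLin_orthonormal, LinearMap.det_toLin, Matrix.det_diagonal,
      prod_sinProd]
  have hdet : ((frameProj u).comp (frameDeriv φ 0)).det = N.det * sphJac φ := by
    rw [ContinuousLinearMap.det, hcomp, LinearMap.det_comp, hDdet]
  have hlow : ∀ t, 1 / 2 * ‖t‖ ≤ ‖N t‖ := by
    intro t
    have h1 := h.norm_sq (frameMap (frame φ) t)
    rw [hf.norm_frameMap] at h1
    have h2 : |inner ℝ v (frameMap (frame φ) t)| ≤ 1 / 2 * ‖t‖ := by
      have : inner ℝ v (frameMap (frame φ) t) =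
          inner ℝ (v - sphPoint φ) (frameMap (frame φ) t) := by
        rw [inner_sub_left, hf.inner_frameMap, sub_zero]
      rw [this]
      refine (abs_real_inner_le_norm _ _).trans ?_
      rw [hf.norm_frameMap]
      gcongr
    have h3 : inner ℝ v (frameMap (frame φ) t) ^ 2 ≤ (1 / 2 * ‖t‖) ^ 2 := sq_le_sq' 
      (by linarith [neg_abs_le (inner ℝ v (frameMap (frame φ) t))]) ((le_abs_self _).trans h2)
    have h4 : (1 / 2 * ‖t‖) ^ 2 ≤ ‖N t‖ ^ 2 := by
      have : ‖N t‖ = ‖frameProj u (frameMap (frame φ) t)‖ := rfl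
      rw [this]
      nlinarith [sq_nonneg ‖t‖]
    exact (sq_le_sq₀ (by positivity) (norm_nonneg _)).1 h4
  have h5 := pow_le_abs_det N (by norm_num) hlow
  rw [hdet, abs_mul, ← mul_assoc]
  refine le_mul_of_one_le_left (abs_nonneg _) ?_
  calc (1 : ℝ) = 2 ^ (d - 1) * (1 / 2) ^ (d - 1) := by rw [← mul_pow]; norm_num
    _ ≤ _ := by gcongr

/-- Near a point where the density in angular coordinates is comparable to the Jacobian, the law
of the direction is dominated by the Lebesgue measure in the orthographic chart. -/
lemma exists_lintegral_le_orthoChart (hd : 2 ≤ d) (h : IsTangentFrame v u) {p : E (d - 1) → ℝ}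
    (hp_pos : ∀ φ ∈ regAngles d, 0 < p φ) {l : ℝ}
    (hl : Tendsto (fun φ => p φ / |sphJac φ|) (comap sphPoint (𝓝 v) ⊓ 𝓟 (regAngles d)) (𝓝 l)) :
    ∃ C : ℝ≥0∞, C ≠ ∞ ∧ ∃ r > 0, ∀ f : E d → ℝ≥0∞, (∀ x ∉ Metric.ball v r, f x = 0) →
      ∫⁻ φ in regBox d 0, ENNReal.ofReal (sphDensity p (sphPoint φ)) * f (sphPoint φ) ≤
        C * ∫⁻ t, f (orthoChart v u t) := by
  have h1 : ∀ᶠ φ in comap sphPoint (𝓝 v) ⊓ 𝓟 (regAngles d), p φ / |sphJac φ| < l + 1 :=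
    hl.eventually (gt_mem_nhds (by linarith))
  rw [eventually_inf_principal, eventually_comap] at h1
  obtain ⟨r, hr, hr1⟩ := Metric.eventually_nhds_iff_ball.1 h1
  refine ⟨ENNReal.ofReal ((l + 1) * 2 ^ (d - 1)), ENNReal.ofReal_ne_top, min r (1 / 2),
    by positivity, fun f hf => ?_⟩
  -- Radius at most `1 / 2` keeps the points in the hemisphere around `v`, where the projection is
  -- injective, and also gives the Jacobian comparison.
  set s := regBox d 0 ∩ sphPoint ⁻¹' Metric.ball v (min r (1 / 2)) with hs
  have hsm : MeasurableSet s := (measurableSet_regBox 0).inter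
    (continuous_sphPoint.measurable Metric.isOpen_ball.measurableSet)
  have hinner : ∀ φ ∈ s, 0 < inner ℝ v (sphPoint φ) := by
    intro φ hφ
    have h2 : ‖sphPoint φ - v‖ < 1 / 2 :=
      (mem_ball_iff_norm.1 hφ.2).trans_le (min_le_right _ _)
    have h3 := norm_sub_sq_real (sphPoint φ) v
    rw [norm_sphPoint φ (by omega), h.norm_eq, real_inner_comm] at h3
    nlinarith [norm_nonneg (sphPoint φ - v)]
  have hinj : Set.InjOn (fun φ => frameProj u (sphPoint φ)) s := by
    intro φ hφ ψ hψ hφψ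
    exact injOn_sphPoint_regBox 0 hφ.1 hψ.1 (h.eq_of_frameProj_eq (norm_sphPoint φ (by omega))
      (norm_sphPoint ψ (by omega)) (hinner φ hφ) (hinner ψ hψ) hφψ)
  have hderiv : ∀ φ ∈ s, HasFDerivWithinAt (fun φ => frameProj u (sphPoint φ))
      ((frameProj u).comp (frameDeriv φ 0)) s φ := fun φ _ =>
    ((frameProj u).hasFDerivAt.comp φ (hasFDerivAt_sphPoint φ (by omega))).hasFDerivWithinAt
  calc ∫⁻ φ in regBox d 0, ENNReal.ofReal (sphDensity p (sphPoint φ)) * f (sphPoint φ)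
      = ∫⁻ φ in s, ENNReal.ofReal (sphDensity p (sphPoint φ)) * f (sphPoint φ) := by
        rw [← lintegral_inter_add_sdiff _ (regBox d 0)
          (continuous_sphPoint.measurable (Metric.isOpen_ball (x := v) (ε := min r (1 / 2))).measurableSet)]
        rw [setLIntegral_eq_zero ((measurableSet_regBox 0).diff (continuous_sphPoint.measurable
          (Metric.isOpen_ball (x := v) (ε := min r (1 / 2))).measurableSet)) (fun φ hφ => ?_), add_zero]
        rw [hf _ hφ.2, mul_zero]; rfl
    _ ≤ ∫⁻ φ in s, ENNReal.ofReal ((l + 1) * 2 ^ (d - 1)) *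
          (ENNReal.ofReal |((frameProj u).comp (frameDeriv φ 0)).det| *
            f (orthoChart v u (frameProj u (sphPoint φ)))) := by
        refine setLIntegral_mono' hsm fun φ hφ => ?_
        rw [h.orthoChart_frameProj (norm_sphPoint φ (by omega)) (hinner φ hφ).le, ← mul_assoc]
        gcongr
        have hreg : φ ∈ regAngles d := by rw [regAngles_eq_regBox]; exact hφ.1
        have hJ : 0 < |sphJac φ| := abs_pos.2 hreg.2
        have h2 := hr1 (sphPoint φ) (Metric.ball_subset_ball (min_le_left _ _) hφ.2) φ rfl hreg
        have h3 : 0 < l + 1 := (div_pos (hp_pos φ hreg) hJ).trans h2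
        rw [div_lt_iff₀ hJ] at h2
        -- The density is at most `(l + 1) * |sphJac φ|`. The vanishing Jacobian is thus traded for
        -- the determinant of the projected coordinates, which the change of variables absorbs.
        have h4 := h.abs_sphJac_le (φ := φ) (by
          rw [norm_sub_rev]
          exact ((mem_ball_iff_norm.1 hφ.2).trans_le (min_le_right _ _)).le)
        rw [← ENNReal.ofReal_mul (by positivity), sphDensity_sphPoint hφ.1]
        refine ENNReal.ofReal_le_ofReal ?_
        calc p φ ≤ (l + 1) * |sphJac φ| := h2.le
          _ ≤ (l + 1) * (2 ^ (d - 1) * |((frameProj u).comp (frameDeriv φ 0)).det|) := by gcongr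
          _ = _ := by ring
    _ = ENNReal.ofReal ((l + 1) * 2 ^ (d - 1)) *
          ∫⁻ t in (fun φ => frameProj u (sphPoint φ)) '' s, f (orthoChart v u t) := by
        rw [lintegral_const_mul' _ _ ENNReal.ofReal_ne_top,
          lintegral_image_eq_lintegral_abs_det_fderiv_mul volume hsm hderiv hinj]
    _ ≤ _ := by gcongr; exact Measure.restrict_le_self

end OrthoChart

end PolarChaos
end

/-! ### The limit measure and the rescaled tail measures on the sphere. -/

noncomputable section

namespace PolarChaos

open scoped ENNReal NNReal

section Global

variable {d m : ℕ} {α : ℝ} {g : E d → ℝ} {p : E (d - 1) → ℝ}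

/-- A density of the angles, positive, bounded and continuous off the degenerate angles, and
compatible with the sphere at the points of the maximum set where the angles degenerate. -/
structure IsAngularDensity (m : ℕ) (g : E d → ℝ) (p : E (d - 1) → ℝ) : Prop where
  pos : ∀ φ ∈ regAngles d, 0 < p φ
  bdd : ∃ C : ℝ, ∀ φ ∈ regAngles d, p φ ≤ C
  cont : AngularContinuous p
  sing_null : (μHE[m] : Measure (E d)) (maxSet g ∩ sphSing d) = 0
  sing_dens : ∀ v ∈ maxSet g ∩ sphSing d, ∃ l : ℝ, 0 < l ∧
    Tendsto (fun φ => p φ / |sphJac φ|) (comap sphPoint (𝓝 v) ⊓ 𝓟 (regAngles d)) (𝓝 l)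

lemma IsAngularDensity.nonneg_bdd (hp : IsAngularDensity m g p) :
    ∃ C : ℝ, 0 ≤ C ∧ ∀ v, sphDensity p v ≤ C := by
  obtain ⟨C, hC⟩ := hp.bdd
  exact ⟨max C 0, le_max_right _ _, sphDensity_le (le_max_right _ _) fun φ hφ =>
    (hC φ hφ).trans (le_max_left _ _)⟩

/-- In the frame the derivative is diagonal, with entries the sine products; these involve only the
sines of the angles before the last, which are positive in the box. -/
lemma isSphereChart_sphPoint (hd : 2 ≤ d) {a : ℝ} {φ : E (d - 1)} (hφ : φ ∈ regBox d a) :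
    IsSphereChart sphPoint φ := by
  refine ⟨contDiff_sphPoint.contDiffAt, Eventually.of_forall fun ψ => norm_sphPoint ψ (by omega), ?_⟩
  rw [(hasFDerivAt_sphPoint φ (by omega)).fderiv]
  have hf := isTangentFrame_frame (by omega : 1 ≤ d) φ
  rw [injective_iff_map_eq_zero]
  intro t ht
  have h1 : frameDeriv φ 0 t = frameMap (frame φ) (WithLp.toLp 2 fun j => sinProd φ 0 j * t j) := by
    rw [frameDeriv_apply, frameMap_apply]
  have h2 := congrArg (frameProj (frame φ)) ht
  rw [h1, frameProj_frameMap hf.orthonormal, map_zero] at h2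
  ext j
  have h3 : sinProd φ 0 j * t j = 0 := congrArg (fun z : E (d - 1) => z j) h2
  refine (mul_eq_zero.1 h3).resolve_left (sinProd_ne_zero (fun i hi => ?_) (by have := j.2; omega))
  have := hφ i
  rw [if_neg hi] at this
  exact (Real.sin_pos_of_pos_of_lt_pi this.1 this.2).ne'

lemma chartWeight_add_fullTurn (φ : E (d - 1)) :
    chartWeight g m sphPoint (φ + fullTurn d) = chartWeight g m sphPoint φ := by
  have h := hessian_comp_add (fun ψ : E (d - 1) => g (sphPoint ψ)) (fullTurn d) φ
  simp only [sphPoint_add_fullTurn] at h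
  rw [chartWeight, chartWeight, h]

/-- A continuous version of the chart weight in spherical coordinates. -/
def coeffWeight (g : E d → ℝ) (m : ℕ) (φ : E (d - 1)) : ℝ :=
  (2 * Real.pi * maxVal g) ^ (((d - 1 - m : ℕ) : ℝ) / 2) /
    √|(hessian (fun y => maxVal g - g (sphPoint y)) φ).charpoly.coeff (d - 1 - (d - 1 - m))|

/-- The limiting measure on the sphere. -/
def limitMeasure (g : E d → ℝ) (m : ℕ) (p : E (d - 1) → ℝ) : Measure (E d) :=
  (((μHE[m] : Measure (E (d - 1))).restrict
    (regBox d 0 ∩ sphPoint ⁻¹' maxSet g)).withDensity fun φ =>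
      ENNReal.ofReal (sphDensity p (sphPoint φ)) * ENNReal.ofReal (coeffWeight g m φ)).map sphPoint

/-- The rescaled tail measure of the direction. -/
def tailMeasure (g : E d → ℝ) (m : ℕ) (Q : Measure (E d)) (A : ℝ) (f : ℝ → ℝ) : Measure (E d) :=
  ENNReal.ofReal (A ^ (((d - 1 - m : ℕ) : ℝ) / 2)) •
    Q.withDensity fun x => ENNReal.ofReal (polarKernel g A f x)

variable (hg : IsNondegenerateMax m α g)
include hg

lemma IsNondegenerateMax.measurable : Measurable g :=
  measurable_of_continuousOn_compl_singleton 0 hg.smooth.continuousOn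

lemma measurable_polarKernel {A : ℝ} {f : ℝ → ℝ} (hf : Measurable f) :
    Measurable (polarKernel g A f) := by
  have := hg.measurable
  unfold polarKernel
  exact Measurable.ite (measurableSet_lt measurable_const this)
    (hf.comp (((measurable_const.div this).sub_const 1).const_mul A)) measurable_const

lemma contDiff_comp_sphPoint : ContDiff ℝ 2 fun φ : E (d - 1) => maxVal g - g (sphPoint φ) := by
  have hd := hg.dim
  rw [contDiff_iff_contDiffAt]
  intro φ
  refine contDiffAt_const.sub (ContDiffAt.comp φ (hg.contDiffAt ?_) contDiff_sphPoint.contDiffAt)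
  intro h0
  have := norm_sphPoint φ (by omega)
  rw [h0] at this
  simp at this

lemma measurable_coeffWeight : Measurable (coeffWeight g m) := by
  have hc := contDiff_comp_sphPoint hg
  have h1 : Continuous (hessian fun φ : E (d - 1) => maxVal g - g (sphPoint φ)) := by
    refine continuous_pi fun i => continuous_pi fun j => ?_
    have h2 : Continuous (fderiv ℝ (fderiv ℝ fun φ : E (d - 1) => maxVal g - g (sphPoint φ))) :=
      ((hc.fderiv_right (m := 1) (by norm_num)).continuous_fderiv (by norm_num))
    have h3 : Continuous fun x => fderiv ℝ (fderiv ℝ fun φ : E (d - 1) => maxVal g - g (sphPoint φ)) x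
        (EuclideanSpace.single i 1) (EuclideanSpace.single j 1) :=
      (h2.clm_apply continuous_const).clm_apply continuous_const
    convert h3 using 2 with x
    rw [hessian_apply hc.contDiffAt]
  have h2 : Continuous fun φ => √|(hessian (fun y : E (d - 1) => maxVal g - g (sphPoint y))
      φ).charpoly.coeff (d - 1 - (d - 1 - m))| :=
    Real.continuous_sqrt.comp (continuous_abs.comp ((continuous_charpoly_coeff _).comp h1))
  exact measurable_const.div h2.measurable

/-- The two weights agree at maximum points with regular angles, which is all the limit measure
sees. The coefficient version is measurable everywhere, so it serves in the definition. -/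
lemma coeffWeight_eq {a : ℝ} {φ : E (d - 1)} (hφ : φ ∈ regBox d a) (hM : sphPoint φ ∈ maxSet g) :
    coeffWeight g m φ = chartWeight g m sphPoint φ := by
  have hd := hg.dim
  have hc := isSphereChart_sphPoint (by omega) hφ
  rw [coeffWeight, chartWeight, ← hc.abs_pseudoDet_eq hg, hc.abs_pseudoDet_eq_coeff hg hM]

lemma measurableSet_maxSet : MeasurableSet (maxSet g) := hg.isClosed_maxSet.measurableSet

/-- Density and weight are periodic in the last angle and translations preserve Hausdorff measure,
so the integral may be taken over whichever box has the point of interest in its interior. -/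
lemma lintegral_limitMeasure (hp : IsAngularDensity m g p) {h : E d → ℝ≥0∞} (hh : Measurable h)
    {a : ℝ} (ha : a = 0 ∨ a = -Real.pi) :
    ∫⁻ x, h x ∂limitMeasure g m p = ∫⁻ φ in regBox d a, ENNReal.ofReal (sphDensity p (sphPoint φ)) *
      (ENNReal.ofReal (chartWeight g m sphPoint φ) * (maxSet g).indicator h (sphPoint φ)) ∂μHE[m] := by
  have hd := hg.dim
  have hΦ : Measurable (sphPoint : E (d - 1) → E d) := continuous_sphPoint.measurable
  have hMm := measurableSet_maxSet hg
  have hw : Measurable fun φ : E (d - 1) => ENNReal.ofReal (sphDensity p (sphPoint φ)) *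
      ENNReal.ofReal (coeffWeight g m φ) :=
    ((measurable_sphDensity (by omega) hp.cont).comp hΦ).ennreal_ofReal.mul
      (measurable_coeffWeight hg).ennreal_ofReal
  rw [setLIntegral_regBox (by omega) (measurePreserving_add_euclideanHausdorff m _) (fun φ => by
    rw [sphPoint_add_fullTurn, chartWeight_add_fullTurn]) ha, limitMeasure, lintegral_map hh hΦ]
  refine (lintegral_withDensity_eq_lintegral_mul _ hw (hh.comp hΦ)).trans ?_
  rw [← lintegral_indicator ((measurableSet_regBox 0).inter (hΦ hMm)),
    ← lintegral_indicator (measurableSet_regBox 0)]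
  refine lintegral_congr fun φ => ?_
  by_cases h1 : φ ∈ regBox d 0
  · by_cases h2 : sphPoint φ ∈ maxSet g
    · rw [Set.indicator_of_mem (show φ ∈ regBox d 0 ∩ sphPoint ⁻¹' maxSet g from ⟨h1, h2⟩), Set.indicator_of_mem h1, Set.indicator_of_mem h2,
        ← coeffWeight_eq hg h1 h2]
      simp [mul_assoc]
    · rw [Set.indicator_of_notMem (fun h : φ ∈ regBox d 0 ∩ sphPoint ⁻¹' maxSet g => h2 h.2), Set.indicator_of_mem h1,
        Set.indicator_of_notMem h2]
      simp
  · rw [Set.indicator_of_notMem (fun h : φ ∈ regBox d 0 ∩ sphPoint ⁻¹' maxSet g => h1 h.1), Set.indicator_of_notMem h1]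

/-- The law of the direction, described by its angular density. -/
lemma lintegral_tailMeasure {Q : Measure (E d)}
    (hQ : ∀ h : E d → ℝ≥0∞, Measurable h → ∫⁻ x, h x ∂Q =
      ∫⁻ φ in regBox d 0, ENNReal.ofReal (sphDensity p (sphPoint φ)) * h (sphPoint φ))
    {A : ℝ} {f : ℝ → ℝ} (hf : Measurable f) {h : E d → ℝ≥0∞} (hh : Measurable h)
    {a : ℝ} (ha : a = 0 ∨ a = -Real.pi) :
    ∫⁻ x, h x ∂tailMeasure g m Q A f = ENNReal.ofReal (A ^ (((d - 1 - m : ℕ) : ℝ) / 2)) *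
      ∫⁻ φ in regBox d a, ENNReal.ofReal (sphDensity p (sphPoint φ)) *
        (ENNReal.ofReal (polarKernel g A f (sphPoint φ)) * h (sphPoint φ)) := by
  have hd := hg.dim
  have hk := (measurable_polarKernel hg (A := A) hf).ennreal_ofReal
  rw [tailMeasure, lintegral_smul_measure, lintegral_withDensity_eq_lintegral_mul _ hk hh,
    hQ _ (hk.mul hh), setLIntegral_regBox (by omega) (measurePreserving_add_volume _) (fun φ => by
      rw [sphPoint_add_fullTurn]) ha]
  rfl

omit hg in
/-- A neighbourhood of a point of the sphere pulled back into a neighbourhood of its angles. -/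
lemma exists_nhds_preimage_subset {a : ℝ} {φ₀ : E (d - 1)} (hφ₀ : φ₀ ∈ openBox d a)
    {W : Set (E (d - 1))} (hW : IsOpen W) (hφW : φ₀ ∈ W) :
    ∃ U, IsOpen U ∧ sphPoint φ₀ ∈ U ∧ ∀ φ ∈ regBox d a, sphPoint φ ∈ U → φ ∈ W := by
  -- The image of this compact set is closed and misses the point, because interior angles have no
  -- other preimage in the closed box.
  have hC : IsCompact (closedBox d a \ W) := (isCompact_closedBox a).diff hW
  refine ⟨(sphPoint '' (closedBox d a \ W))ᶜ, (hC.image continuous_sphPoint).isClosed.isOpen_compl,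
    ?_, fun φ hφ hU => ?_⟩
  · rintro ⟨φ, hφ, h⟩
    rw [eq_of_sphPoint_eq hφ.1 hφ₀ h] at hφ
    exact hφ.2 hφW
  · by_contra hn
    exact hU ⟨φ, ⟨regBox_subset_closedBox a hφ, hn⟩, rfl⟩

end Global

end PolarChaos
end

/-! ### Local comparison at regular points. -/

noncomputable section

namespace PolarChaos

open scoped ENNReal NNReal

section LocalBounds

variable {d m : ℕ} {α : ℝ} {g : E d → ℝ} {p : E (d - 1) → ℝ} {Q : Measure (E d)}
  {ι : Type} {l : Filter ι} {A : ι → ℝ} {f : ι → ℝ → ℝ}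

/-- Near a maximum point with non-degenerate angles. -/
lemma isLocallyClose_of_mem (hg : IsNondegenerateMax m α g) (hp : IsAngularDensity m g p)
    (hQ : ∀ h : E d → ℝ≥0∞, Measurable h → ∫⁻ x, h x ∂Q =
      ∫⁻ φ in regBox d 0, ENNReal.ofReal (sphDensity p (sphPoint φ)) * h (sphPoint φ))
    (hl : l.IsCountablyGenerated) (hf : IsExpKernel l A f) {v : E d} (hv : v ∈ maxSet g)
    (hvS : v ∉ sphSing d) {ε : ℝ} (hε : 0 < ε) :
    ∃ U, IsOpen U ∧ v ∈ U ∧ limitMeasure g m p U < ∞ ∧ 0 < limitMeasure g m p Set.univ ∧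
      IsLocallyClose l (fun y => tailMeasure g m Q (A y) (f y)) (limitMeasure g m p) ε U := by
  have hd := hg.dim
  have hΦ : Measurable (sphPoint : E (d - 1) → E d) := continuous_sphPoint.measurable
  obtain ⟨a, ha, φ₀, hφ₀, rfl⟩ :=
    exists_openBox_eq (by omega) (IsNondegenerateMax.norm_of_mem hv) hvS
  obtain ⟨C, hC0, hC⟩ := hp.nonneg_bdd
  have hchart := isSphereChart_sphPoint (by omega) (openBox_subset_regBox a hφ₀)
  obtain ⟨W, hW, hφW, hWsub, hfin, hpos, hZm, hcw, hmain⟩ :=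
    hchart.exists_nhds_laplace hg hv hε ((isOpen_openBox a).mem_nhds hφ₀)
  obtain ⟨U, hU, hvU, hUW⟩ := exists_nhds_preimage_subset hφ₀ hW hφW
  have hρm : Measurable fun φ : E (d - 1) => sphDensity p (sphPoint φ) :=
    (measurable_sphDensity (by omega) hp.cont).comp hΦ
  have hWreg : W ⊆ regBox d a := hWsub.trans (openBox_subset_regBox a)
  have hlim : ∀ h : E d → ℝ≥0∞, Measurable h → (∀ x ∉ U, h x = 0) →
      ∫⁻ x, h x ∂limitMeasure g m p = ∫⁻ φ in {φ ∈ W | sphPoint φ ∈ maxSet g},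
        ENNReal.ofReal (sphDensity p (sphPoint φ)) * h (sphPoint φ) *
          ENNReal.ofReal (chartWeight g m sphPoint φ) ∂μHE[m] := by
    intro h hh hU0
    rw [lintegral_limitMeasure hg hp hh ha, ← lintegral_indicator (measurableSet_regBox a),
      ← lintegral_indicator hZm]
    refine lintegral_congr fun φ => ?_
    by_cases hφW : φ ∈ W
    · rw [Set.indicator_of_mem (hWreg hφW)]
      by_cases hM : sphPoint φ ∈ maxSet g
      · rw [Set.indicator_of_mem hM,
          Set.indicator_of_mem (show φ ∈ {φ ∈ W | sphPoint φ ∈ maxSet g} from ⟨hφW, hM⟩)]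
        ring
      · rw [Set.indicator_of_notMem hM,
          Set.indicator_of_notMem (fun hn : φ ∈ {φ ∈ W | sphPoint φ ∈ maxSet g} => hM hn.2)]
        simp
    · rw [Set.indicator_of_notMem (fun hn : φ ∈ {φ ∈ W | sphPoint φ ∈ maxSet g} => hφW hn.1)]
      by_cases hreg : φ ∈ regBox d a
      · rw [Set.indicator_of_mem hreg]
        by_cases hM : sphPoint φ ∈ maxSet g
        · rw [Set.indicator_of_mem hM, hU0 _ fun h => hφW (hUW φ hreg h)]
          simp
        · rw [Set.indicator_of_notMem hM]
          simp
      · rw [Set.indicator_of_notMem hreg]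
  have hlimU : limitMeasure g m p U = ∫⁻ φ in {φ ∈ W | sphPoint φ ∈ maxSet g},
        ENNReal.ofReal (sphDensity p (sphPoint φ)) * U.indicator 1 (sphPoint φ) *
          ENNReal.ofReal (chartWeight g m sphPoint φ) ∂μHE[m] := by
    rw [← hlim _ (measurable_one.indicator hU.measurableSet)
      (fun x hx => Set.indicator_of_notMem hx _), lintegral_indicator_one hU.measurableSet]
  refine ⟨U, hU, hvU, ?_, ?_, ?_⟩
  · rw [hlimU]
    calc _ ≤ ∫⁻ φ in {φ ∈ W | sphPoint φ ∈ maxSet g}, ENNReal.ofReal C * 1 *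
          ENNReal.ofReal (2 * chartWeight g m sphPoint φ₀) ∂μHE[m] := by
          refine setLIntegral_mono' hZm fun φ hφ => ?_
          gcongr
          · exact hC _
          · exact Set.indicator_le_self' (fun _ _ => zero_le) _
          · exact (hcw φ hφ.1 hφ.2).1
      _ < ∞ := by
          rw [lintegral_const, Measure.restrict_apply_univ]
          exact ENNReal.mul_lt_top (ENNReal.mul_lt_top (by simp) ENNReal.ofReal_lt_top) hfin
  -- Positivity of the limit: the piece of the maximum set in `W` has positive `m`-dimensional
  -- volume, and density and weight are positive on it.
  · rw [← setLIntegral_one, setLIntegral_univ, lintegral_limitMeasure hg hp measurable_const ha]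
    have hcw0 := IsSphereChart.chartWeight_pos hg hchart
    set F : E (d - 1) → ℝ≥0∞ := fun φ => ENNReal.ofReal (sphDensity p (sphPoint φ)) *
      ENNReal.ofReal (chartWeight g m sphPoint φ₀ / 2) with hF
    have hFm : Measurable F := hρm.ennreal_ofReal.mul_const _
    have hZF : {φ ∈ W | sphPoint φ ∈ maxSet g} ⊆ Function.support F := by
      intro φ hφ
      have h1 : 0 < sphDensity p (sphPoint φ) := by
        refine sphDensity_pos hp.pos ?_
        rw [image_regBox (by omega), ← image_regBox (by omega) a]
        exact ⟨φ, hWreg hφ.1, rfl⟩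
      rw [Function.mem_support]
      exact mul_ne_zero (ENNReal.ofReal_pos.2 h1).ne' (ENNReal.ofReal_pos.2 (by positivity)).ne'
    calc 0 < ∫⁻ φ in {φ ∈ W | sphPoint φ ∈ maxSet g}, F φ ∂μHE[m] := by
          rw [lintegral_pos_iff_support hFm, Measure.restrict_apply' hZm,
            Set.inter_eq_self_of_subset_right hZF]
          exact hpos
      _ ≤ _ := by
          rw [← lintegral_indicator hZm, ← lintegral_indicator (measurableSet_regBox a)]
          refine lintegral_mono fun φ => Set.indicator_apply_le fun hφ => ?_
          rw [Set.indicator_of_mem (hWreg hφ.1), Set.indicator_of_mem hφ.2, mul_one]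
          refine mul_le_mul' le_rfl (ENNReal.ofReal_le_ofReal ?_)
          have := (hcw φ hφ.1 hφ.2).2
          linarith
  · intro ψ hψ0 hψ1 hψU δ hδ
    -- Density times cutoff, extended by zero off `W`. The support of the cutoff lies over `U`,
    -- whose angles in the box belong to `W`, so no mass is lost.
    set q : E (d - 1) → ℝ≥0∞ := W.indicator fun φ =>
      ENNReal.ofReal (sphDensity p (sphPoint φ) * ψ (sphPoint φ)) with hq
    have hρ0 : ∀ v, 0 ≤ sphDensity p v := sphDensity_nonneg hp.pos
    have hψm : Measurable fun x => ENNReal.ofReal (ψ x) :=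
      ENNReal.measurable_ofReal.comp ψ.continuous.measurable
    have hqm : Measurable q :=
      (hρm.mul (ψ.continuous.measurable.comp hΦ)).ennreal_ofReal.indicator hW.measurableSet
    have hqC : ∀ φ, q φ ≤ ENNReal.ofReal C := by
      intro φ
      by_cases hφ : φ ∈ W
      swap
      · simp [hq, hφ]
      simp only [hq]
      rw [Set.indicator_of_mem hφ]
      refine ENNReal.ofReal_le_ofReal ?_
      calc _ ≤ C * 1 := mul_le_mul (hC _) (hψ1 _) (hψ0 _) hC0
        _ = C := mul_one C
    have hqc : ContinuousOn q W := by
      have h1 : ContinuousOn (fun φ : E (d - 1) =>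
          ENNReal.ofReal (sphDensity p (sphPoint φ) * ψ (sphPoint φ))) W :=
        ENNReal.continuous_ofReal.comp_continuousOn
          (((continuousOn_sphDensity_comp (by omega) hp.cont a).mono hWreg).mul
            (ψ.continuous.comp continuous_sphPoint).continuousOn)
      exact h1.congr fun φ hφ => Set.indicator_of_mem hφ _
    have hq0 : ∀ φ ∉ W, q φ = 0 := fun φ hφ => Set.indicator_of_notMem hφ _
    have h := hmain q _ hqm ENNReal.ofReal_ne_top hqC hqc hq0 ι l A f hl hf δ hδ
    have hΛ : ∫⁻ x, ENNReal.ofReal (ψ x) ∂limitMeasure g m p =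
        ∫⁻ φ in {φ ∈ W | sphPoint φ ∈ maxSet g}, q φ *
          ENNReal.ofReal (chartWeight g m sphPoint φ) ∂μHE[m] := by
      rw [hlim _ hψm fun x hx => by rw [hψU x hx, ENNReal.ofReal_zero]]
      refine setLIntegral_congr_fun hZm fun φ hφ => ?_
      simp only [hq]
      rw [Set.indicator_of_mem hφ.1, ENNReal.ofReal_mul (hρ0 _)]
    have hI : ∀ y, ∫⁻ x, ENNReal.ofReal (ψ x) ∂tailMeasure g m Q (A y) (f y) =
        ENNReal.ofReal (A y ^ (((d - 1 - m : ℕ) : ℝ) / 2)) *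
          ∫⁻ φ, q φ * ENNReal.ofReal (polarKernel g (A y) (f y) (sphPoint φ)) := by
      intro y
      rw [lintegral_tailMeasure hg hQ (hf.meas y) hψm ha,
        ← lintegral_indicator (measurableSet_regBox a)]
      congr 1
      refine lintegral_congr fun φ => ?_
      by_cases hφW : φ ∈ W
      · simp only [hq]
        rw [Set.indicator_of_mem (hWreg hφW), Set.indicator_of_mem hφW, ENNReal.ofReal_mul (hρ0 _)]
        ring
      · rw [hq0 φ hφW, zero_mul]
        by_cases hreg : φ ∈ regBox d a
        · rw [Set.indicator_of_mem hreg, hψU _ fun h => hφW (hUW φ hreg h)]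
          simp
        · rw [Set.indicator_of_notMem hreg]
    filter_upwards [h.1, h.2] with y h1 h2
    simp only [hI, hΛ]
    exact ⟨h1, h2⟩

/-- Near a point of the sphere off the maximum set. -/
lemma isLocallyClose_of_notMem (hg : IsNondegenerateMax m α g) (hp : IsAngularDensity m g p)
    (hQS : Q (Metric.sphere 0 1)ᶜ = 0) (hQ1 : Q Set.univ ≤ 1)
    (hf : IsExpKernel l A f) {v : E d} (hv1 : ‖v‖ = 1) (hv : v ∉ maxSet g) (ε : ℝ) :
    ∃ U, IsOpen U ∧ v ∈ U ∧ limitMeasure g m p U < ∞ ∧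
      IsLocallyClose l (fun y => tailMeasure g m Q (A y) (f y)) (limitMeasure g m p) ε U := by
  have hpos := hg.max_pos
  have hlt : g v < maxVal g := lt_of_le_of_ne (hg.le_maxVal hv1) fun h => hv ⟨by simpa using hv1, h⟩
  -- Half of the gap to the maximum, so that a gap of `c` persists on a neighbourhood of `v`.
  set c := (maxVal g - g v) / 2 with hc
  have hc0 : 0 < c := by rw [hc]; linarith
  set U : Set (E d) := {0}ᶜ ∩ g ⁻¹' Set.Iio (maxVal g - c) with hUdef
  have hU : IsOpen U := hg.smooth.continuousOn.isOpen_inter_preimage isOpen_compl_singleton isOpen_Iio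
  have hvU : v ∈ U := ⟨by rintro rfl; simp at hv1, by
    rw [Set.mem_preimage, Set.mem_Iio, hc]; linarith⟩
  have hΛU : limitMeasure g m p U = 0 := by
    rw [← lintegral_indicator_one hU.measurableSet, lintegral_limitMeasure hg hp
      (measurable_one.indicator hU.measurableSet) (Or.inl rfl)]
    refine (lintegral_congr fun φ => ?_).trans lintegral_zero
    by_cases hM : sphPoint φ ∈ maxSet g
    · rw [Set.indicator_of_mem hM, Set.indicator_of_notMem, mul_zero, mul_zero]
      intro h
      have h1 : g (sphPoint φ) < maxVal g - c := h.2
      rw [hM.2] at h1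
      linarith
    · rw [Set.indicator_of_notMem hM, mul_zero, mul_zero]
  refine ⟨U, hU, hvU, by rw [hΛU]; exact ENNReal.zero_lt_top, fun ψ hψ0 hψ1 hψU δ hδ => ?_⟩
  have hψle : ∀ x, ENNReal.ofReal (ψ x) ≤ U.indicator 1 x := by
    intro x
    by_cases hx : x ∈ U
    · simp [hx, hψ1 x]
    · simp [hx, hψU x hx]
  have hψΛ : ∫⁻ x, ENNReal.ofReal (ψ x) ∂limitMeasure g m p = 0 := by
    refine le_antisymm ((lintegral_mono hψle).trans ?_) (zero_le)
    rw [lintegral_indicator_one hU.measurableSet, hΛU]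
  rw [hψΛ, mul_zero, mul_zero]
  set κ : ℝ := ((d - 1 - m : ℕ) : ℝ) / 2 with hκ
  -- One power more than the integer exponent dominating `κ`: the rescaled kernel is then of order
  -- `1 / A` away from the maximum set.
  set N := d - 1 - m + 1 with hN
  obtain ⟨B, hB, hbound⟩ := hf.bound N
  have hdecay : Tendsto (fun y => A y ^ κ * (B / (1 + (maxVal g)⁻¹ * A y * c) ^ N)) l (𝓝 0) := by
    set b := (maxVal g)⁻¹ * c with hb
    have hb0 : 0 < b := by positivity
    have h0 : Tendsto (fun y => B * (b ^ N)⁻¹ * (A y)⁻¹) l (𝓝 0) := by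
      have := (tendsto_inv_atTop_zero.comp hf.scale).const_mul (B * (b ^ N)⁻¹)
      rwa [mul_zero] at this
    refine squeeze_zero' ?_ ?_ h0
    · filter_upwards [hf.scale.eventually_ge_atTop 1] with y hy
      have : 0 ≤ A y := by linarith
      positivity
    · filter_upwards [hf.scale.eventually_ge_atTop 1] with y hy
      have hA : 0 < A y := by linarith
      have h1 : A y ^ κ ≤ A y ^ (d - 1 - m) := by
        rw [← Real.rpow_natCast]
        refine Real.rpow_le_rpow_of_exponent_le hy ?_
        rw [hκ]
        have : (0 : ℝ) ≤ ((d - 1 - m : ℕ) : ℝ) := Nat.cast_nonneg _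
        linarith
      have h2 : (b * A y) ^ N ≤ (1 + (maxVal g)⁻¹ * A y * c) ^ N := by
        refine pow_le_pow_left₀ (by positivity) ?_ N
        rw [hb]; linarith [show (maxVal g)⁻¹ * c * A y = (maxVal g)⁻¹ * A y * c by ring]
      calc A y ^ κ * (B / (1 + (maxVal g)⁻¹ * A y * c) ^ N)
          ≤ A y ^ (d - 1 - m) * (B / (b * A y) ^ N) := by gcongr
        _ = B * (b ^ N)⁻¹ * (A y)⁻¹ := by
          rw [mul_pow, hN, pow_succ (A y)]
          field_simp
  have hdecay' : ∀ᶠ y in l, ENNReal.ofReal (A y ^ κ * (B / (1 + (maxVal g)⁻¹ * A y * c) ^ N)) ≤ δ := by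
    have := (ENNReal.continuous_ofReal.tendsto 0).comp hdecay
    rw [ENNReal.ofReal_zero] at this
    exact (this.eventually (gt_mem_nhds hδ)).mono fun y hy => le_of_lt hy
  filter_upwards [hdecay', hbound, hf.anti, hf.scale.eventually_ge_atTop 0] with y h1 h2 h3 h4
  refine ⟨?_, zero_le⟩
  rw [zero_add]
  refine le_trans ?_ h1
  rw [tailMeasure, lintegral_smul_measure, smul_eq_mul, ENNReal.ofReal_mul (by positivity)]
  gcongr
  have hk := (measurable_polarKernel hg (A := A y) (hf.meas y)).ennreal_ofReal
  refine (lintegral_withDensity_eq_lintegral_mul _ hk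
    (ENNReal.measurable_ofReal.comp ψ.continuous.measurable)).trans_le ?_
  have hle : ∀ᵐ x ∂Q, ENNReal.ofReal (polarKernel g (A y) (f y) x) * ENNReal.ofReal (ψ x) ≤
      ENNReal.ofReal (B / (1 + (maxVal g)⁻¹ * A y * c) ^ N) := by
    have hS : ∀ᵐ x ∂Q, x ∈ Metric.sphere (0 : E d) 1 := hQS
    filter_upwards [hS] with x hx
    by_cases hxU : x ∈ U
    · have hgx : g x < maxVal g - c := hxU.2
      calc _ ≤ ENNReal.ofReal (polarKernel g (A y) (f y) x) * 1 := by
            gcongr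
            exact ENNReal.ofReal_le_one.2 (hψ1 x)
        _ = ENNReal.ofReal (polarKernel g (A y) (f y) x) := mul_one _
        _ ≤ _ := by
            refine ENNReal.ofReal_le_ofReal ?_
            refine (IsSphereChart.polarKernel_le (sub_nonneg.2 (hg.le_maxVal (by simpa using hx)))
              h4 h3 (hf.nonneg y)).trans ?_
            refine le_trans (h3 ?_) (h2 ((maxVal g)⁻¹ * A y * c) (by positivity))
            gcongr
            linarith
    · rw [hψU x hxU]
      simp
  calc _ ≤ ∫⁻ x, ENNReal.ofReal (B / (1 + (maxVal g)⁻¹ * A y * c) ^ N) ∂Q :=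
        lintegral_mono_ae hle
    _ ≤ _ := by
        rw [lintegral_const]
        exact mul_le_of_le_one_right (zero_le) hQ1

end LocalBounds

end PolarChaos
end

/-! ### Degenerate angles, and convergence of the total mass. -/

noncomputable section

namespace PolarChaos

open scoped ENNReal NNReal

section Singular

variable {d m : ℕ} {α : ℝ} {g : E d → ℝ} {p : E (d - 1) → ℝ} {Q : Measure (E d)}
  {ι : Type} {l : Filter ι} {A : ι → ℝ} {f : ι → ℝ → ℝ}

lemma continuous_orthoChart {v : E d} {u : Fin (d - 1) → E d} : Continuous (orthoChart v u) := by
  unfold orthoChart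
  fun_prop

/-- The orthogonal projection undoes the chart and is 1-Lipschitz, so the preimage lies in a
Lipschitz image of a null set. -/
lemma IsTangentFrame.measure_preimage_eq_zero {v : E d} {u : Fin (d - 1) → E d}
    (h : IsTangentFrame v u) {N : Set (E d)} (hN : (μHE[m] : Measure (E d)) N = 0) :
    (μHE[m] : Measure (E (d - 1))) (orthoChart v u ⁻¹' N) = 0 := by
  have hsub : orthoChart v u ⁻¹' N ⊆ frameProj u '' N := fun t ht =>
    ⟨_, ht, h.frameProj_orthoChart t⟩
  refine measure_mono_null hsub (le_antisymm ?_ zero_le)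
  refine (euclideanHausdorffMeasure_image_le
    (h.lipschitz_frameProj.lipschitzOnWith (s := N)) m).trans ?_
  rw [hN, mul_zero]

/-- In the orthographic chart a piece of the maximum set has positive `m`-dimensional volume,
whereas its degenerate points form a null set. This yields a regular point at which the limit
measure is seen to be nonzero. -/
lemma exists_mem_notMem_sphSing (hg : IsNondegenerateMax m α g) (hp : IsAngularDensity m g p) :
    ∃ v ∈ maxSet g, v ∉ sphSing d := by
  by_contra hn
  push Not at hn
  obtain ⟨v, hv⟩ := hg.maxSet_nonempty
  obtain ⟨u, hu⟩ := exists_isTangentFrame (IsNondegenerateMax.norm_of_mem hv)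
  obtain ⟨W, -, -, -, -, hpos, -⟩ := hu.isSphereChart.exists_nhds_laplace hg
    (by rwa [orthoChart_zero]) one_pos univ_mem
  refine hpos.ne' (measure_mono_null (fun t ht => ?_) (hu.measure_preimage_eq_zero hp.sing_null))
  exact ⟨ht.2, hn _ ht.2⟩

/-- Near a maximum point with degenerate angles. -/
lemma exists_majorant_of_mem_sphSing (hg : IsNondegenerateMax m α g) (hp : IsAngularDensity m g p)
    (hQ : ∀ h : E d → ℝ≥0∞, Measurable h → ∫⁻ x, h x ∂Q =
      ∫⁻ φ in regBox d 0, ENNReal.ofReal (sphDensity p (sphPoint φ)) * h (sphPoint φ))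
    (hl : l.IsCountablyGenerated) (hf : IsExpKernel l A f) {v : E d}
    (hv : v ∈ maxSet g ∩ sphSing d) :
    ∃ U, IsOpen U ∧ v ∈ U ∧ ∃ Λ : Measure (E d), Λ Set.univ < ∞ ∧ Λ (maxSet g ∩ sphSing d) = 0 ∧
      ∀ ψ : C(E d, ℝ), (∀ x, 0 ≤ ψ x) → (∀ x, ψ x ≤ 1) → (∀ x ∉ U, ψ x = 0) →
        ∀ δ : ℝ≥0∞, 0 < δ → ∀ᶠ y in l,
          ∫⁻ x, ENNReal.ofReal (ψ x) ∂tailMeasure g m Q (A y) (f y) ≤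
            ∫⁻ x, ENNReal.ofReal (ψ x) ∂Λ + δ := by
  have hd := hg.dim
  obtain ⟨u, hu⟩ := exists_isTangentFrame (IsNondegenerateMax.norm_of_mem hv.1)
  obtain ⟨b, -, hb⟩ := hp.sing_dens v hv
  obtain ⟨C, hC, r, hr, hCr⟩ := exists_lintegral_le_orthoChart (by omega) hu hp.pos hb
  obtain ⟨W, hW, h0W, -, hfin, -, hZm, hcw, hmain⟩ := hu.isSphereChart.exists_nhds_laplace hg
    (by rw [orthoChart_zero]; exact hv.1) one_pos univ_mem
  have hΨm : Measurable (orthoChart v u) := measurable_orthoChart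
  set Z := {t ∈ W | orthoChart v u t ∈ maxSet g} with hZ
  -- The factors come from the Laplace bound with `ε = 1`, from the domination of the law by
  -- Lebesgue measure, and from the chart weight being at most twice its value at the centre.
  set c : ℝ≥0∞ := ENNReal.ofReal (1 + 1) * (C *
    ENNReal.ofReal (2 * chartWeight g m (orthoChart v u) 0)) with hc
  have hcfin : c < ∞ := ENNReal.mul_lt_top ENNReal.ofReal_lt_top
    (ENNReal.mul_lt_top hC.lt_top ENNReal.ofReal_lt_top)
  refine ⟨Metric.ball v r ∩ frameProj u ⁻¹' W,
    Metric.isOpen_ball.inter (hW.preimage (frameProj u).continuous),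
    ⟨Metric.mem_ball_self hr, by rwa [Set.mem_preimage, hu.frameProj_self]⟩,
    c • ((μHE[m] : Measure (E (d - 1))).restrict Z).map (orthoChart v u), ?_, ?_, ?_⟩
  · rw [Measure.smul_apply, Measure.map_apply hΨm MeasurableSet.univ, Set.preimage_univ,
      Measure.restrict_apply_univ]
    exact ENNReal.mul_lt_top hcfin hfin
  · rw [Measure.smul_apply, Measure.map_apply hΨm
      ((measurableSet_maxSet hg).inter isClosed_sphSing.measurableSet)]
    have := Measure.restrict_apply_le (μ := (μHE[m] : Measure (E (d - 1)))) Z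
      (orthoChart v u ⁻¹' (maxSet g ∩ sphSing d))
    rw [hu.measure_preimage_eq_zero hp.sing_null] at this
    rw [le_antisymm this zero_le, smul_zero]
  · intro ψ hψ0 hψ1 hψU δ hδ
    have hψm : Measurable fun x => ENNReal.ofReal (ψ x) :=
      ENNReal.measurable_ofReal.comp ψ.continuous.measurable
    have hψc : Continuous fun t => C * ENNReal.ofReal (ψ (orthoChart v u t)) :=
      (ENNReal.continuous_const_mul hC).comp
        (ENNReal.continuous_ofReal.comp (ψ.continuous.comp continuous_orthoChart))
    set q : E (d - 1) → ℝ≥0∞ := fun t => C * ENNReal.ofReal (ψ (orthoChart v u t)) with hq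
    have hq0 : ∀ t ∉ W, q t = 0 := by
      intro t ht
      simp only [hq]
      rw [hψU _ fun h => ht ?_, ENNReal.ofReal_zero, mul_zero]
      have := h.2
      rwa [Set.mem_preimage, hu.frameProj_orthoChart] at this
    have hqC : ∀ t, q t ≤ C := fun t =>
      mul_le_of_le_one_right zero_le (ENNReal.ofReal_le_one.2 (hψ1 _))
    have h := (hmain q C hψc.measurable hC hqC hψc.continuousOn hq0 ι l A f hl hf δ hδ).1
    filter_upwards [h] with y hy
    have hk := (measurable_polarKernel hg (A := A y) (hf.meas y)).ennreal_ofReal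
    calc ∫⁻ x, ENNReal.ofReal (ψ x) ∂tailMeasure g m Q (A y) (f y)
        ≤ ENNReal.ofReal (A y ^ (((d - 1 - m : ℕ) : ℝ) / 2)) * (C * ∫⁻ t,
          ENNReal.ofReal (polarKernel g (A y) (f y) (orthoChart v u t)) *
            ENNReal.ofReal (ψ (orthoChart v u t))) := by
          rw [lintegral_tailMeasure hg hQ (hf.meas y) hψm (Or.inl rfl)]
          gcongr
          refine hCr (fun x => ENNReal.ofReal (polarKernel g (A y) (f y) x) *
            ENNReal.ofReal (ψ x)) fun x hx => ?_
          rw [hψU x fun h => hx h.1, ENNReal.ofReal_zero, mul_zero]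
      _ = ENNReal.ofReal (A y ^ (((d - 1 - m : ℕ) : ℝ) / 2)) * ∫⁻ t, q t *
          ENNReal.ofReal (polarKernel g (A y) (f y) (orthoChart v u t)) := by
          rw [← lintegral_const_mul' _ _ hC]
          congr 1
          refine lintegral_congr fun t => ?_
          simp only [hq]
          ring
      _ ≤ _ := hy
      _ ≤ _ := by
          gcongr
          rw [lintegral_smul_measure, lintegral_map hψm hΨm, smul_eq_mul, hc, mul_assoc]
          gcongr
          rw [← lintegral_const_mul' _ _ (ENNReal.mul_lt_top hC.lt_top ENNReal.ofReal_lt_top).ne]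
          refine setLIntegral_mono' hZm fun t ht => ?_
          simp only [hq]
          rw [mul_right_comm]
          gcongr
          exact (hcw t ht.1 ht.2).1

end Singular

section Convergence

variable {d m : ℕ} {α : ℝ} {g : E d → ℝ} {p : E (d - 1) → ℝ} {Q : Measure (E d)}
  {ι : Type} {l : Filter ι} {A : ι → ℝ} {f : ι → ℝ → ℝ}

/-- Convergence of the rescaled tail of the direction. -/
theorem tendsto_tailMeasure (hg : IsNondegenerateMax m α g) (hp : IsAngularDensity m g p)
    (hQ : ∀ h : E d → ℝ≥0∞, Measurable h → ∫⁻ x, h x ∂Q =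
      ∫⁻ φ in regBox d 0, ENNReal.ofReal (sphDensity p (sphPoint φ)) * h (sphPoint φ))
    (hQS : Q (Metric.sphere 0 1)ᶜ = 0) (hQ1 : Q Set.univ ≤ 1) [l.NeBot]
    (hl : l.IsCountablyGenerated) (hf : IsExpKernel l A f) :
    0 < limitMeasure g m p Set.univ ∧ limitMeasure g m p Set.univ < ∞ ∧
      Tendsto (fun y => tailMeasure g m Q (A y) (f y) Set.univ) l
        (𝓝 (limitMeasure g m p Set.univ)) := by
  have hd := hg.dim
  have hMm := measurableSet_maxSet hg
  refine ⟨?_, ?_⟩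
  · obtain ⟨v, hv, hvS⟩ := exists_mem_notMem_sphSing hg hp
    obtain ⟨U, -, -, -, h, -⟩ := isLocallyClose_of_mem hg hp hQ hl hf hv hvS one_pos
    exact h
  -- The limit measure is carried by the maximum points with regular angles, so it charges neither
  -- the complement of the sphere nor the degenerate points.
  have hΛsub : ∀ N : Set (E d), MeasurableSet N →
      (∀ φ ∈ regBox d 0, sphPoint φ ∈ maxSet g → sphPoint φ ∉ N) → limitMeasure g m p N = 0 := by
    intro N hN h
    rw [← lintegral_indicator_one hN, lintegral_limitMeasure hg hp
      (measurable_one.indicator hN) (Or.inl rfl),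
      setLIntegral_eq_zero (measurableSet_regBox 0)]
    intro φ hφ
    beta_reduce
    by_cases hM : sphPoint φ ∈ maxSet g
    · rw [Set.indicator_of_mem hM, Set.indicator_of_notMem (h φ hφ hM), mul_zero, mul_zero]; rfl
    · rw [Set.indicator_of_notMem hM, mul_zero, mul_zero]; rfl
  have hKc : IsCompact (maxSet g ∩ sphSing d) :=
    ((isCompact_sphere (0 : E d) 1).of_isClosed_subset hg.isClosed_maxSet fun x hx => hx.1).inter_right
      isClosed_sphSing
  refine tendsto_measure_univ_of_local (isCompact_sphere (0 : E d) 1) (K := maxSet g ∩ sphSing d)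
    ?_ ?_ hKc.isClosed ?_ ?_ ?_
  · intro y
    rw [tailMeasure, Measure.smul_apply, withDensity_absolutelyContinuous _ _ hQS, smul_zero]
  · refine hΛsub _ Metric.isClosed_sphere.measurableSet.compl fun φ _ hM hN => hN hM.1
  · exact hΛsub _ hKc.measurableSet fun φ hφ _ hN =>
      sphPoint_notMem_sphSing_of_regBox (by omega) hφ hN.2
  · exact exists_nhds_measure_le hKc fun v hv => exists_majorant_of_mem_sphSing hg hp hQ hl hf hv
  · intro ε hε v hv
    by_cases hM : v ∈ maxSet g
    · obtain ⟨U, h1, h2, h3, -, h4⟩ := isLocallyClose_of_mem hg hp hQ hl hf hM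
        (fun h => hv.2 ⟨hM, h⟩) hε
      exact ⟨U, h1, h2, h3, h4⟩
    · exact isLocallyClose_of_notMem hg hp hQS hQ1 hf (by simpa using hv.1) hM ε

end Convergence

end PolarChaos
end

/-! ### Transfer of asymptotics, the leading constant, and conditioning on the direction. -/

noncomputable section

namespace PolarChaos

open scoped ENNReal NNReal

section Transfer

variable {T w H : ℝ → ℝ} {a : EReal} {κ L : ℝ}

lemma IsGumbelTail.eventually_pos (h : IsGumbelTail T w a) : ∀ᶠ y in upTo a, 0 < T y :=
  (eventually_upTo_lt h.bot_lt).mono fun y hy => h.pos y hy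

lemma IsGumbelTail.isEquivalent (h : IsGumbelTail T w a) (hL : 0 < L)
    (hH : Tendsto (fun y => (y * w y) ^ κ * H y / T y) (upTo a) (𝓝 L)) :
    H ~[upTo a] fun y => L / (y * w y) ^ κ * T y := by
  refine (isEquivalent_iff_tendsto_one ?_).2 ?_
  · filter_upwards [h.eventually_pos, h.tendsto_scale.eventually_gt_atTop 0] with y h1 h2
    positivity
  · have h3 := hH.div_const L
    rw [div_self hL.ne'] at h3
    refine h3.congr' ?_
    filter_upwards [h.eventually_pos, h.tendsto_scale.eventually_gt_atTop 0] with y h1 h2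
    have h4 : 0 < (y * w y) ^ κ := Real.rpow_pos_of_pos h2 _
    simp only [Pi.div_apply]
    field_simp

lemma IsGumbelTail.eventually_pos_of_tendsto (h : IsGumbelTail T w a) (hL : 0 < L)
    (hH : Tendsto (fun y => (y * w y) ^ κ * H y / T y) (upTo a) (𝓝 L)) :
    ∀ᶠ y in upTo a, 0 < H y := by
  filter_upwards [hH.eventually (lt_mem_nhds hL), h.eventually_pos,
    h.tendsto_scale.eventually_gt_atTop 0] with y h1 h2 h3
  have h4 : 0 < (y * w y) ^ κ := Real.rpow_pos_of_pos h3 _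
  have h5 := (div_pos_iff_of_pos_right h2).1 h1
  exact (mul_pos_iff_of_pos_left h4).1 h5

/-- Near the endpoint `H` is a constant times `T / (y * w y) ^ κ`. The shift multiplies `T` by `exp
(-t)` and leaves `y * w y` asymptotically unchanged by `tendsto_scale_ratio`. -/
lemma IsGumbelTail.isEquivalent_shift (h : IsGumbelTail T w a) (hL : 0 < L)
    (hH : Tendsto (fun y => (y * w y) ^ κ * H y / T y) (upTo a) (𝓝 L)) (t : ℝ) :
    (fun y => H (y + t / w y)) ~[upTo a] fun y => Real.exp (-t) * H y := by
  have hHpos := h.eventually_pos_of_tendsto hL hH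
  have hshift := h.tendsto_shift t
  refine (isEquivalent_iff_tendsto_one ?_).2 ?_
  · filter_upwards [hHpos] with y hy
    positivity
  · have h1 : Tendsto (fun y => (((y + t / w y) * w (y + t / w y)) ^ κ * H (y + t / w y) /
        T (y + t / w y)) / ((y * w y) ^ κ * H y / T y)) (upTo a) (𝓝 1) := by
      have := (hH.comp hshift).div hH hL.ne'
      rwa [div_self hL.ne'] at this
    have h2 := (h.tendsto_scale_ratio t).rpow_const (p := κ) (Or.inl one_ne_zero)
    rw [Real.one_rpow] at h2
    have h3 := ((h.ratio t).div_const (Real.exp (-t)))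
    rw [div_self (Real.exp_pos _).ne'] at h3
    have h4 := (h1.mul h2).mul h3
    rw [one_mul, one_mul] at h4
    refine h4.congr' ?_
    filter_upwards [hHpos, h.eventually_pos, h.tendsto_scale.eventually_gt_atTop 0,
      hshift.eventually h.eventually_pos,
      (h.tendsto_scale.comp hshift).eventually_gt_atTop 0] with y b1 b2 b3 b4 b5
    simp only [Function.comp] at b5
    have e1 : 0 < (y * w y) ^ κ := Real.rpow_pos_of_pos b3 _
    have e2 : 0 < ((y + t / w y) * w (y + t / w y)) ^ κ := Real.rpow_pos_of_pos b5 _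
    rw [Real.div_rpow b3.le b5.le]
    simp only [Pi.div_apply]
    have e3 := Real.exp_pos (-t)
    field_simp

lemma bot_lt_coe_mul {c : ℝ} (hc : 0 < c) (ha : 0 < a) : (⊥ : EReal) < (c : EReal) * a :=
  lt_trans (by simp) (EReal.mul_pos (by exact_mod_cast hc) ha)

lemma coe_mul_le_coe_mul_iff {c : ℝ} (hc : 0 < c) (ha : 0 < a) (b : ℝ) :
    (((c * b : ℝ) : EReal) < (c : EReal) * a ↔ (b : EReal) < a) ∧
      (((c * b : ℝ) : EReal) ≤ (c : EReal) * a ↔ (b : EReal) ≤ a) := by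
  induction a using EReal.rec with
  | bot => simp at ha
  | top =>
    rw [EReal.coe_mul_top_of_pos hc]
    exact ⟨iff_of_true (EReal.coe_lt_top _) (EReal.coe_lt_top _), iff_of_true le_top le_top⟩
  | coe x =>
    rw [← EReal.coe_mul]
    simp only [EReal.coe_lt_coe_iff, EReal.coe_le_coe_iff]
    exact ⟨mul_lt_mul_iff_right₀ hc, mul_le_mul_iff_right₀ hc⟩

lemma tendsto_upTo_div {c : ℝ} (hc : 0 < c) (ha : 0 < a) :
    Tendsto (fun x : ℝ => x / c) (upTo ((c : EReal) * a)) (upTo a) := by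
  have ha' : ⊥ < a := lt_trans (by simp) ha
  intro s hs
  rw [mem_map]
  obtain ⟨b, hb, h⟩ := (eventually_upTo_iff ha').1 (show ∀ᶠ x in upTo a, x ∈ s from hs)
  refine (eventually_upTo_iff (bot_lt_coe_mul hc ha)).2 ⟨c * b, (coe_mul_le_coe_mul_iff hc ha b).1.2 hb,
    fun x hx hxa => h _ ?_ ?_⟩
  · rw [lt_div_iff₀ hc]; linarith
  · rw [← (coe_mul_le_coe_mul_iff hc ha (x / c)).1, mul_div_cancel₀ _ hc.ne']
    exact hxa

end Transfer

section Constant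

variable {d m : ℕ} {α : ℝ} {g : E d → ℝ} {p : E (d - 1) → ℝ}

lemma measurableSet_angularMaxSet (hg : IsNondegenerateMax m α g) :
    MeasurableSet (angularMaxSet g) := by
  have : angularMaxSet g = regBox d 0 ∩ sphPoint ⁻¹' maxSet g := by
    rw [← regAngles_eq_regBox]; rfl
  rw [this]
  exact (measurableSet_regBox 0).inter
    (continuous_sphPoint.measurable (measurableSet_maxSet hg))

lemma leadingIntegrand_nonneg (hp : IsAngularDensity m g p) {φ : E (d - 1)}
    (hφ : φ ∈ angularMaxSet g) : 0 ≤ leadingIntegrand g p φ :=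
  div_nonneg (hp.pos φ hφ.1).le (Real.sqrt_nonneg _)

lemma mul_leadingIntegrand {φ : E (d - 1)} (hφ : φ ∈ angularMaxSet g) :
    (2 * Real.pi * maxVal g) ^ (((d - 1 - m : ℕ) : ℝ) / 2) * leadingIntegrand g p φ =
      sphDensity p (sphPoint φ) * chartWeight g m sphPoint φ := by
  have h1 : φ ∈ regBox d 0 := by rw [← regAngles_eq_regBox]; exact hφ.1
  rw [sphDensity_sphPoint h1, leadingIntegrand, chartWeight]
  ring

lemma limitMeasure_univ (hg : IsNondegenerateMax m α g) (hp : IsAngularDensity m g p) :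
    limitMeasure g m p Set.univ =
      ENNReal.ofReal ((2 * Real.pi * maxVal g) ^ (((d - 1 - m : ℕ) : ℝ) / 2)) *
        ∫⁻ φ in angularMaxSet g, ENNReal.ofReal (leadingIntegrand g p φ) ∂μHE[m] := by
  have hpos := hg.max_pos
  rw [← lintegral_const_mul' _ _ ENNReal.ofReal_ne_top, ← setLIntegral_one, setLIntegral_univ,
    lintegral_limitMeasure hg hp measurable_const (Or.inl rfl),
    ← lintegral_indicator (measurableSet_regBox 0),
    ← lintegral_indicator (measurableSet_angularMaxSet hg)]
  refine lintegral_congr fun φ => ?_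
  by_cases h : φ ∈ angularMaxSet g
  · have h1 : φ ∈ regBox d 0 := by rw [← regAngles_eq_regBox]; exact h.1
    rw [Set.indicator_of_mem h, Set.indicator_of_mem h1, Set.indicator_of_mem h.2, mul_one,
      ← ENNReal.ofReal_mul (sphDensity_nonneg hp.pos _), ← mul_leadingIntegrand h,
      ENNReal.ofReal_mul (by positivity)]
  · rw [Set.indicator_of_notMem h]
    by_cases h1 : φ ∈ regBox d 0
    · rw [Set.indicator_of_mem h1, Set.indicator_of_notMem, mul_zero, mul_zero]
      exact fun h2 => h ⟨by rwa [regAngles_eq_regBox], h2⟩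
    · rw [Set.indicator_of_notMem h1]

lemma aestronglyMeasurable_leadingIntegrand (hg : IsNondegenerateMax m α g)
    (hp : IsAngularDensity m g p) :
    AEStronglyMeasurable (leadingIntegrand g p)
      ((μHE[m] : Measure (E (d - 1))).restrict (angularMaxSet g)) := by
  have hd := hg.dim
  have hpos := hg.max_pos
  have hm : Measurable fun φ : E (d - 1) => sphDensity p (sphPoint φ) * coeffWeight g m φ /
      (2 * Real.pi * maxVal g) ^ (((d - 1 - m : ℕ) : ℝ) / 2) :=
    (((measurable_sphDensity (by omega) hp.cont).comp continuous_sphPoint.measurable).mul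
      (measurable_coeffWeight hg)).div_const _
  refine hm.aestronglyMeasurable.congr ?_
  refine (ae_restrict_iff' (measurableSet_angularMaxSet hg)).2 (Eventually.of_forall fun φ hφ => ?_)
  have h1 : φ ∈ regBox d 0 := by rw [← regAngles_eq_regBox]; exact hφ.1
  have h2 : (2 * Real.pi * maxVal g) ^ (((d - 1 - m : ℕ) : ℝ) / 2) ≠ 0 := by positivity
  beta_reduce
  rw [coeffWeight_eq hg h1 hφ.2, div_eq_iff h2, ← mul_leadingIntegrand hφ, mul_comm]

/-- The integrand is nonnegative and its integral is the limit mass up to a positive constant, so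
finiteness of that mass is integrability. -/
lemma integrableOn_leadingIntegrand (hg : IsNondegenerateMax m α g) (hp : IsAngularDensity m g p)
    (hfin : limitMeasure g m p Set.univ < ∞) :
    IntegrableOn (leadingIntegrand g p) (angularMaxSet g) (μHE[m]) ∧
      (limitMeasure g m p Set.univ).toReal =
        (2 * Real.pi * maxVal g) ^ (((d - 1 - m : ℕ) : ℝ) / 2) *
          ∫ φ in angularMaxSet g, leadingIntegrand g p φ ∂μHE[m] := by
  have hpos := hg.max_pos
  have hC : 0 < (2 * Real.pi * maxVal g) ^ (((d - 1 - m : ℕ) : ℝ) / 2) := by positivity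
  have hnn : 0 ≤ᵐ[(μHE[m] : Measure (E (d - 1))).restrict (angularMaxSet g)]
      leadingIntegrand g p :=
    (ae_restrict_iff' (measurableSet_angularMaxSet hg)).2
      (Eventually.of_forall fun φ hφ => leadingIntegrand_nonneg hp hφ)
  have hmeas := aestronglyMeasurable_leadingIntegrand hg hp
  rw [limitMeasure_univ hg hp] at hfin ⊢
  refine ⟨⟨hmeas, ?_⟩, ?_⟩
  · rw [hasFiniteIntegral_iff_ofReal hnn]
    exact ENNReal.lt_top_of_mul_ne_top_right hfin.ne (ENNReal.ofReal_pos.2 hC).ne'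
  · rw [integral_eq_lintegral_of_nonneg_ae hnn hmeas, ENNReal.toReal_mul,
      ENNReal.toReal_ofReal hC.le]

end Constant

section Polar

variable {d m : ℕ} {α : ℝ} {g : E d → ℝ}
  {Ω : Type*} [MeasurableSpace Ω] {μ : Measure Ω} [IsProbabilityMeasure μ]
  {χ : Ω → ℝ} {ζ : Ω → E d} {w : ℝ → ℝ}

/-- The tail of `g (χ ζ)` conditioned on the direction. -/
lemma ofReal_tail_eq_lintegral (hg : IsNondegenerateMax m α g) (hχ : Measurable χ)
    (hχpos : ∀ᵐ ω ∂μ, 0 < χ ω) (hζ : Measurable ζ) (hindep : IndepFun χ ζ μ)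
    {y : ℝ} (hy : 0 < y) (hw : 0 < w y) (hT : 0 < μ.real {ω | y < χ ω ^ α}) :
    ENNReal.ofReal (μ.real {ω | maxVal g * y < g (χ ω • ζ ω)}) =
      ENNReal.ofReal (μ.real {ω | y < χ ω ^ α}) * ∫⁻ x, ENNReal.ofReal (polarKernel g (y * w y)
        (fun s => μ.real {ω | y + s / w y < χ ω ^ α} / μ.real {ω | y < χ ω ^ α}) x) ∂μ.map ζ := by
  have hpos := hg.max_pos
  have hgm := hg.measurable
  set S : Set (E d × ℝ) := {z | maxVal g * y < z.2 ^ α * g z.1} with hS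
  have hSm : MeasurableSet S := measurableSet_lt measurable_const
    ((measurable_snd.pow_const α).mul (hgm.comp measurable_fst))
  have h1 : μ {ω | maxVal g * y < g (χ ω • ζ ω)} = (μ.map fun ω => (ζ ω, χ ω)) S := by
    rw [Measure.map_apply (hζ.prodMk hχ) hSm]
    refine measure_congr ?_
    filter_upwards [hχpos] with ω hω
    have : g (χ ω • ζ ω) = χ ω ^ α * g (ζ ω) := hg.hom _ _ hω
    exact propext (by
      change maxVal g * y < g (χ ω • ζ ω) ↔ maxVal g * y < χ ω ^ α * g (ζ ω)
      rw [this])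
  rw [ofReal_measureReal, h1, (indepFun_iff_map_prod_eq_prod_map_map hζ.aemeasurable
    hχ.aemeasurable).1 hindep.symm, Measure.prod_apply hSm,
    ← lintegral_const_mul' _ _ ENNReal.ofReal_ne_top]
  refine lintegral_congr fun x => ?_
  rw [Measure.map_apply hχ (measurable_prodMk_left hSm)]
  by_cases hx : 0 < g x
  · rw [polarKernel, if_pos hx, ← ENNReal.ofReal_mul hT.le, mul_div_cancel₀ _ hT.ne',
      ofReal_measureReal]
    congr 1
    ext ω
    -- The argument of the polar kernel is chosen so that the shifted threshold for `χ ^ α` is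
    -- exactly `maxVal g * y / g x`.
    have e : y + y * w y * (maxVal g / g x - 1) / w y = maxVal g * y / g x := by
      field_simp
      ring
    simp only [Set.mem_preimage, hS, Set.mem_ofPred_eq, e]
    rw [div_lt_iff₀ hx]
  -- In a direction with `g x ≤ 0` the product is nonpositive and cannot exceed the positive
  -- threshold.
  · rw [polarKernel, if_neg hx, ENNReal.ofReal_zero, mul_zero]
    rw [measure_eq_zero_iff_ae_notMem]
    filter_upwards [hχpos] with ω hω hmem
    have h2 : maxVal g * y < χ ω ^ α * g x := hmem
    have h3 : χ ω ^ α * g x ≤ 0 :=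
      mul_nonpos_of_nonneg_of_nonpos (Real.rpow_nonneg hω.le _) (not_lt.1 hx)
    have h4 : 0 < maxVal g * y := mul_pos hpos hy
    linarith

end Polar

end PolarChaos
end

/-! ### Conclusion. -/

noncomputable section

namespace PolarChaos

open scoped ENNReal NNReal

section Polar

variable {d m : ℕ} {α : ℝ} {g : E d → ℝ} {p : E (d - 1) → ℝ}
  {Ω : Type*} [MeasurableSpace Ω] {μ : Measure Ω} [IsProbabilityMeasure μ]
  {χ : Ω → ℝ} {ν : Ω → E (d - 1)} {ζ : Ω → E d} {w : ℝ → ℝ} {xp : EReal}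

/-- The tail of `g (χ ζ)` relative to the tail of `χ ^ α`. -/
theorem tendsto_tail_ratio (hg : IsNondegenerateMax m α g) (hp : IsAngularDensity m g p)
    (hχ : Measurable χ) (hχpos : ∀ᵐ ω ∂μ, 0 < χ ω) (hν : Measurable ν)
    (hζ : ζ = fun ω => sphPoint (ν ω))
    (hlaw : μ.map ν = (volume.restrict (angleBox d)).withDensity fun φ => ENNReal.ofReal (p φ))
    (hindep : IndepFun χ ζ μ)
    (hG : IsGumbelTail (fun x => μ.real {ω | x < χ ω ^ α}) w xp) :
    0 < limitMeasure g m p Set.univ ∧ limitMeasure g m p Set.univ < ∞ ∧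
      Tendsto (fun y => (y * w y) ^ (((d - 1 - m : ℕ) : ℝ) / 2) *
        μ.real {ω | maxVal g * y < g (χ ω • ζ ω)} / μ.real {ω | y < χ ω ^ α}) (upTo xp)
        (𝓝 (limitMeasure g m p Set.univ).toReal) := by
  have hd := hg.dim
  have hζm : Measurable ζ := by rw [hζ]; exact continuous_sphPoint.measurable.comp hν
  have : (upTo xp).NeBot := upTo_neBot hG.bot_lt
  have : IsProbabilityMeasure (μ.map ζ) := Measure.isProbabilityMeasure_map hζm.aemeasurable
  have hQ : ∀ h : E d → ℝ≥0∞, Measurable h → ∫⁻ x, h x ∂μ.map ζ =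
      ∫⁻ φ in regBox d 0, ENNReal.ofReal (sphDensity p (sphPoint φ)) * h (sphPoint φ) := by
    intro h hh
    rw [hζ]
    exact lintegral_direction (by omega) hν hlaw hp.cont hh
  have hQS : μ.map ζ (Metric.sphere 0 1)ᶜ = 0 := by
    rw [Measure.map_apply hζm Metric.isClosed_sphere.measurableSet.compl]
    convert measure_empty (μ := μ)
    ext ω
    simp [hζ, norm_sphPoint _ (show 1 ≤ d by omega)]
  obtain ⟨h1, h2, h3⟩ := tendsto_tailMeasure hg hp hQ hQS prob_le_one
    (upTo_isCountablyGenerated xp) hG.isExpKernel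
  refine ⟨h1, h2, ((ENNReal.tendsto_toReal h2.ne).comp h3).congr' ?_⟩
  have hy0 : ∀ᶠ y in upTo xp, 0 < y := eventually_upTo_gt hG.bot_lt (by exact_mod_cast hG.pos_end)
  filter_upwards [hy0, hG.wpos, hG.eventually_pos] with y hy hw hT
  have hkey := ofReal_tail_eq_lintegral hg hχ hχpos hζm hindep hy hw hT
  have hA : 0 ≤ (y * w y) ^ (((d - 1 - m : ℕ) : ℝ) / 2) := by positivity
  simp only [Function.comp]
  rw [tailMeasure, Measure.smul_apply, withDensity_apply _ MeasurableSet.univ, setLIntegral_univ,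
    smul_eq_mul, ENNReal.toReal_mul, ENNReal.toReal_ofReal hA, mul_div_assoc]
  congr 1
  rw [eq_div_iff hT.ne']
  have h4 := congrArg ENNReal.toReal hkey
  rw [ENNReal.toReal_ofReal measureReal_nonneg, ENNReal.toReal_mul, ENNReal.toReal_ofReal hT.le] at h4
  rw [h4, mul_comm]

/-- Tail equivalence and the Gumbel domain of attraction for `g (χ ζ)`. -/
theorem isGMDA_polar (hg : IsNondegenerateMax m α g) (hχpos : ∀ᵐ ω ∂μ, 0 < χ ω)
    (hζ : ∀ ω, ‖ζ ω‖ = 1)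
    (hG : IsGumbelTail (fun x => μ.real {ω | x < χ ω ^ α}) w xp) {L : ℝ} (hL : 0 < L)
    (hLeq : L = (2 * Real.pi * maxVal g) ^ (((d - 1 - m : ℕ) : ℝ) / 2) *
      ∫ φ in angularMaxSet g, leadingIntegrand g p φ ∂μHE[m])
    (hlim : Tendsto (fun y => (y * w y) ^ (((d - 1 - m : ℕ) : ℝ) / 2) *
      μ.real {ω | maxVal g * y < g (χ ω • ζ ω)} / μ.real {ω | y < χ ω ^ α}) (upTo xp) (𝓝 L)) :
    0 < leadingConst m g p ∧
      ((fun x : ℝ => μ.real {ω | x < g (χ ω • ζ ω)}) ~[upTo ((maxVal g : EReal) * xp)]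
        fun x : ℝ => leadingConst m g p / (x * w (x / maxVal g)) ^ (((d : ℝ) - 1 - m) / 2) *
          μ.real {ω | x / maxVal g < χ ω ^ α}) ∧
      IsGMDA μ (fun ω => g (χ ω • ζ ω)) (fun x => w (x / maxVal g) / maxVal g)
        ((maxVal g : EReal) * xp) := by
  have hd := hg.dim
  have hpos := hg.max_pos
  have hdiv := tendsto_upTo_div hpos hG.pos_end
  have hκ : ((d : ℝ) - 1 - m) / 2 = ((d - 1 - m : ℕ) : ℝ) / 2 := by
    rw [Nat.cast_sub (by omega), Nat.cast_sub (by omega), Nat.cast_one]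
  set κ : ℝ := ((d - 1 - m : ℕ) : ℝ) / 2 with hκdef
  -- The extra factor `maxVal g ^ κ`, which turns `maxVal g` into its square in the constant, comes
  -- from `x * w (x / maxVal g)` being `maxVal g` times the scale at `x / maxVal g`.
  have hconst : leadingConst m g p = maxVal g ^ κ * L := by
    rw [leadingConst, hκ, hLeq, ← mul_assoc, ← Real.mul_rpow hpos.le (by positivity)]
    congr 2
    ring
  have hcancel : ∀ x : ℝ, maxVal g * (x / maxVal g) = x := fun x => mul_div_cancel₀ x hpos.ne'
  have hequiv := (hG.isEquivalent hL hlim).comp_tendsto hdiv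
  have hshift : ∀ t, _ := fun t => (hG.isEquivalent_shift hL hlim t).comp_tendsto hdiv
  have hPpos := hdiv.eventually (hG.eventually_pos_of_tendsto hL hlim)
  simp only [Function.comp_def, hcancel] at hequiv hshift hPpos
  refine ⟨by rw [hconst]; positivity, ?_, ?_, ?_, ?_⟩
  · refine hequiv.congr_right ?_
    filter_upwards [hdiv.eventually (hG.tendsto_scale.eventually_gt_atTop 0)] with x hx
    have e1 : x * w (x / maxVal g) = maxVal g * (x / maxVal g * w (x / maxVal g)) := by
      field_simp
    rw [hκ, hconst, e1, Real.mul_rpow hpos.le hx.le, mul_div_mul_left _ _ (by positivity)]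
  · -- the upper endpoint
    refine le_antisymm ?_ ?_
    · refine sSup_le ?_
      rintro _ ⟨x, hx, rfl⟩
      -- The endpoint cannot exceed `maxVal g * xp`, because `g (χ ζ) ≤ maxVal g * χ ^ α`.
      -- Conversely the tail is positive arbitrarily close to that value.
      have hle : μ.real {ω | x < g (χ ω • ζ ω)} ≤ μ.real {ω | x / maxVal g < χ ω ^ α} := by
        refine ENNReal.toReal_mono (measure_ne_top _ _) (measure_mono_ae ?_)
        filter_upwards [hχpos] with ω hω hmem
        have h1 : x < g (χ ω • ζ ω) := hmem
        rw [hg.hom _ _ hω] at h1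
        have h2 : χ ω ^ α * g (ζ ω) ≤ χ ω ^ α * maxVal g :=
          mul_le_mul_of_nonneg_left (hg.le_maxVal (hζ ω)) (Real.rpow_nonneg hω.le _)
        change x / maxVal g < χ ω ^ α
        rw [div_lt_iff₀ hpos]
        linarith
      have h3 := hG.le_of_pos (x / maxVal g) (lt_of_lt_of_le hx hle)
      have h4 := (coe_mul_le_coe_mul_iff hpos hG.pos_end (x / maxVal g)).2.2 h3
      rwa [hcancel] at h4
    · refine le_of_forall_lt fun c hc => ?_
      obtain ⟨b, hcb, hb⟩ := EReal.lt_iff_exists_real_btwn.1 hc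
      have hbot := bot_lt_coe_mul hpos hG.pos_end
      have := upTo_neBot hbot
      obtain ⟨x, hx1, hx2⟩ := (hPpos.and (eventually_upTo_gt hbot hb)).exists
      have h5 : (b : EReal) < x := by exact_mod_cast hx2
      exact (hcb.trans h5).trans_le (le_sSup ⟨x, hx1, rfl⟩)
  · filter_upwards [hdiv.eventually hG.wpos] with x hx
    positivity
  · intro t
    refine (hshift t).congr_left (Eventually.of_forall fun x => ?_)
    -- In the variable `x = maxVal g * y`, the shift by `t / w y` becomes a shift by `t` divided by
    -- the rescaled weight.
    have e : maxVal g * (x / maxVal g + t / w (x / maxVal g)) =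
        x + t / (w (x / maxVal g) / maxVal g) := by
      rw [mul_add, hcancel, div_div_eq_mul_div]
      ring
    simp only [e]

end Polar

end PolarChaos
end

theorem theorem3
    {d m : ℕ} (hm : 1 ≤ m) (hmd : m + 2 ≤ d)
    -- the homogeneous function
    (α : ℝ) (hα : 0 < α) (g : PolarChaos.E d → ℝ)
    (hhom : ∀ (c : ℝ) (u : PolarChaos.E d), 0 < c → g (c • u) = c ^ α * g u)
    (hC2 : ContDiffOn ℝ 2 g {0}ᶜ)
    (hpos : 0 < PolarChaos.maxVal g)
    -- the maximum set is an `m`-dimensional `C²` manifold, approached non-degenerately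
    (hman : PolarChaos.IsC2Submanifold m (PolarChaos.maxSet g))
    (hrank : ∀ v ∈ PolarChaos.maxSet g, ∀ u : Fin (d - 1) → PolarChaos.E d,
      Orthonormal ℝ u → (∀ i, inner ℝ (u i) v = 0) →
      ((PolarChaos.maxVal g * α)⁻¹ • PolarChaos.tangentHessian g v u - 1).rank = d - 1 - m)
    -- the polar random vector `χ ζ`, with `ζ` having angular coordinates `ν`
    {Ω : Type*} [MeasurableSpace Ω] (μ : Measure Ω) [IsProbabilityMeasure μ]
    (χ : Ω → ℝ) (hχ : Measurable χ) (hχpos : ∀ᵐ ω ∂μ, 0 < χ ω)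
    (ν : Ω → PolarChaos.E (d - 1)) (hν : Measurable ν)
    (ζ : Ω → PolarChaos.E d) (hζ : ∀ ω, ζ ω = PolarChaos.sphPoint (ν ω))
    (hindep : IndepFun χ ζ μ)
    (w : ℝ → ℝ) (xp : EReal)
    (hGMDA : PolarChaos.IsGMDA μ (fun ω => χ ω ^ α) w xp)
    -- `ν` has the density `p`
    (p : PolarChaos.E (d - 1) → ℝ)
    (hlaw : μ.map ν =
      (volume.restrict (PolarChaos.angleBox d)).withDensity fun φ => ENNReal.ofReal (p φ))
    (hp_pos : ∀ φ ∈ PolarChaos.regAngles d, 0 < p φ)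
    (hp_bdd : ∃ C : ℝ, ∀ φ ∈ PolarChaos.regAngles d, p φ ≤ C)
    (hp_cont : PolarChaos.AngularContinuous p)
    -- behaviour where the coordinates degenerate (void if the maximum set avoids that locus)
    (hsing_null : Measure.euclideanHausdorffMeasure m
      (PolarChaos.maxSet g ∩ PolarChaos.sphSing d) = 0)
    (hsing_dens : ∀ v ∈ PolarChaos.maxSet g ∩ PolarChaos.sphSing d, ∃ l : ℝ, 0 < l ∧
      Tendsto (fun φ => p φ / |PolarChaos.sphJac φ|)
        (comap PolarChaos.sphPoint (𝓝 v) ⊓ 𝓟 (PolarChaos.regAngles d)) (𝓝 l)) :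
    IntegrableOn (PolarChaos.leadingIntegrand g p) (PolarChaos.angularMaxSet g)
        (Measure.euclideanHausdorffMeasure m) ∧
      0 < PolarChaos.leadingConst m g p ∧
      ((fun x : ℝ => μ.real {ω | x < g (χ ω • ζ ω)})
        ~[PolarChaos.upTo ((PolarChaos.maxVal g : EReal) * xp)]
        fun x : ℝ => PolarChaos.leadingConst m g p /
            (x * w (x / PolarChaos.maxVal g)) ^ (((d : ℝ) - 1 - m) / 2) *
          μ.real {ω | x / PolarChaos.maxVal g < χ ω ^ α}) ∧
      PolarChaos.IsGMDA μ (fun ω => g (χ ω • ζ ω))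
        (fun x => w (x / PolarChaos.maxVal g) / PolarChaos.maxVal g)
        ((PolarChaos.maxVal g : EReal) * xp) := by
  have hg : PolarChaos.IsNondegenerateMax m α g := ⟨hmd, hα, hhom, hC2, hpos, hman, hrank⟩
  have hp : PolarChaos.IsAngularDensity m g p := ⟨hp_pos, hp_bdd, hp_cont, hsing_null, hsing_dens⟩
  have hζe : ζ = fun ω => PolarChaos.sphPoint (ν ω) := funext hζ
  have hζm : Measurable ζ := by
    rw [hζe]; exact PolarChaos.continuous_sphPoint.measurable.comp hν
  have hG := hGMDA.isGumbelTail (hχpos.mono fun ω hω => Real.rpow_pos_of_pos hω α)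
  obtain ⟨hΛ, hΛfin, hlim⟩ := PolarChaos.tendsto_tail_ratio hg hp hχ hχpos hν hζe hlaw hindep hG
  obtain ⟨hint, hΛeq⟩ := PolarChaos.integrableOn_leadingIntegrand hg hp hΛfin
  obtain ⟨hconst, hequiv, hgmda⟩ := PolarChaos.isGMDA_polar hg hχpos (ζ := ζ)
    (fun ω => by rw [hζ]; exact PolarChaos.norm_sphPoint _ (by omega)) hG
    (ENNReal.toReal_pos hΛ.ne' hΛfin.ne) hΛeq hlim
  exact ⟨hint, hconst, hequiv, hgmda⟩
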